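/- Let $H$ be a finite dimensional Hopf algebra over $\mathbb{C}$ with antipode $S$, universal $R$-matrix $R=\sum_i a_i\otimes b_i$ and ribbon element $v$; put $R'=\sum_i b_i\otimes a_i$, $u=\sum_i S(b_i)a_i$ and $g=uv^{-1}$. Here $v$ is central and invertible, $\Delta(v)=(R'R)^{-1}(v\otimes v)$, $S(v)=v$, $\varepsilon(v)=1$, $v^2=uS(u)$. Assume that $H$ is factorizable, i.e. $\Psi:H^*\to H$, $\beta\mapsto(\beta\otimes\mathrm{id})(RR')$, is bijective. Let $\mu^l\neq0$ be a left integral on $H$, $(\mathrm{id}\otimes\mu^l)\Delta(x)=\mu^l(x)1$ for all $x$, and $\mu^r=\mu^l\circ S^{-1}$. Let $\mathcal{Z}(H)$ be the centre of $H$ and $\mathrm{SLF}(H)=\{\varphi\in H^*\mid\varphi(xy)=\varphi(yx)\ \forall x,y\in H\}$. *Loop and handle algebras.* For a finite dimensional $H$-module $I$ let $\overset{I}{T}$ be the matrix of its matrix coefficients, with entries in $H^*$. The loop algebra $\mathcal{L}_{0,1}(H)$ is the quotient of the tensor algebra of $H^*$ by the relations $\overset{I\otimes J}{M}=\overset{I}{M}_1\,\overset{IJ}{R'}_{12}\,\overset{J}{M}_2\,(\overset{IJ}{R'}_{12})^{-1}$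 for all finite dimensional modules $I,J$, where $\overset{I}{M}$ is the matrix of the classes of the entries of $\overset{I}{T}$, $X_1=X\otimes 1$, $X_2=1\otimes X$, and $\overset{IJ}{R}$, $\overset{IJ}{R'}$ are the matrices of $R$, $R'$ on $I\otimes J$. It is identified with $H$ through $\overset{I}{M}\mapsto(\overset{I}{T}\otimes\mathrm{id})(RR')$, so that $x\in H$ corresponds to the class of $\Psi^{-1}(x)$. The handle algebra $\mathcal{L}_{1,0}(H)$ is the quotient of the free product of two copies of $\mathcal{L}_{0,1}(H)$, whose matrices $\overset{I}{M}$ are denoted $\overset{I}{B}$ and $\overset{I}{A}$ respectively, by the relations $\overset{IJ}{R}_{12}\overset{I}{B}_1\overset{IJ}{R'}_{12}\overset{J}{A}_2=\overset{J}{A}_2\overset{IJ}{R}_{12}\overset{I}{B}_1(\overset{IJ}{R}_{12})^{-1}$. For $x\in H$, $x_B$ and $x_A$ denote the images of $x$ in $\mathcal{L}_{1,0}(H)$ through the first and the second copy of $\mathcal{L}_{0,1}(H)\cong H$. The algebra $\mathcal{L}_{1,0}(H)$ acts on $H^*$ by the representation $\rho$ determined by $\overset{I}{B}\mapsto\overset{I}{L}{}^{(+)}\,\overset{I}{T}\,(\overset{I}{L}{}^{(-)})^{-1}$,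 $\overset{I}{A}\mapsto\overset{I}{L}{}^{(+)}(\overset{I}{L}{}^{(-)})^{-1}$, where $\overset{I}{L}{}^{(+)}=(\overset{I}{T}\otimes\mathrm{id})(R)$, $\overset{I}{L}{}^{(-)}=(\overset{I}{T}\otimes\mathrm{id})((R')^{-1})$, $h\in H$ acts on $H^*$ by $\varphi\mapsto\varphi(?\,h)$, and $\psi\in H^*$ acts by $\varphi\mapsto\psi\varphi=(\psi\otimes\varphi)\circ\Delta$. *The two projective representations.* In $\mathrm{SL}_2(\mathbb{Z})$ let $\tau_a=\begin{pmatrix}1&1\\0&1\end{pmatrix}$, $\tau_b=\begin{pmatrix}1&0\\-1&1\end{pmatrix}$, $t=\tau_a$ and $s=\tau_a^{-1}\tau_b^{-1}\tau_a^{-1}=\begin{pmatrix}0&-1\\1&0\end{pmatrix}$. Let $\theta_1:\mathrm{SL}_2(\mathbb{Z})\to\mathrm{PGL}(\mathrm{SLF}(H))$ be the projective representation which sends $\tau_a$ and $\tau_b$ to the classes of the restrictions to $\mathrm{SLF}(H)$ of $\rho\bigl((v^{-1})_A\bigr)$ and $\rho\bigl((v^{-1})_B\bigr)$. Let $\rho_{\mathrm{LM}}:\mathrm{SL}_2(\mathbb{Z})\to\mathrm{PGL}(\mathcal{Z}(H))$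 be the Lyubashenko--Majid projective representation, which sends $s$ and $t$ to the classes of the restrictions to $\mathcal{Z}(H)$ of $$\mathcal{S}(x)=(\mathrm{id}\otimes\mu^l)\bigl(R^{-1}(1\otimes x)R'^{-1}\bigr),\qquad \mathcal{T}(x)=v^{-1}x .$$ **Theorem.** The representation $\rho$ of $\mathcal{L}_{1,0}(H)$ and the projective representations $\theta_1$ and $\rho_{\mathrm{LM}}$ are well defined, and $\theta_1$ is equivalent to $\rho_{\mathrm{LM}}$. More precisely, $$f:\mathcal{Z}(H)\to\mathrm{SLF}(H),\qquad f(z)=\mu^r\bigl(g\,v^{-1}S(z)\,?\bigr)$$ is an isomorphism of vector spaces, and $\theta_1(\gamma)=[f]\,\rho_{\mathrm{LM}}(\gamma)\,[f]^{-1}$ in $\mathrm{PGL}(\mathrm{SLF}(H))$ for all $\gamma\in\mathrm{SL}_2(\mathbb{Z})$. -/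

import Mathlib

open scoped TensorProduct Kronecker MatrixGroups

noncomputable section

namespace TorusRep

/-! ### Braided, factorizable and ribbon Hopf algebras -/

section Hopf

variable {H : Type*} [Ring H] [HopfAlgebra ℂ H]

/-- The flip `x ⊗ y ↦ y ⊗ x`, as an algebra automorphism of `H ⊗ H`. -/
def flip : H ⊗[ℂ] H →ₐ[ℂ] H ⊗[ℂ] H :=
  (Algebra.TensorProduct.comm ℂ H H : H ⊗[ℂ] H ≃ₐ[ℂ] H ⊗[ℂ] H).toAlgHom

/-- For `R = ∑ aᵢ ⊗ bᵢ`, the element `R' = ∑ bᵢ ⊗ aᵢ`. -/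
def swapped (R : (H ⊗[ℂ] H)ˣ) : (H ⊗[ℂ] H)ˣ :=
  Units.map (flip (H := H) : H ⊗[ℂ] H →* H ⊗[ℂ] H) R

/-- `x ⊗ y ↦ x ⊗ y ⊗ 1`. -/
def leg12 : H ⊗[ℂ] H →ₐ[ℂ] H ⊗[ℂ] (H ⊗[ℂ] H) :=
  Algebra.TensorProduct.map (AlgHom.id ℂ H) Algebra.TensorProduct.includeLeft

/-- `x ⊗ y ↦ x ⊗ 1 ⊗ y`. -/
def leg13 : H ⊗[ℂ] H →ₐ[ℂ] H ⊗[ℂ] (H ⊗[ℂ] H) :=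
  Algebra.TensorProduct.map (AlgHom.id ℂ H) Algebra.TensorProduct.includeRight

/-- `x ⊗ y ↦ 1 ⊗ x ⊗ y`. -/
def leg23 : H ⊗[ℂ] H →ₐ[ℂ] H ⊗[ℂ] (H ⊗[ℂ] H) :=
  Algebra.TensorProduct.includeRight

/-- `R` is a universal `R`-matrix on the Hopf algebra `H`. -/
structure IsUniversalRMatrix (R : (H ⊗[ℂ] H)ˣ) : Prop where
  comul_op : ∀ h : H, (R : H ⊗[ℂ] H) * Coalgebra.comul (R := ℂ) h =
    flip (Coalgebra.comul (R := ℂ) h) * (R : H ⊗[ℂ] H)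
  comul_left : Algebra.TensorProduct.assoc ℂ ℂ ℂ H H H
      (Algebra.TensorProduct.map (Bialgebra.comulAlgHom ℂ H) (AlgHom.id ℂ H) (R : H ⊗[ℂ] H)) =
    leg13 (R : H ⊗[ℂ] H) * leg23 (R : H ⊗[ℂ] H)
  comul_right : Algebra.TensorProduct.map (AlgHom.id ℂ H) (Bialgebra.comulAlgHom ℂ H)
      (R : H ⊗[ℂ] H) =
    leg13 (R : H ⊗[ℂ] H) * leg12 (R : H ⊗[ℂ] H)

/-- `slice X β = (β ⊗ id)(X)`, linear in `β`. -/
def slice (X : H ⊗[ℂ] H) : Module.Dual ℂ H →ₗ[ℂ] H :=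
  (TensorProduct.lid ℂ H).toLinearMap ∘ₗ LinearMap.applyₗ X ∘ₗ LinearMap.rTensorHom H

/-- The map `Ψ : H* → H`, `β ↦ (β ⊗ id)(R R')`. -/
def psiMap (R : (H ⊗[ℂ] H)ˣ) : Module.Dual ℂ H →ₗ[ℂ] H :=
  slice ((R : H ⊗[ℂ] H) * (swapped R : H ⊗[ℂ] H))

/-- `(H, R)` is factorizable: `Ψ` is an isomorphism of vector spaces. -/
def IsFactorizable (R : (H ⊗[ℂ] H)ˣ) : Prop :=
  Function.Bijective (psiMap R)

/-- The Drinfeld element `u = ∑ S(bᵢ) aᵢ`. -/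
def drinfeldElement (R : (H ⊗[ℂ] H)ˣ) : H :=
  LinearMap.mul' ℂ H ((HopfAlgebra.antipode ℂ (A := H)).rTensor H (swapped R : H ⊗[ℂ] H))

/-- `v` is a ribbon element of the braided Hopf algebra `(H, R)`. -/
structure IsRibbonElement (R : (H ⊗[ℂ] H)ˣ) (v : Hˣ) : Prop where
  central : (v : H) ∈ Subalgebra.center ℂ H
  comul_eq : Coalgebra.comul (R := ℂ) (v : H) =
    ((swapped R * R)⁻¹ : (H ⊗[ℂ] H)ˣ) * ((v : H) ⊗ₜ[ℂ] (v : H))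
  antipode_eq : HopfAlgebra.antipode ℂ (v : H) = v
  counit_eq : Coalgebra.counit (R := ℂ) (v : H) = 1
  sq_eq : (v : H) ^ 2 = drinfeldElement R * HopfAlgebra.antipode ℂ (drinfeldElement R)

/-- The canonical pivotal element `g = u v⁻¹`. -/
def pivot (R : (H ⊗[ℂ] H)ˣ) (v : Hˣ) : H :=
  drinfeldElement R * (v⁻¹ : Hˣ)

/-- `μ` is a left integral on `H`: `μ ≠ 0` and `(id ⊗ μ)(Δ(x)) = μ(x) 1` for all `x`. -/
structure IsLeftIntegral (μ : Module.Dual ℂ H) : Prop where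
  ne_zero : μ ≠ 0
  integral : ∀ x : H,
    TensorProduct.rid ℂ H (μ.lTensor H (Coalgebra.comul (R := ℂ) x)) = μ x • (1 : H)

variable (H) in
/-- The space of symmetric linear forms on `H`. -/
def SLF : Submodule ℂ (Module.Dual ℂ H) where
  carrier := {φ | ∀ x y : H, φ (x * y) = φ (y * x)}
  add_mem' := fun {a b} ha hb x y => by simp [ha x y, hb x y]
  zero_mem' := fun _ _ => rfl
  smul_mem' := fun c a ha x y => by simp [ha x y]

variable (H) in
/-- The centre of `H`, as a vector space. -/
def centre : Submodule ℂ H :=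
  Subalgebra.toSubmodule (Subalgebra.center ℂ H)

end Hopf

/-! ### Matrix notation -/

section Matrices

variable {H : Type*} [Ring H] [HopfAlgebra ℂ H]
  {m n : Type} [Fintype m] [DecidableEq m] [Fintype n] [DecidableEq n]

/-- A finite dimensional `H`-module with a chosen basis indexed by `n`, that is a morphism of
algebras from `H` to matrices. -/
abbrev MatRep (H : Type*) [Ring H] [HopfAlgebra ℂ H] (n : Type) [Fintype n] [DecidableEq n] :=
  H →ₐ[ℂ] Matrix n n ℂ

/-- The matrix coefficient `T^a_b` of the module `I`. -/
def coeff (I : MatRep H n) (a b : n) : Module.Dual ℂ H :=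
  Matrix.entryLinearMap ℂ ℂ a b ∘ₗ I.toLinearMap

/-- The representation of elements of `H ⊗ H` on the tensor product of vector spaces `I ⊗ J`. -/
def rep₂ (I : MatRep H m) (J : MatRep H n) : H ⊗[ℂ] H →ₐ[ℂ] Matrix (m × n) (m × n) ℂ :=
  (Matrix.kroneckerAlgEquiv m n ℂ).toAlgHom.comp (Algebra.TensorProduct.map I J)

/-- The `H`-module `I ⊗ J`. -/
def tensorRep (I : MatRep H m) (J : MatRep H n) : MatRep H (m × n) :=
  (rep₂ I J).comp (Bialgebra.comulAlgHom ℂ H)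

variable {A : Type*} [Semiring A] [Algebra ℂ A]

/-- A scalar matrix seen with coefficients in the algebra `A`. -/
def scal (A : Type*) [Semiring A] [Algebra ℂ A] (X : Matrix n n ℂ) : Matrix n n A :=
  X.map (algebraMap ℂ A)

/-- The embedding `M ↦ M₁ = M ⊗ 1`. -/
def emb₁ (n : Type) [Fintype n] [DecidableEq n] (M : Matrix m m A) : Matrix (m × n) (m × n) A :=
  M ⊗ₖ (1 : Matrix n n A)

/-- The embedding `N ↦ N₂ = 1 ⊗ N`. -/
def emb₂ (m : Type) [Fintype m] [DecidableEq m] (N : Matrix n n A) : Matrix (m × n) (m × n) A :=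
  (1 : Matrix m m A) ⊗ₖ N

/-- The map `x ⊗ y ↦ (matrix of x on I) y`, from `H ⊗ H` to matrices with coefficients in `H`;
in other words `T_I ⊗ id`. -/
def matEval (I : MatRep H n) : H ⊗[ℂ] H →ₐ[ℂ] Matrix n n H :=
  ((matrixEquivTensor n ℂ H).symm.toAlgHom.comp
    (Algebra.TensorProduct.map (AlgHom.id ℂ H) I)).comp flip

/-- The matrix `L⁽⁺⁾ = (T ⊗ id)(R)`. -/
def Lplus (R : (H ⊗[ℂ] H)ˣ) (I : MatRep H n) : Matrix n n H :=
  matEval I (R : H ⊗[ℂ] H)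

/-- The matrix `L⁽⁻⁾ = (T ⊗ id)((R')⁻¹)`. -/
def Lminus (R : (H ⊗[ℂ] H)ˣ) (I : MatRep H n) : Matrix n n H :=
  matEval I (((swapped R)⁻¹ : (H ⊗[ℂ] H)ˣ) : H ⊗[ℂ] H)

/-- The inverse `(T ⊗ id)(R')` of the matrix `L⁽⁻⁾`. -/
def LminusInv (R : (H ⊗[ℂ] H)ˣ) (I : MatRep H n) : Matrix n n H :=
  matEval I (swapped R : H ⊗[ℂ] H)

theorem Lminus_mul_LminusInv (R : (H ⊗[ℂ] H)ˣ) (I : MatRep H n) :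
    Lminus R I * LminusInv R I = 1 ∧ LminusInv R I * Lminus R I = 1 := by
  constructor
  · rw [Lminus, LminusInv, ← map_mul, Units.inv_mul, map_one]
  · rw [Lminus, LminusInv, ← map_mul, Units.mul_inv, map_one]

end Matrices

/-! ### The loop algebra and the handle algebra -/

section Algebras

variable {H : Type*} [Ring H] [HopfAlgebra ℂ H]

/-- The matrix with coefficients `T^a_b`, in the tensor algebra of `H*`. -/
def freeMat {n : Type} [Fintype n] [DecidableEq n] (I : MatRep H n) :
    Matrix n n (TensorAlgebra ℂ (Module.Dual ℂ H)) :=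
  Matrix.of fun a b => TensorAlgebra.ι ℂ (coeff I a b)

/-- The matrix `M_I₁ R'₁₂ M_J₂ R'₁₂⁻¹`, with coefficients in the tensor algebra of `H*`. -/
def fusionMat (R : (H ⊗[ℂ] H)ˣ) {m n : Type} [Fintype m] [DecidableEq m] [Fintype n]
    [DecidableEq n] (I : MatRep H m) (J : MatRep H n) :
    Matrix (m × n) (m × n) (TensorAlgebra ℂ (Module.Dual ℂ H)) :=
  emb₁ n (freeMat I) * scal _ (rep₂ I J (swapped R : H ⊗[ℂ] H)) *
    emb₂ m (freeMat J) * scal _ (rep₂ I J (((swapped R)⁻¹ : (H ⊗[ℂ] H)ˣ) : H ⊗[ℂ] H))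

/-- The fusion relations `M_{I ⊗ J} = M_I₁ R'₁₂ M_J₂ R'₁₂⁻¹`, for all finite dimensional
modules `I`, `J` and coefficient by coefficient. -/
inductive LoopRel (R : (H ⊗[ℂ] H)ˣ) :
    TensorAlgebra ℂ (Module.Dual ℂ H) → TensorAlgebra ℂ (Module.Dual ℂ H) → Prop
  | fusion {m n : ℕ} (I : MatRep H (Fin m)) (J : MatRep H (Fin n)) (p q : Fin m × Fin n) :
      LoopRel R (freeMat (tensorRep I J) p q) (fusionMat R I J p q)

/-- The loop algebra `𝓛₀,₁(H)`. -/
abbrev LoopAlgebra (R : (H ⊗[ℂ] H)ˣ) := RingQuot (LoopRel R)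

/-- The linear map `H* → 𝓛₀,₁(H)`, which sends `T^a_b` to `M^a_b`. -/
def loopι (R : (H ⊗[ℂ] H)ˣ) : Module.Dual ℂ H →ₗ[ℂ] LoopAlgebra R :=
  (RingQuot.mkAlgHom ℂ (LoopRel R)).toLinearMap ∘ₗ TensorAlgebra.ι ℂ

/-- The matrix `M_I` with coefficients in `𝓛₀,₁(H)`. -/
def matM (R : (H ⊗[ℂ] H)ˣ) {n : Type} [Fintype n] [DecidableEq n] (I : MatRep H n) :
    Matrix n n (LoopAlgebra R) :=
  Matrix.of fun a b => loopι R (coeff I a b)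

/-- The free product `𝓛₀,₁(H) * 𝓛₀,₁(H)`. The first copy is labelled by `false` and the second
one by `true`. -/
abbrev LoopFree (R : (H ⊗[ℂ] H)ˣ) :=
  LinearAlgebra.FreeProduct ℂ (fun _ : Bool => LoopAlgebra R)

/-- The matrix `B_I`, with coefficients in the free product: the matrix `M_I` in the first
copy of the loop algebra. -/
def freeB (R : (H ⊗[ℂ] H)ˣ) {n : Type} [Fintype n] [DecidableEq n] (I : MatRep H n) :
    Matrix n n (LoopFree R) :=
  (matM R I).map (LinearAlgebra.FreeProduct.ι ℂ (fun _ : Bool => LoopAlgebra R) false)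

/-- The matrix `A_I`, with coefficients in the free product: the matrix `M_I` in the second
copy of the loop algebra. -/
def freeA (R : (H ⊗[ℂ] H)ˣ) {n : Type} [Fintype n] [DecidableEq n] (I : MatRep H n) :
    Matrix n n (LoopFree R) :=
  (matM R I).map (LinearAlgebra.FreeProduct.ι ℂ (fun _ : Bool => LoopAlgebra R) true)

/-- The matrix `R₁₂ B_I₁ R'₁₂ A_J₂`. -/
def exchangeLeft (R : (H ⊗[ℂ] H)ˣ) {m n : Type} [Fintype m] [DecidableEq m] [Fintype n]
    [DecidableEq n] (I : MatRep H m) (J : MatRep H n) : Matrix (m × n) (m × n) (LoopFree R) :=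
  scal _ (rep₂ I J (R : H ⊗[ℂ] H)) * emb₁ n (freeB R I) *
    scal _ (rep₂ I J (swapped R : H ⊗[ℂ] H)) * emb₂ m (freeA R J)

/-- The matrix `A_J₂ R₁₂ B_I₁ R₁₂⁻¹`. -/
def exchangeRight (R : (H ⊗[ℂ] H)ˣ) {m n : Type} [Fintype m] [DecidableEq m] [Fintype n]
    [DecidableEq n] (I : MatRep H m) (J : MatRep H n) : Matrix (m × n) (m × n) (LoopFree R) :=
  emb₂ m (freeA R J) * scal _ (rep₂ I J (R : H ⊗[ℂ] H)) *
    emb₁ n (freeB R I) * scal _ (rep₂ I J ((R⁻¹ : (H ⊗[ℂ] H)ˣ) : H ⊗[ℂ] H))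

/-- The exchange relations `R₁₂ B_I₁ R'₁₂ A_J₂ = A_J₂ R₁₂ B_I₁ R₁₂⁻¹`, for all finite dimensional
modules `I`, `J` and coefficient by coefficient. -/
inductive HandleRel (R : (H ⊗[ℂ] H)ˣ) : LoopFree R → LoopFree R → Prop
  | exchange {m n : ℕ} (I : MatRep H (Fin m)) (J : MatRep H (Fin n)) (p q : Fin m × Fin n) :
      HandleRel R (exchangeLeft R I J p q) (exchangeRight R I J p q)

/-- The handle algebra `𝓛₁,₀(H)`. -/
abbrev HandleAlgebra (R : (H ⊗[ℂ] H)ˣ) := RingQuot (HandleRel R)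

/-- The morphism `j_B : 𝓛₀,₁(H) → 𝓛₁,₀(H)`, `M ↦ B`. -/
def jB (R : (H ⊗[ℂ] H)ˣ) : LoopAlgebra R →ₐ[ℂ] HandleAlgebra R :=
  (RingQuot.mkAlgHom ℂ (HandleRel R)).comp
    (LinearAlgebra.FreeProduct.ι ℂ (fun _ : Bool => LoopAlgebra R) false)

/-- The morphism `j_A : 𝓛₀,₁(H) → 𝓛₁,₀(H)`, `M ↦ A`. -/
def jA (R : (H ⊗[ℂ] H)ˣ) : LoopAlgebra R →ₐ[ℂ] HandleAlgebra R :=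
  (RingQuot.mkAlgHom ℂ (HandleRel R)).comp
    (LinearAlgebra.FreeProduct.ι ℂ (fun _ : Bool => LoopAlgebra R) true)

/-- The matrix `B_I` with coefficients in `𝓛₁,₀(H)`. -/
def matB (R : (H ⊗[ℂ] H)ˣ) {n : Type} [Fintype n] [DecidableEq n] (I : MatRep H n) :
    Matrix n n (HandleAlgebra R) :=
  (matM R I).map (jB R)

/-- The matrix `A_I` with coefficients in `𝓛₁,₀(H)`. -/
def matA (R : (H ⊗[ℂ] H)ˣ) {n : Type} [Fintype n] [DecidableEq n] (I : MatRep H n) :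
    Matrix n n (HandleAlgebra R) :=
  (matM R I).map (jA R)

/-- The element of `𝓛₀,₁(H)` identified with `x ∈ H`, when `(H, R)` is factorizable: the class of
the linear form `Ψ⁻¹(x)`. It is the preimage of `x` under the isomorphism `𝓛₀,₁(H) ≅ H` which
sends `M_I` to `L⁽⁺⁾_I L⁽⁻⁾_I⁻¹ = (T_I ⊗ id)(R R')`, see `rsd_loopOf` below. -/
def loopOf {R : (H ⊗[ℂ] H)ˣ} (hR : IsFactorizable R) (x : H) : LoopAlgebra R :=
  loopι R ((LinearEquiv.ofBijective (psiMap R) hR).symm x)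

end Algebras

/-! ### The action of the handle algebra on `H*` -/

section Action

variable {H : Type*} [Ring H] [HopfAlgebra ℂ H]

/-- The operator `h ▷ φ = φ(? h)` on `H*`, for `h ∈ H`. -/
def hAct (h : H) : Module.End ℂ (Module.Dual ℂ H) :=
  (LinearMap.mulRight ℂ h).dualMap

/-- The operator `ψ ▷ φ = ψ φ` on `H*`, for `ψ ∈ H*`, where `(ψ φ)(x) = (ψ ⊗ φ)(Δ(x))`. -/
def dAct (ψ : Module.Dual ℂ H) : Module.End ℂ (Module.Dual ℂ H) where
  toFun φ := LinearMap.mul' ℂ ℂ ∘ₗ TensorProduct.map ψ φ ∘ₗ Coalgebra.comul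
  map_add' a b := by
    rw [TensorProduct.map_add_right, LinearMap.add_comp, LinearMap.comp_add]
  map_smul' c a := by
    rw [TensorProduct.map_smul_right, LinearMap.smul_comp, LinearMap.comp_smul, RingHom.id_apply]

/-- The matrix `T_I` of operators on `H*`, acting by multiplication in `H*`. -/
def opT {n : Type} [Fintype n] [DecidableEq n] (I : MatRep H n) :
    Matrix n n (Module.End ℂ (Module.Dual ℂ H)) :=
  Matrix.of fun a b => dAct (coeff I a b)

/-- `ρ` is the representation `▷` of `𝓛₁,₀(H)` on `H*`. It is obtained from the morphism
`B ↦ L⁽⁺⁾ T L⁽⁻⁾⁻¹`, `A ↦ L⁽⁺⁾ L⁽⁻⁾⁻¹` with values in the Heisenberg double of `H*`, whose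
elements act on `H*` by `h ▷ φ = φ(? h)` for `h ∈ H` and `ψ ▷ φ = ψ φ` for `ψ ∈ H*`.
There is at most one such `ρ`, since the coefficients of the matrices `A_I` and `B_I` generate
the algebra `𝓛₁,₀(H)`. -/
structure IsHandleRep (R : (H ⊗[ℂ] H)ˣ)
    (ρ : HandleAlgebra R →ₐ[ℂ] Module.End ℂ (Module.Dual ℂ H)) : Prop where
  map_B : ∀ {n : ℕ} (I : MatRep H (Fin n)), (matB R I).map ρ =
    (Lplus R I).map hAct * opT I * (LminusInv R I).map hAct
  map_A : ∀ {n : ℕ} (I : MatRep H (Fin n)), (matA R I).map ρ =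
    (Lplus R I).map hAct * (LminusInv R I).map hAct

end Action

/-! ### Projective representations -/

section Projective

/-- The projective linear group `PGL(V)`, the quotient of `GL(V)` by its centre. -/
abbrev PGL (V : Type*) [AddCommGroup V] [Module ℂ V] :=
  LinearMap.GeneralLinearGroup ℂ V ⧸ Subgroup.center (LinearMap.GeneralLinearGroup ℂ V)

variable {V W : Type*} [AddCommGroup V] [Module ℂ V] [AddCommGroup W] [Module ℂ W]

theorem map_center_eq {G K : Type*} [Group G] [Group K] (e : G ≃* K) :
    (Subgroup.center G).map (e : G →* K) = Subgroup.center K := by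
  ext y
  rw [Subgroup.mem_map, Subgroup.mem_center_iff]
  constructor
  · rintro ⟨x, hx, rfl⟩ z
    rw [Subgroup.mem_center_iff] at hx
    obtain ⟨w, rfl⟩ := e.surjective z
    have := congrArg e (hx w)
    rw [map_mul, map_mul] at this
    exact this
  · intro hy
    refine ⟨e.symm y, ?_, e.apply_symm_apply y⟩
    rw [Subgroup.mem_center_iff]
    intro z
    apply e.injective
    rw [map_mul, map_mul, e.apply_symm_apply]
    exact hy (e z)

/-- Conjugation by a linear isomorphism `f`, `[P] ↦ [f P f⁻¹]`, from `PGL(V)` to `PGL(W)`. -/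
def PGL.conj (f : V ≃ₗ[ℂ] W) : PGL V ≃* PGL W :=
  QuotientGroup.congr _ _ (LinearMap.GeneralLinearGroup.congrLinearEquiv f)
    (map_center_eq (LinearMap.GeneralLinearGroup.congrLinearEquiv f))

/-- The subspace `U` of `V` is stable under the operator `t`, the restriction of `t` to `U` is
invertible, and its class in `PGL(U)` is `π`. -/
def IsClassOfRestriction (U : Submodule ℂ V) (t : Module.End ℂ V) (π : PGL U) : Prop :=
  ∃ P : LinearMap.GeneralLinearGroup ℂ U,
    (∀ w : U, (((P : Module.End ℂ U) w : U) : V) = t (w : V)) ∧ QuotientGroup.mk P = π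

/-- The Dehn twist `τ_a` in the mapping class group `SL₂(ℤ)` of the torus. -/
def tauA : SL(2, ℤ) := ⟨!![1, 1; 0, 1], by simp [Matrix.det_fin_two_of]⟩

/-- The Dehn twist `τ_b` in the mapping class group `SL₂(ℤ)` of the torus. -/
def tauB : SL(2, ℤ) := ⟨!![1, 0; -1, 1], by simp [Matrix.det_fin_two_of]⟩

/-- The element `s` of `SL₂(ℤ)`. -/
def sMat : SL(2, ℤ) := ⟨!![0, -1; 1, 0], by simp [Matrix.det_fin_two_of]⟩

/-- The element `t` of `SL₂(ℤ)`. -/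
def tMat : SL(2, ℤ) := ⟨!![1, 1; 0, 1], by simp [Matrix.det_fin_two_of]⟩

/-- The relations which link the two systems of generators. -/
theorem sMat_eq_and_tMat_eq : sMat = tauA⁻¹ * tauB⁻¹ * tauA⁻¹ ∧ tMat = tauA := by
  constructor
  · decide
  · rfl

/-- The generators satisfy the defining relations of both presentations of `SL₂(ℤ)`. -/
theorem generators_relations :
    tauA * tauB * tauA = tauB * tauA * tauB ∧ (tauA * tauB) ^ 6 = 1 ∧
      (sMat * tMat) ^ 3 = sMat ^ 2 ∧ sMat ^ 4 = 1 := by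
  decide

end Projective

section Theta

variable {H : Type*} [Ring H] [HopfAlgebra ℂ H]

/-- `θ` is the projective representation `θ₁` of `SL₂(ℤ)` on `SLF(H)`: with `ρ` the representation
of `𝓛₁,₀(H)` on `H*`, the Dehn twists `τ_a` and `τ_b` are sent to the classes of the restrictions
to `SLF(H)` of `ρ((v⁻¹)_A)` and `ρ((v⁻¹)_B)`. -/
structure IsTheta {R : (H ⊗[ℂ] H)ˣ} (hR : IsFactorizable R) (v : Hˣ)
    (ρ : HandleAlgebra R →ₐ[ℂ] Module.End ℂ (Module.Dual ℂ H))
    (θ : SL(2, ℤ) →* PGL (SLF H)) : Prop where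
  map_tauA : IsClassOfRestriction (SLF H) (ρ (jA R (loopOf hR (v⁻¹ : Hˣ)))) (θ tauA)
  map_tauB : IsClassOfRestriction (SLF H) (ρ (jB R (loopOf hR (v⁻¹ : Hˣ)))) (θ tauB)

/-- The operator `𝒮(x) = (id ⊗ μ)(R⁻¹ (1 ⊗ x) R'⁻¹)` on `H`. -/
def opS (R : (H ⊗[ℂ] H)ˣ) (μ : Module.Dual ℂ H) : Module.End ℂ H :=
  (TensorProduct.rid ℂ H).toLinearMap ∘ₗ μ.lTensor H ∘ₗ
    LinearMap.mulLeft ℂ ((R⁻¹ : (H ⊗[ℂ] H)ˣ) : H ⊗[ℂ] H) ∘ₗ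
    LinearMap.mulRight ℂ (((swapped R)⁻¹ : (H ⊗[ℂ] H)ˣ) : H ⊗[ℂ] H) ∘ₗ
    TensorProduct.mk ℂ H H 1

/-- The operator `𝒯(x) = v⁻¹ x` on `H`. -/
def opTwist (v : Hˣ) : Module.End ℂ H :=
  LinearMap.mulLeft ℂ ((v⁻¹ : Hˣ) : H)

/-- `σ` is the Lyubashenko--Majid projective representation of `SL₂(ℤ)` on the centre of `H`:
`s` and `t` are sent to the classes of the restrictions of `𝒮` and `𝒯` to the centre. -/
structure IsLyubashenkoMajid (R : (H ⊗[ℂ] H)ˣ) (v : Hˣ) (μ : Module.Dual ℂ H)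
    (σ : SL(2, ℤ) →* PGL (centre H)) : Prop where
  map_s : IsClassOfRestriction (centre H) (opS R μ) (σ sMat)
  map_t : IsClassOfRestriction (centre H) (opTwist v) (σ tMat)

end Theta

/-! ### The identification of the loop algebra with `H` -/

section Identification

variable {H : Type*} [Ring H] [HopfAlgebra ℂ H]

theorem slice_tmul (x y : H) (β : Module.Dual ℂ H) : slice (x ⊗ₜ[ℂ] y) β = β x • y := by
  simp [slice]

theorem matEval_apply {n : Type} [Fintype n] [DecidableEq n] (I : MatRep H n) (X : H ⊗[ℂ] H)
    (a b : n) : matEval I X a b = slice X (coeff I a b) := by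
  induction X with
  | zero => simp [slice]
  | add x y hx hy =>
    rw [map_add, Matrix.add_apply, hx, hy]
    simp [slice]
  | tmul x y =>
    rw [slice_tmul]
    simp [matEval, flip, coeff, matrixEquivTensor_apply_symm, Algebra.smul_def,
      Algebra.commutes]

theorem span_coeff [FiniteDimensional ℂ H] (β : Module.Dual ℂ H) :
    β ∈ Submodule.span ℂ {φ : Module.Dual ℂ H |
      ∃ (n : ℕ) (I : MatRep H (Fin n)) (a b : Fin n), φ = coeff I a b} := by
  set e := Module.finBasis ℂ H
  have key : β = ∑ j, ∑ i, (e.repr 1 j * β (e i)) • coeff (Algebra.leftMulMatrix e) i j := by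
    ext x
    have h1 : ∑ j, e.repr (1 : H) j • (x * e j) = x := by
      conv_rhs => rw [← mul_one x, ← e.sum_repr (1 : H), Finset.mul_sum]
      simp
    conv_lhs => rw [← h1, map_sum]
    rw [LinearMap.sum_apply]
    refine Finset.sum_congr rfl fun j _ => ?_
    rw [map_smul, LinearMap.sum_apply]
    conv_lhs => rw [← e.sum_repr (x * e j), map_sum, Finset.smul_sum]
    refine Finset.sum_congr rfl fun i _ => ?_
    simp [coeff, Algebra.leftMulMatrix_eq_repr_mul]
    ring
  rw [key]
  exact Submodule.sum_mem _ fun j _ => Submodule.sum_mem _ fun i _ =>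
    Submodule.smul_mem _ _ (Submodule.subset_span ⟨_, _, i, j, rfl⟩)

/-- The morphism `𝓛₀,₁(H) → H`, `M ↦ L⁽⁺⁾ L⁽⁻⁾⁻¹`, sends `loopOf hR x` to `x`. -/
theorem rsd_loopOf [FiniteDimensional ℂ H] {R : (H ⊗[ℂ] H)ˣ} (hR : IsFactorizable R)
    (Φ : LoopAlgebra R →ₐ[ℂ] H)
    (hΦ : ∀ (n : ℕ) (I : MatRep H (Fin n)),
      (matM R I).map Φ = Lplus R I * LminusInv R I) (x : H) :
    Φ (loopOf hR x) = x := by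
  have h : Φ.toLinearMap ∘ₗ loopι R = psiMap R := by
    ext β
    induction span_coeff β using Submodule.span_induction with
    | mem φ hφ =>
      obtain ⟨n, I, a, b, rfl⟩ := hφ
      have := congrFun (congrFun (hΦ n I) a) b
      rw [Lplus, LminusInv, ← map_mul, matEval_apply] at this
      exact this
    | zero => simp
    | add y z _ _ hy hz => rw [map_add, map_add, hy, hz]
    | smul c y _ hy => rw [map_smul, map_smul, hy]
  have := LinearMap.congr_fun h ((LinearEquiv.ofBijective (psiMap R) hR).symm x)
  exact this.trans (LinearEquiv.apply_symm_apply (LinearEquiv.ofBijective (psiMap R) hR) x)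

end Identification

end TorusRep

end

/-! Write μ for the left integral, ν for the right one, u for the Drinfeld element and Q = R'R. On
the centre put 𝒮₊(z) = (id ⊗ μ(z ?))(Q) and 𝒮₋(z) = (id ⊗ μ(z ?))(Q⁻¹). The operator 𝒮 restricts to
𝒮₋ (`opS_apply_of_central`), and 𝒮₊(z) = Ψ(μ(z ?)) (`psiMap_actL`), so factorizability makes 𝒮₊
injective. The antipode A satisfies A𝒮₋ = 𝒮₊ and A² = 1 on the centre.

Integrals. Every linear form on H is μ(k ?) for a unique k, and μ(Λ ?) is a character when Λ is the
cointegral dual to μ. Comparing R with the second R-matrix R'⁻¹ shows that Ψ takes the same value 1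
on this character and on ε. Hence H is unimodular (`apply_cointegral_mul`), which gives the
cyclicity μ(x S²(y)) = μ(yx) and, for a nonzero scalar c, ν(u v⁻² ?) = c μ(u⁻¹ ?). With g v⁻¹ = u
v⁻² the map f becomes z ↦ c μ(u⁻¹ S(z) ?), and μ(u⁻¹ ?) is a nondegenerate trace.

Modular relations. From Q = Δ(v⁻¹)(v ⊗ v), the integral property and cyclicity,
`sliceMap_monodromy_relation` proves 𝒮₊(v⁻¹ 𝒮₊(y)) = μ(v⁻¹) v S(𝒮₊(vy)). The same statement for
(R'⁻¹, v⁻¹) gives a relation for 𝒮₋. Up to scalars the two imply 𝒮² = A, 𝒮⁴ = 1 and (𝒮𝒯)³ = 𝒮². By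
`exists_monoidHom_of_relations` these suffice to define the Lyubashenko–Majid representation.

Handle algebra. The formulas for ρ respect the fusion and exchange relations by the Yang–Baxter
equation and the commutation rule of the Heisenberg double (`opMatA_fusion`, `opMatB_fusion`,
`opMat_exchange`).

Comparison. The representation θ₁ is obtained by conjugation with f, so only τ_a and τ_b have to be
checked. The element (v⁻¹)_A acts by φ ↦ φ(? v⁻¹), which is f𝒯f⁻¹. The element (v⁻¹)_B comes from
the form μ(v)⁻¹ μ(v ?), whose action is computed in `valB_actL_apply`; on f(z) it is proportional to
f(A𝒯⁻¹𝒮𝒯⁻¹z), and this operator represents t⁻¹s⁻¹t⁻¹ = τ_b. -/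

namespace TorusRep

noncomputable section

/-! ### The presentation of `SL₂(ℤ)` by s⁴ = 1 and (st)³ = s². -/

section Presentation

/-- The submonoid of `SL₂(ℤ)` of matrices with nonnegative entries, in the form needed to
recognise its trivial element: it is generated by `t` and `t s t`. -/
def IsPositiveWord {G : Type*} [Group G] (s t : G) (p : SL(2, ℤ) × G) : Prop :=
  p ∈ Submonoid.closure {(tMat, t), (tMat * sMat * tMat, t * s * t)}

theorem coe_mul_apply (A B : SL(2, ℤ)) (i j : Fin 2) :
    (A * B).1 i j = A.1 i 0 * B.1 0 j + A.1 i 1 * B.1 1 j := by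
  rw [Matrix.SpecialLinearGroup.coe_mul, Matrix.mul_apply, Fin.sum_univ_two]

/-- Left multiplication by either generator adds one row to the other. Nonnegative entries with both
row sums at least 1 are therefore preserved, and the total becomes at least 3 as soon as one letter
is used. The identity has total 2, so a nonempty word is never the identity matrix. -/
theorem positive_word_entries {G : Type*} [Group G] {s t : G} {p : SL(2, ℤ) × G}
    (hp : IsPositiveWord s t p) :
    (0 ≤ p.1.1 0 0 ∧ 0 ≤ p.1.1 0 1 ∧ 0 ≤ p.1.1 1 0 ∧ 0 ≤ p.1.1 1 1 ∧
      1 ≤ p.1.1 0 0 + p.1.1 0 1 ∧ 1 ≤ p.1.1 1 0 + p.1.1 1 1) ∧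
    (p = 1 ∨ 3 ≤ p.1.1 0 0 + p.1.1 0 1 + p.1.1 1 0 + p.1.1 1 1) := by
  have hT : tMat.1 = !![1, 1; 0, 1] := rfl
  have hU : (tMat * sMat * tMat).1 = !![1, 0; 1, 1] := by decide
  induction hp using Submonoid.closure_induction_left with
  | one => simp
  | mul_left x hx y hy ih =>
    obtain ⟨⟨h1, h2, h3, h4, h5, h6⟩, -⟩ := ih
    rcases hx with rfl | rfl
    · rw [Prod.fst_mul]
      simp only [coe_mul_apply, hT, Matrix.of_apply, Matrix.cons_val', Matrix.cons_val_zero,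
        Matrix.cons_val_one, Matrix.cons_val_fin_one]
      refine ⟨?_, Or.inr ?_⟩ <;> omega
    · rw [Prod.fst_mul]
      simp only [coe_mul_apply (tMat * sMat * tMat), hU, Matrix.of_apply, Matrix.cons_val',
        Matrix.cons_val_zero, Matrix.cons_val_one, Matrix.cons_val_fin_one]
      refine ⟨?_, Or.inr ?_⟩ <;> omega

/-- The elements `s^{2e} (st)^i W s^j` with `W` a positive word. -/
def HasNormalForm {G : Type*} [Group G] (s t : G) (p : SL(2, ℤ) × G) : Prop :=
  ∃ (e i j : ℕ) (W : SL(2, ℤ) × G), IsPositiveWord s t W ∧ i < 3 ∧ j < 2 ∧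
    p = ((sMat, s) : SL(2, ℤ) × G) ^ (2 * e) *
      (((sMat, s) : SL(2, ℤ) × G) * (tMat, t)) ^ i * W * ((sMat, s) : SL(2, ℤ) × G) ^ j

section NormalForm

variable {G : Type*} [Group G] {s t : G}

theorem pair_s_pow_four (hs : s ^ 4 = 1) : ((sMat, s) : SL(2, ℤ) × G) ^ 4 = 1 :=
  Prod.ext generators_relations.2.2.2 hs

theorem pair_st_pow_three (hst : (s * t) ^ 3 = s ^ 2) :
    (((sMat, s) : SL(2, ℤ) × G) * (tMat, t)) ^ 3 = (sMat, s) ^ 2 :=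
  Prod.ext generators_relations.2.2.1 hst

theorem HasNormalForm.st_mul (hst : (s * t) ^ 3 = s ^ 2) {q : SL(2, ℤ) × G}
    (hq : HasNormalForm s t q) : HasNormalForm s t ((sMat, s) * (tMat, t) * q) := by
  obtain ⟨e, i, j, W, hW, hi, hj, rfl⟩ := hq
  have h3 := pair_st_pow_three hst
  unfold HasNormalForm
  generalize ((sMat, s) : SL(2, ℤ) × G) = σ at *
  generalize ((tMat, t) : SL(2, ℤ) × G) = τ at *
  -- Even powers of s are powers of (st)³, hence commute with st.
  have hcomm : Commute (σ ^ (2 * e)) (σ * τ) := by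
    rw [pow_mul, ← h3]
    exact (((Commute.refl (σ * τ)).pow_left 3).pow_left e)
  have : (σ * τ) * (σ ^ (2 * e) * (σ * τ) ^ i * W * σ ^ j) =
      σ ^ (2 * e) * (σ * τ) ^ (i + 1) * W * σ ^ j := by
    rw [← mul_assoc, ← mul_assoc, ← mul_assoc, ← hcomm.eq, pow_succ', mul_assoc (σ ^ (2 * e))]
  rw [this]
  rcases Nat.lt_or_ge (i + 1) 3 with h | h
  · exact ⟨e, i + 1, j, W, hW, h, hj, rfl⟩
  · obtain rfl : i = 2 := by omega
    refine ⟨e + 1, 0, j, W, hW, by omega, hj, ?_⟩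
    rw [h3, ← pow_add, pow_zero, mul_one]
    rfl

/-- With r = st, the letters of W are t = s⁻¹r and tst = s⁻¹r². Multiplying by s thus either
releases the first letter of W as a power of r (when i = 0) or absorbs rⁱ into W as a new letter, at
the cost of a factor s². -/
theorem HasNormalForm.s_mul {q : SL(2, ℤ) × G} (hq : HasNormalForm s t q) :
    HasNormalForm s t ((sMat, s) * q) := by
  obtain ⟨e, i, j, W, hW, hi, hj, rfl⟩ := hq
  have hτ : IsPositiveWord s t ((tMat, t) * W) :=
    Submonoid.mul_mem _ (Submonoid.subset_closure (Or.inl rfl)) hW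
  have hτ' : IsPositiveWord s t ((tMat, t) * (sMat, s) * (tMat, t) * W) :=
    Submonoid.mul_mem _ (Submonoid.subset_closure (Or.inr rfl)) hW
  have hinv : ∀ W, IsPositiveWord s t W → W = 1 ∨ ∃ y, IsPositiveWord s t y ∧
      (W = (tMat, t) * y ∨ W = (tMat, t) * (sMat, s) * (tMat, t) * y) := by
    intro W hW
    unfold IsPositiveWord at hW
    induction hW using Submonoid.closure_induction_left with
    | one => exact Or.inl rfl
    | mul_left x hx y hy ih =>
      rcases hx with rfl | rfl
      · exact Or.inr ⟨y, hy, Or.inl rfl⟩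
      · exact Or.inr ⟨y, hy, Or.inr rfl⟩
  have hW1 := hinv W hW
  clear hinv
  unfold HasNormalForm
  generalize ((sMat, s) : SL(2, ℤ) × G) = σ at *
  generalize ((tMat, t) : SL(2, ℤ) × G) = τ at *
  have hmove : σ * (σ ^ (2 * e) * (σ * τ) ^ i * W * σ ^ j) =
      σ ^ (2 * e) * (σ * (σ * τ) ^ i * W * σ ^ j) := by
    simp only [← mul_assoc]
    rw [← pow_succ', ← pow_succ]
  rw [hmove]
  obtain rfl | rfl | rfl : i = 0 ∨ i = 1 ∨ i = 2 := by omega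
  · rcases hW1 with rfl | ⟨y, hy, rfl | rfl⟩
    · obtain rfl | rfl : j = 0 ∨ j = 1 := by omega
      · exact ⟨e, 0, 1, 1, Submonoid.one_mem _, by omega, by omega, by simp⟩
      · refine ⟨e + 1, 0, 0, 1, Submonoid.one_mem _, by omega, by omega, ?_⟩
        simp [mul_add, pow_add, pow_two]
    · exact ⟨e, 1, j, y, hy, by omega, hj, by simp [mul_assoc]⟩
    · refine ⟨e, 2, j, y, hy, by omega, hj, ?_⟩
      simp only [pow_zero, mul_one, mul_assoc, pow_two]
  · refine ⟨e + 1, 0, j, τ * W, hτ, by omega, hj, ?_⟩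
    simp only [pow_zero, mul_one, mul_assoc, pow_one, mul_add, pow_add, pow_two]
  · refine ⟨e + 1, 0, j, τ * σ * τ * W, hτ', by omega, hj, ?_⟩
    simp only [pow_zero, mul_one, mul_assoc, mul_add, pow_add, pow_two]

/-- Normal forms are stable under left multiplication by s and st. They are stable under the
inverses too, since s⁻¹ = s³ and (st)⁻¹ = s⁻²(st)². The letters t = s⁻¹(st) and t⁻¹ = (st)⁻¹s
follow. -/
theorem hasNormalForm_of_mem_closure (hs : s ^ 4 = 1) (hst : (s * t) ^ 3 = s ^ 2)
    {p : SL(2, ℤ) × G} (hp : p ∈ Subgroup.closure {(sMat, s), (tMat, t)}) :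
    HasNormalForm s t p := by
  have h4 := pair_s_pow_four hs
  have h3 := pair_st_pow_three hst
  have hsi : ∀ q, HasNormalForm s t q → HasNormalForm s t ((sMat, s)⁻¹ * q) := by
    intro q hq
    have h := hq.s_mul.s_mul.s_mul
    rwa [← mul_assoc, ← mul_assoc, ← pow_two, ← pow_succ,
      show ((sMat, s) : SL(2, ℤ) × G) ^ (2 + 1) = (sMat, s)⁻¹ from
        eq_inv_of_mul_eq_one_left (by rw [← pow_succ]; exact h4)] at h
  have hri : ∀ q, HasNormalForm s t q →
      HasNormalForm s t (((sMat, s) * (tMat, t))⁻¹ * q) := by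
    intro q hq
    have h := ((hq.st_mul hst).st_mul hst)
    have h5 : ((sMat, s) * (tMat, t) : SL(2, ℤ) × G)⁻¹ =
        (sMat, s)⁻¹ * ((sMat, s)⁻¹ * (((sMat, s) * (tMat, t)) * ((sMat, s) * (tMat, t)))) := by
      rw [inv_eq_iff_mul_eq_one, ← mul_inv_eq_one]
      have : (((sMat, s) * (tMat, t)) * ((sMat, s) * (tMat, t)) : SL(2, ℤ) × G) =
          (sMat, s) ^ 2 * ((sMat, s) * (tMat, t))⁻¹ := by
        rw [← h3, eq_mul_inv_iff_mul_eq, pow_succ, pow_two]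
      rw [this, pow_two]
      group
    rw [h5]
    simp only [mul_assoc] at h ⊢
    exact hsi _ (hsi _ h)
  induction hp using Subgroup.closure_induction_left with
  | one => exact ⟨0, 0, 0, 1, Submonoid.one_mem _, by omega, by omega, by simp⟩
  | mul_left x hx y hy ih =>
    rcases hx with rfl | rfl
    · exact ih.s_mul
    · have := hsi _ (ih.st_mul hst)
      rwa [mul_assoc, inv_mul_cancel_left] at this
  | inv_mul_cancel x hx y hy ih =>
    rcases hx with rfl | rfl
    · exact hsi _ ih
    · have := hri _ ih.s_mul
      rwa [mul_inv_rev, mul_assoc, inv_mul_cancel_left] at this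

/-- If the matrix part of a normal form is trivial, the matrix of W is one of finitely many explicit
matrices. Nonnegativity leaves only the identity, and then W itself is empty, so the component in G
is trivial as well. -/
theorem eq_one_of_fst_eq_one (hs : s ^ 4 = 1) (hst : (s * t) ^ 3 = s ^ 2) {p : SL(2, ℤ) × G}
    (hp : p ∈ Subgroup.closure {(sMat, s), (tMat, t)}) (h1 : p.1 = 1) : p = 1 := by
  obtain ⟨e, i, j, W, hW, hi, hj, rfl⟩ := hasNormalForm_of_mem_closure hs hst hp
  obtain ⟨⟨a1, a2, a3, a4, a5, a6⟩, hor⟩ := positive_word_entries hW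
  have h4 := pair_s_pow_four (s := s) hs
  have he : ∃ e' < 2, ((sMat, s) : SL(2, ℤ) × G) ^ (2 * e) = (sMat, s) ^ (2 * e') := by
    refine ⟨e % 2, Nat.mod_lt _ (by omega), ?_⟩
    conv_lhs => rw [← Nat.mod_add_div e 2, mul_add, ← mul_assoc, pow_add, pow_mul _ (2 * 2),
      show 2 * 2 = 4 from rfl, h4, one_pow, mul_one]
  obtain ⟨e', he', hee⟩ := he
  rw [hee] at h1 ⊢
  simp only [Prod.fst_mul, Prod.pow_fst] at h1
  have hW1 : W.1 = ((sMat * tMat) ^ i)⁻¹ * (sMat ^ (2 * e'))⁻¹ * (sMat ^ j)⁻¹ := by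
    rw [mul_eq_one_iff_eq_inv] at h1
    rw [← h1]
    group
  rw [hW1] at a1 a2 a3 a4
  interval_cases i <;> interval_cases j <;> interval_cases e'
  -- Among the twelve triples, only i = j = e' = 0 gives a matrix without negative entries.
  all_goals first
    | exact absurd a1 (by decide)
    | exact absurd a2 (by decide)
    | exact absurd a3 (by decide)
    | exact absurd a4 (by decide)
    | skip
  have hW2 : W.1 = 1 := by rw [hW1]; simp
  rcases hor with h | h
  · simp [h]
  · rw [hW2] at h
    exact absurd h (by decide)

end NormalForm

/-- The subgroup of `SL₂(ℤ)` × G generated by the two pairs is the graph of the desired morphism. It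
projects onto `SL₂(ℤ)` because s and t generate, and injectively by the normal form. -/
theorem exists_monoidHom_of_relations {G : Type*} [Group G] {s t : G} (hs : s ^ 4 = 1)
    (hst : (s * t) ^ 3 = s ^ 2) : ∃ φ : SL(2, ℤ) →* G, φ sMat = s ∧ φ tMat = t := by
  set K : Subgroup (SL(2, ℤ) × G) := Subgroup.closure {(sMat, s), (tMat, t)} with hK
  have hbij : Function.Bijective ((MonoidHom.fst SL(2, ℤ) G).comp K.subtype) := by
    constructor
    · rw [injective_iff_map_eq_one]
      exact fun x hx => Subtype.ext (eq_one_of_fst_eq_one hs hst x.2 hx)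
    · rw [← MonoidHom.range_eq_top, MonoidHom.range_comp, Subgroup.range_subtype, hK,
        MonoidHom.map_closure, Set.image_pair]
      have := SpecialLinearGroup.SL2Z_generators
      exact this
  set e := MulEquiv.ofBijective _ hbij with he
  refine ⟨((MonoidHom.snd SL(2, ℤ) G).comp K.subtype).comp e.symm.toMonoidHom, ?_, ?_⟩
  · have : e.symm sMat = ⟨(sMat, s), Subgroup.subset_closure (Or.inl rfl)⟩ := by
      rw [MulEquiv.symm_apply_eq]
      rfl
    simp [this]
  · have : e.symm tMat = ⟨(tMat, t), Subgroup.subset_closure (Or.inr rfl)⟩ := by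
      rw [MulEquiv.symm_apply_eq]
      rfl
    simp [this]

end Presentation

/-! ### Tensor legs, the Yang–Baxter equation and the operators on H*. -/

section HandleRep

variable {H : Type*} [Ring H] [HopfAlgebra ℂ H]

@[simp] theorem flip_tmul (x y : H) : flip (x ⊗ₜ[ℂ] y) = y ⊗ₜ x := rfl

@[simp] theorem flip_flip (X : H ⊗[ℂ] H) : flip (flip X) = X := by
  induction X with
  | zero => simp
  | tmul x y => rfl
  | add X Y hX hY => rw [map_add, map_add, hX, hY]

theorem coe_swapped (R : (H ⊗[ℂ] H)ˣ) : (swapped R : H ⊗[ℂ] H) = flip (R : H ⊗[ℂ] H) := rfl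

theorem coe_swapped_inv (R : (H ⊗[ℂ] H)ˣ) :
    ((swapped R)⁻¹ : (H ⊗[ℂ] H)ˣ) = flip ((R⁻¹ : (H ⊗[ℂ] H)ˣ) : H ⊗[ℂ] H) := rfl

@[simp] theorem leg12_tmul (x y : H) : leg12 (x ⊗ₜ[ℂ] y) = x ⊗ₜ[ℂ] (y ⊗ₜ[ℂ] (1 : H)) := rfl
@[simp] theorem leg13_tmul (x y : H) : leg13 (x ⊗ₜ[ℂ] y) = x ⊗ₜ[ℂ] ((1 : H) ⊗ₜ[ℂ] y) := rfl
@[simp] theorem leg23_tmul (x y : H) : leg23 (x ⊗ₜ[ℂ] y) = (1 : H) ⊗ₜ[ℂ] (x ⊗ₜ[ℂ] y) := rfl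

/-! #### Permutations of the three legs -/

variable (H) in
/-- Exchange of the last two factors of `H ⊗ H ⊗ H`. -/
def swap23 : H ⊗[ℂ] (H ⊗[ℂ] H) →ₐ[ℂ] H ⊗[ℂ] (H ⊗[ℂ] H) :=
  Algebra.TensorProduct.map (AlgHom.id ℂ H) flip

variable (H) in
/-- Exchange of the first two factors of `H ⊗ H ⊗ H`. -/
def swap12 : H ⊗[ℂ] (H ⊗[ℂ] H) →ₐ[ℂ] H ⊗[ℂ] (H ⊗[ℂ] H) :=
  (Algebra.TensorProduct.leftComm ℂ H H H).toAlgHom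

@[simp] theorem swap23_tmul (x y z : H) : swap23 H (x ⊗ₜ[ℂ] (y ⊗ₜ[ℂ] z)) = x ⊗ₜ (z ⊗ₜ y) := rfl
@[simp] theorem swap12_tmul (x y z : H) : swap12 H (x ⊗ₜ[ℂ] (y ⊗ₜ[ℂ] z)) = y ⊗ₜ (x ⊗ₜ z) := rfl

theorem swap23_leg12 (X : H ⊗[ℂ] H) : swap23 H (leg12 X) = leg13 X := by
  induction X with
  | zero => simp
  | tmul x y => rfl
  | add X Y hX hY => simp only [map_add, hX, hY]

theorem swap23_leg13 (X : H ⊗[ℂ] H) : swap23 H (leg13 X) = leg12 X := by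
  induction X with
  | zero => simp
  | tmul x y => rfl
  | add X Y hX hY => simp only [map_add, hX, hY]

theorem swap23_leg23 (X : H ⊗[ℂ] H) : swap23 H (leg23 X) = leg23 (flip X) := rfl

theorem swap12_leg12 (X : H ⊗[ℂ] H) : swap12 H (leg12 X) = leg12 (flip X) := by
  induction X with
  | zero => simp
  | tmul x y => rfl
  | add X Y hX hY => simp only [map_add, hX, hY]

theorem swap12_leg13 (X : H ⊗[ℂ] H) : swap12 H (leg13 X) = leg23 X := by
  induction X with
  | zero => simp
  | tmul x y => rfl
  | add X Y hX hY => simp only [map_add, hX, hY]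

theorem swap12_leg23 (X : H ⊗[ℂ] H) : swap12 H (leg23 X) = leg13 X := by
  induction X with
  | zero => simp
  | tmul x y => rfl
  | add X Y hX hY => simp only [map_add, hX, hY]

/-! #### The coproduct on the legs -/

variable (H) in
/-- `Δ ⊗ id`. -/
def comulLeft : H ⊗[ℂ] H →ₐ[ℂ] H ⊗[ℂ] (H ⊗[ℂ] H) :=
  (Algebra.TensorProduct.assoc ℂ ℂ ℂ H H H).toAlgHom.comp
    (Algebra.TensorProduct.map (Bialgebra.comulAlgHom ℂ H) (AlgHom.id ℂ H))

variable (H) in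
/-- `id ⊗ Δ`. -/
def comulRight : H ⊗[ℂ] H →ₐ[ℂ] H ⊗[ℂ] (H ⊗[ℂ] H) :=
  Algebra.TensorProduct.map (AlgHom.id ℂ H) (Bialgebra.comulAlgHom ℂ H)

theorem comulRight_tmul (x y : H) :
    comulRight H (x ⊗ₜ[ℂ] y) = x ⊗ₜ[ℂ] Coalgebra.comul (R := ℂ) y := rfl

/-- `(X ⊗ y)` in `H ⊗ H ⊗ H`. -/
theorem comulLeft_tmul (x y : H) :
    comulLeft H (x ⊗ₜ[ℂ] y) = leg12 (Coalgebra.comul (R := ℂ) x) * (1 ⊗ₜ (1 ⊗ₜ y)) := by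
  change Algebra.TensorProduct.assoc ℂ ℂ ℂ H H H (Coalgebra.comul (R := ℂ) x ⊗ₜ[ℂ] y) = _
  induction Coalgebra.comul (R := ℂ) x with
  | zero => simp
  | tmul a b => simp
  | add X Y hX hY => rw [TensorProduct.add_tmul, map_add, map_add, add_mul, hX, hY]

theorem comulLeft_flip (X : H ⊗[ℂ] H) :
    comulLeft H (flip X) = swap23 H (swap12 H (comulRight H X)) := by
  induction X with
  | zero => simp
  | tmul x y =>
    rw [flip_tmul, comulLeft_tmul, comulRight_tmul]
    induction Coalgebra.comul (R := ℂ) y with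
    | zero => simp
    | tmul a b => simp
    | add X Y hX hY => rw [TensorProduct.tmul_add]; simp only [map_add, add_mul, hX, hY]
  | add X Y hX hY => simp only [map_add, hX, hY]

theorem comulRight_flip (X : H ⊗[ℂ] H) :
    comulRight H (flip X) = swap12 H (swap23 H (comulLeft H X)) := by
  induction X with
  | zero => simp
  | tmul x y =>
    rw [flip_tmul, comulLeft_tmul, comulRight_tmul]
    induction Coalgebra.comul (R := ℂ) x with
    | zero => simp
    | tmul a b => simp
    | add X Y hX hY => rw [TensorProduct.tmul_add]; simp only [map_add, add_mul, hX, hY]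
  | add X Y hX hY => simp only [map_add, hX, hY]

namespace IsUniversalRMatrix

variable {R : (H ⊗[ℂ] H)ˣ} (hR : IsUniversalRMatrix R)
include hR

theorem comulLeft_eq : comulLeft H (R : H ⊗[ℂ] H) = leg13 (R : H ⊗[ℂ] H) * leg23 (R : H ⊗[ℂ] H) :=
  hR.comul_left

theorem comulRight_eq :
    comulRight H (R : H ⊗[ℂ] H) = leg13 (R : H ⊗[ℂ] H) * leg12 (R : H ⊗[ℂ] H) :=
  hR.comul_right

theorem comulLeft_swapped : comulLeft H (swapped R : H ⊗[ℂ] H) =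
    leg23 (swapped R : H ⊗[ℂ] H) * leg13 (swapped R : H ⊗[ℂ] H) := by
  rw [coe_swapped, comulLeft_flip, hR.comulRight_eq, map_mul, map_mul, swap12_leg13, swap12_leg12,
    swap23_leg23, swap23_leg12]

theorem comulRight_swapped : comulRight H (swapped R : H ⊗[ℂ] H) =
    leg12 (swapped R : H ⊗[ℂ] H) * leg13 (swapped R : H ⊗[ℂ] H) := by
  rw [coe_swapped, comulRight_flip, hR.comulLeft_eq, map_mul, map_mul, swap23_leg13, swap23_leg23,
    swap12_leg12, swap12_leg23]

/-- The Yang--Baxter equation. -/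
theorem yangBaxter : leg12 (R : H ⊗[ℂ] H) * leg13 (R : H ⊗[ℂ] H) * leg23 (R : H ⊗[ℂ] H) =
    leg23 (R : H ⊗[ℂ] H) * leg13 (R : H ⊗[ℂ] H) * leg12 (R : H ⊗[ℂ] H) := by
  -- Conjugating Δ ⊗ id by R₁₂ gives Δᵒᵖ ⊗ id; applied to R itself this is the Yang–Baxter equation.
  have key : ∀ X : H ⊗[ℂ] H, leg12 (R : H ⊗[ℂ] H) * comulLeft H X =
      swap12 H (comulLeft H X) * leg12 (R : H ⊗[ℂ] H) := by
    intro X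
    induction X with
    | zero => simp
    | tmul x y =>
      have hc : ∀ Z : H ⊗[ℂ] H, (1 : H) ⊗ₜ[ℂ] ((1 : H) ⊗ₜ[ℂ] y) * leg12 Z =
          leg12 Z * (1 : H) ⊗ₜ[ℂ] ((1 : H) ⊗ₜ[ℂ] y) := by
        intro Z
        induction Z with
        | zero => simp
        | tmul a b => simp
        | add X Y hX hY => simp only [map_add, mul_add, add_mul, hX, hY]
      rw [comulLeft_tmul, map_mul, swap12_leg12, swap12_tmul, ← mul_assoc, ← map_mul,
        hR.comul_op, map_mul, mul_assoc, mul_assoc, hc]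
    | add X Y hX hY => simp only [map_add, mul_add, add_mul, hX, hY]
  have := key (R : H ⊗[ℂ] H)
  rwa [hR.comulLeft_eq, map_mul, swap12_leg13, swap12_leg23, ← mul_assoc] at this

end IsUniversalRMatrix

/-! #### Evaluation of tensors on modules -/

section Evaluation

variable {B C A : Type*} [Semiring B] [Algebra ℂ B] [Semiring C] [Algebra ℂ C]
  [Semiring A] [Algebra ℂ A]
  {m n : Type} [Fintype m] [DecidableEq m] [Fintype n] [DecidableEq n]

/-- The map `x ⊗ y ↦ K(x) y`, from `B ⊗ A` to the matrices with coefficients in `A`. -/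
def evalLeft (K : B →ₐ[ℂ] Matrix n n ℂ) (A : Type*) [Semiring A] [Algebra ℂ A] :
    B ⊗[ℂ] A →ₐ[ℂ] Matrix n n A :=
  ((matrixEquivTensor n ℂ A).symm.toAlgHom.comp
    (Algebra.TensorProduct.map (AlgHom.id ℂ A) K)).comp
    (Algebra.TensorProduct.comm ℂ B A).toAlgHom

theorem evalLeft_tmul (K : B →ₐ[ℂ] Matrix n n ℂ) (x : B) (y : A) :
    evalLeft K A (x ⊗ₜ[ℂ] y) = (K x).map (fun c => c • y) := by
  ext a b
  simp [evalLeft, matrixEquivTensor_apply_symm, Algebra.smul_def, Algebra.commutes]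

theorem rep₂_tmul (I : MatRep H m) (J : MatRep H n) (x y : H) :
    rep₂ I J (x ⊗ₜ[ℂ] y) = I x ⊗ₖ J y := by
  ext ⟨a, b⟩ ⟨c, d⟩
  simp [rep₂, Matrix.kroneckerAlgEquiv, Matrix.kroneckerMap_apply]

/-- Evaluation on `I ⊗ J` of the first two factors of a tensor in `H ⊗ H ⊗ H`, followed by the
morphism `F` on the third one. -/
def evalThree (F : H →ₐ[ℂ] A) (I : MatRep H m) (J : MatRep H n) :
    H ⊗[ℂ] (H ⊗[ℂ] H) →ₐ[ℂ] Matrix (m × n) (m × n) A :=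
  ((evalLeft (rep₂ I J) A).comp (Algebra.TensorProduct.map (AlgHom.id ℂ (H ⊗[ℂ] H)) F)).comp
    (Algebra.TensorProduct.assoc ℂ ℂ ℂ H H H).symm.toAlgHom

/-- Evaluation on `I` of the first factor of a tensor in `H ⊗ H`, followed by the morphism `F` on
the second one. -/
def evalTwo (F : H →ₐ[ℂ] A) (I : MatRep H n) : H ⊗[ℂ] H →ₐ[ℂ] Matrix n n A :=
  (evalLeft I A).comp (Algebra.TensorProduct.map (AlgHom.id ℂ H) F)

variable (F : H →ₐ[ℂ] A) (I : MatRep H m) (J : MatRep H n)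

theorem evalTwo_tmul (x y : H) : evalTwo F I (x ⊗ₜ[ℂ] y) = (I x).map (fun c => c • F y) := by
  rw [evalTwo, AlgHom.comp_apply, Algebra.TensorProduct.map_tmul, evalLeft_tmul]
  rfl

theorem evalThree_tmul (x y z : H) : evalThree F I J (x ⊗ₜ[ℂ] (y ⊗ₜ[ℂ] z)) =
    (I x ⊗ₖ J y).map (fun c => c • F z) := by
  rw [← rep₂_tmul, ← evalLeft_tmul]
  rfl

theorem matEval_map (X : H ⊗[ℂ] H) : (matEval I X).map F = evalTwo F I X := by
  induction X with
  | zero => ext; simp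
  | tmul x y =>
    ext a b
    rw [Matrix.map_apply, matEval_apply, slice_tmul, evalTwo_tmul, map_smul]
    rfl
  | add X Y hX hY =>
    rw [map_add, map_add, ← hX, ← hY]
    ext
    simp

theorem evalThree_leg12 (X : H ⊗[ℂ] H) : evalThree F I J (leg12 X) = scal A (rep₂ I J X) := by
  induction X with
  | zero => ext; simp [scal]
  | tmul x y =>
    rw [leg12_tmul, evalThree_tmul, rep₂_tmul]
    ext
    simp [scal, Algebra.algebraMap_eq_smul_one]
  | add X Y hX hY =>
    simp only [map_add, hX, hY]
    ext
    simp [scal]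

theorem evalThree_leg13 (X : H ⊗[ℂ] H) : evalThree F I J (leg13 X) = emb₁ n (evalTwo F I X) := by
  induction X with
  | zero => simp [emb₁]
  | tmul x y =>
    rw [leg13_tmul, evalThree_tmul, evalTwo_tmul]
    ext ⟨a, b⟩ ⟨c, d⟩
    by_cases h : b = d <;> simp [emb₁, Matrix.kroneckerMap_apply, h]
  | add X Y hX hY => simp only [map_add, hX, hY, emb₁, Matrix.add_kronecker]

theorem evalThree_leg23 (X : H ⊗[ℂ] H) : evalThree F I J (leg23 X) = emb₂ m (evalTwo F J X) := by
  induction X with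
  | zero => simp [emb₂]
  | tmul x y =>
    rw [leg23_tmul, evalThree_tmul, evalTwo_tmul]
    ext ⟨a, b⟩ ⟨c, d⟩
    by_cases h : a = c <;> simp [emb₂, Matrix.kroneckerMap_apply, h]
  | add X Y hX hY => simp only [map_add, hX, hY, emb₂, Matrix.kronecker_add]

theorem evalTwo_tensorRep (X : H ⊗[ℂ] H) :
    evalTwo F (tensorRep I J) X = evalThree F I J (comulLeft H X) := by
  have : evalTwo F (tensorRep I J) = (evalThree F I J).comp (comulLeft H) := by
    ext x
    all_goals simp [evalTwo, evalThree, comulLeft, tensorRep, evalLeft_tmul]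
  rw [this]
  rfl

end Evaluation

/-! #### The operators on `H*` -/

section Operators

variable {m n : Type} [Fintype m] [DecidableEq m] [Fintype n] [DecidableEq n]

variable (H) in
/-- The representation `h ↦ (φ ↦ φ(? h))` of `H` on `H*`. -/
def hActHom : H →ₐ[ℂ] Module.End ℂ (Module.Dual ℂ H) :=
  AlgHom.ofLinearMap
    { toFun := hAct
      map_add' := fun x y => by ext; simp [hAct, mul_add]
      map_smul' := fun c x => by ext; simp [hAct] }
    (by ext; simp [hAct]) (fun x y => by ext; simp [hAct, mul_assoc])

@[simp] theorem hActHom_apply (h : H) : hActHom H h = hAct h := rfl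

@[simp] theorem hAct_apply (h : H) (φ : Module.Dual ℂ H) (x : H) : hAct h φ x = φ (x * h) := rfl

theorem dAct_apply (ψ φ : Module.Dual ℂ H) (x : H) :
    dAct ψ φ x = LinearMap.mul' ℂ ℂ (TensorProduct.map ψ φ (Coalgebra.comul (R := ℂ) x)) := rfl

variable (H) in
/-- `dAct` as a linear map. -/
def dActLin : Module.Dual ℂ H →ₗ[ℂ] Module.End ℂ (Module.Dual ℂ H) where
  toFun := dAct
  map_add' a b := by
    ext φ x
    rw [LinearMap.add_apply, LinearMap.add_apply, dAct_apply, TensorProduct.map_add_left]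
    simp [dAct_apply]
  map_smul' c a := by
    ext φ x
    rw [dAct_apply, TensorProduct.map_smul_left]
    simp [dAct_apply]

@[simp] theorem dActLin_apply (ψ : Module.Dual ℂ H) : dActLin H ψ = dAct ψ := rfl

/-- The exchange of `h` and of `T` in the Heisenberg double. -/
theorem hAct_mul_opT (J : MatRep H n) (h : H) (a b : n) :
    hAct h * opT J a b =
      (opT J * evalTwo (hActHom H) J (Coalgebra.comul (R := ℂ) h)) a b := by
  ext φ x
  have key : ∀ X Y : H ⊗[ℂ] H,
      LinearMap.mul' ℂ ℂ (TensorProduct.map (coeff J a b) φ (X * Y)) =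
        ∑ c, LinearMap.mul' ℂ ℂ (TensorProduct.map (coeff J a c)
          (evalTwo (hActHom H) J Y c b φ) X) := by
    intro X Y
    induction X with
    | zero => simp
    | add X X' hX hX' => simp only [add_mul, map_add, hX, hX', Finset.sum_add_distrib]
    | tmul x y =>
      induction Y with
      | zero => simp
      | add Y Y' hY hY' =>
        simp only [mul_add, map_add, hY, hY', ← Finset.sum_add_distrib, Matrix.add_apply,
          LinearMap.add_apply, TensorProduct.map_tmul, TensorProduct.tmul_add]
      | tmul z t =>
        simp [evalTwo_tmul, coeff, Matrix.mul_apply, Finset.sum_mul, mul_assoc]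
  rw [Module.End.mul_apply, hAct_apply, opT, Matrix.of_apply, dAct_apply, Bialgebra.comul_mul, key,
    Matrix.mul_apply, LinearMap.sum_apply, LinearMap.sum_apply]
  rfl

variable (I : MatRep H m) (J : MatRep H n)

theorem dAct_dAct (ψ χ : Module.Dual ℂ H) : dAct (dAct ψ χ) = dAct ψ * dAct χ := by
  ext φ x
  have h1 : ∀ X : H ⊗[ℂ] H, LinearMap.mul' ℂ ℂ (TensorProduct.map (dAct ψ χ) φ X) =
      LinearMap.mul' ℂ ℂ (TensorProduct.map ψ
        (LinearMap.mul' ℂ ℂ ∘ₗ TensorProduct.map χ φ) (TensorProduct.assoc ℂ H H H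
          (Coalgebra.comul.rTensor H X))) := by
    intro X
    induction X with
    | zero => simp
    | add X X' hX hX' => simp only [map_add, hX, hX']
    | tmul y z =>
      rw [TensorProduct.map_tmul, dAct_apply, LinearMap.rTensor_tmul]
      induction Coalgebra.comul (R := ℂ) y with
      | zero => simp
      | add X X' hX hX' =>
        simp only [map_add, TensorProduct.add_tmul, hX, hX'] at *
      | tmul p q => simp [mul_assoc]
  have h2 : ∀ X : H ⊗[ℂ] H, LinearMap.mul' ℂ ℂ (TensorProduct.map ψ (dAct χ φ) X) =
      LinearMap.mul' ℂ ℂ (TensorProduct.map ψ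
        (LinearMap.mul' ℂ ℂ ∘ₗ TensorProduct.map χ φ) (Coalgebra.comul.lTensor H X)) := by
    intro X
    induction X with
    | zero => simp
    | add X X' hX hX' => simp only [map_add, hX, hX']
    | tmul y z => rfl
  rw [dAct_apply, h1, Module.End.mul_apply, dAct_apply, h2, Coalgebra.coassoc_apply]

section Embeddings

variable {A : Type*} [Semiring A] [Algebra ℂ A]

omit [DecidableEq m] [Algebra ℂ A] in
theorem emb₁_mul_apply (M : Matrix m m A) (N : Matrix (m × n) (m × n) A) (a : m) (b : n)
    (p : m × n) : (emb₁ n M * N) (a, b) p = ∑ c, M a c * N (c, b) p := by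
  simp only [emb₁, Matrix.mul_apply, Fintype.sum_prod_type, Matrix.kroneckerMap_apply,
    Matrix.one_apply, mul_ite, mul_one, mul_zero, ite_mul, zero_mul, Finset.sum_ite_eq,
    Finset.mem_univ, if_true]

omit [DecidableEq n] [Algebra ℂ A] in
theorem emb₂_mul_apply (M : Matrix n n A) (N : Matrix (m × n) (m × n) A) (a : m) (b : n)
    (p : m × n) : (emb₂ m M * N) (a, b) p = ∑ c, M b c * N (a, c) p := by
  simp only [emb₂, Matrix.mul_apply, Fintype.sum_prod_type, Matrix.kroneckerMap_apply,
    Matrix.one_apply, ite_mul, one_mul, zero_mul]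
  rw [Finset.sum_comm]
  simp

omit [Algebra ℂ A] in
theorem emb₁_mul_emb₂_apply (M : Matrix m m A) (N : Matrix n n A) (a c : m) (b d : n) :
    (emb₁ n M * emb₂ m N) (a, b) (c, d) = M a c * N b d := by
  rw [emb₁_mul_apply]
  simp [emb₂, Matrix.kroneckerMap_apply, Matrix.one_apply]

omit [Algebra ℂ A] in
theorem emb₂_mul_emb₁_apply (M : Matrix m m A) (N : Matrix n n A) (a c : m) (b d : n) :
    (emb₂ m N * emb₁ n M) (a, b) (c, d) = N b d * M a c := by
  rw [emb₂_mul_apply]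
  simp [emb₁, Matrix.kroneckerMap_apply, Matrix.one_apply]

theorem evalThree_tmul_apply (F : H →ₐ[ℂ] A) (x : H) (Y : H ⊗[ℂ] H) (a c : m) (b d : n) :
    evalThree F I J (x ⊗ₜ Y) (a, b) (c, d) = I x a c • evalTwo F J Y b d := by
  induction Y with
  | zero => simp
  | add X X' hX hX' => simp only [TensorProduct.tmul_add, map_add, Matrix.add_apply, hX, hX',
      smul_add]
  | tmul y z => simp [evalThree_tmul, evalTwo_tmul, Matrix.kroneckerMap_apply, mul_smul]

theorem evalThree_swap12_tmul_apply (F : H →ₐ[ℂ] A) (x : H) (Y : H ⊗[ℂ] H) (a c : m) (b d : n) :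
    evalThree F I J (swap12 H (x ⊗ₜ Y)) (a, b) (c, d) = J x b d • evalTwo F I Y a c := by
  induction Y with
  | zero => simp
  | add X X' hX hX' => simp only [TensorProduct.tmul_add, map_add, Matrix.add_apply, hX, hX',
      smul_add]
  | tmul y z =>
    simp [evalThree_tmul, evalTwo_tmul, Matrix.kroneckerMap_apply, smul_smul, mul_comm]

end Embeddings

theorem opT_tensorRep : opT (tensorRep I J) = emb₁ n (opT I) * emb₂ m (opT J) := by
  ext1 ⟨a, b⟩ ⟨c, d⟩
  rw [emb₁_mul_emb₂_apply]
  simp only [opT, Matrix.of_apply]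
  rw [← dAct_dAct]
  congr 1
  ext x
  rw [dAct_apply]
  simp only [coeff, tensorRep, LinearMap.comp_apply, AlgHom.toLinearMap_apply, AlgHom.comp_apply,
    Bialgebra.comulAlgHom_apply]
  induction Coalgebra.comul (R := ℂ) x with
  | zero => simp
  | add X X' hX hX' => simp only [map_add, hX, hX']
  | tmul y z => simp [rep₂_tmul, Matrix.kroneckerMap_apply]

/-- `X₁₃ T₂ = T₂ (id ⊗ Δ)(X)`. -/
theorem emb₁_mul_opT (X : H ⊗[ℂ] H) :
    emb₁ n (evalTwo (hActHom H) I X) * emb₂ m (opT J) =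
      emb₂ m (opT J) * evalThree (hActHom H) I J (comulRight H X) := by
  induction X with
  | zero => simp [emb₁]
  | add X X' hX hX' => simp only [map_add, mul_add, ← hX, ← hX', emb₁, Matrix.add_kronecker,
      add_mul]
  | tmul x y =>
    ext1 ⟨a, b⟩ ⟨c, d⟩
    rw [emb₁_mul_emb₂_apply, emb₂_mul_apply, comulRight_tmul]
    simp only [evalThree_tmul_apply, mul_smul_comm]
    rw [← Finset.smul_sum, ← Matrix.mul_apply, ← hAct_mul_opT, evalTwo_tmul, Matrix.map_apply,
      smul_mul_assoc]
    rfl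

/-- `X₂₃ T₁ = T₁ (id ⊗ Δ)(X)₂₁₃`. -/
theorem emb₂_mul_opT (X : H ⊗[ℂ] H) :
    emb₂ m (evalTwo (hActHom H) J X) * emb₁ n (opT I) =
      emb₁ n (opT I) * evalThree (hActHom H) I J (swap12 H (comulRight H X)) := by
  induction X with
  | zero => simp [emb₂]
  | add X X' hX hX' => simp only [map_add, mul_add, ← hX, ← hX', emb₂, Matrix.kronecker_add,
      add_mul]
  | tmul x y =>
    ext1 ⟨a, b⟩ ⟨c, d⟩
    rw [emb₂_mul_emb₁_apply, emb₁_mul_apply, comulRight_tmul]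
    simp only [evalThree_swap12_tmul_apply, mul_smul_comm]
    rw [← Finset.smul_sum, ← Matrix.mul_apply, ← hAct_mul_opT, evalTwo_tmul, Matrix.map_apply,
      smul_mul_assoc]
    rfl

end Operators

end HandleRep

/-! ### The defining relations of the loop and handle algebras, and the representation ρ. -/

section HandleRep

variable {H : Type*} [Ring H] [HopfAlgebra ℂ H]

namespace IsUniversalRMatrix

variable {R : (H ⊗[ℂ] H)ˣ} (hR : IsUniversalRMatrix R)
include hR

/-- This and the next three equations are images of the Yang–Baxter equation under permutations of
the legs. The digits record where legs 1, 2, 3 are sent, and R with decreasing indices is written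
with R'. -/
theorem yangBaxter_231 : leg23 (R : H ⊗[ℂ] H) * leg12 (swapped R : H ⊗[ℂ] H) *
      leg13 (swapped R : H ⊗[ℂ] H) =
    leg13 (swapped R : H ⊗[ℂ] H) * leg12 (swapped R : H ⊗[ℂ] H) * leg23 (R : H ⊗[ℂ] H) := by
  have := congrArg (fun X => swap12 H (swap23 H X)) hR.yangBaxter
  simpa only [map_mul, swap12_leg12, swap12_leg13, swap12_leg23, swap23_leg12, swap23_leg13,
    swap23_leg23, ← coe_swapped] using this

theorem yangBaxter_321 : leg23 (swapped R : H ⊗[ℂ] H) * leg13 (swapped R : H ⊗[ℂ] H) *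
      leg12 (swapped R : H ⊗[ℂ] H) =
    leg12 (swapped R : H ⊗[ℂ] H) * leg13 (swapped R : H ⊗[ℂ] H) *
      leg23 (swapped R : H ⊗[ℂ] H) := by
  have := congrArg (fun X => swap12 H (swap23 H (swap12 H X))) hR.yangBaxter
  simpa only [map_mul, swap12_leg12, swap12_leg13, swap12_leg23, swap23_leg12, swap23_leg13,
    swap23_leg23, ← coe_swapped] using this

theorem yangBaxter_132 : leg13 (R : H ⊗[ℂ] H) * leg12 (R : H ⊗[ℂ] H) *
      leg23 (swapped R : H ⊗[ℂ] H) =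
    leg23 (swapped R : H ⊗[ℂ] H) * leg12 (R : H ⊗[ℂ] H) * leg13 (R : H ⊗[ℂ] H) := by
  have := congrArg (fun X => swap23 H X) hR.yangBaxter
  simpa only [map_mul, swap12_leg12, swap12_leg13, swap12_leg23, swap23_leg12, swap23_leg13,
    swap23_leg23, ← coe_swapped] using this

theorem yangBaxter_312 : leg13 (swapped R : H ⊗[ℂ] H) * leg23 (swapped R : H ⊗[ℂ] H) *
      leg12 (R : H ⊗[ℂ] H) =
    leg12 (R : H ⊗[ℂ] H) * leg23 (swapped R : H ⊗[ℂ] H) * leg13 (swapped R : H ⊗[ℂ] H) := by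
  have := congrArg (fun X => swap23 H (swap12 H X)) hR.yangBaxter
  simpa only [map_mul, swap12_leg12, swap12_leg13, swap12_leg23, swap23_leg12, swap23_leg13,
    swap23_leg23, ← coe_swapped] using this

end IsUniversalRMatrix

section Relations

variable {m n : Type} [Fintype m] [DecidableEq m] [Fintype n] [DecidableEq n]
  (R : (H ⊗[ℂ] H)ˣ)

omit [DecidableEq m] in
theorem emb₁_mul {A : Type*} [Semiring A] [Algebra ℂ A] (M N : Matrix m m A) :
    emb₁ n (M * N) = emb₁ n M * emb₁ n N := by
  ext1 ⟨a, b⟩ ⟨c, d⟩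
  rw [emb₁_mul_apply]
  by_cases h : b = d <;> simp [emb₁, Matrix.kroneckerMap_apply, Matrix.mul_apply, h]

omit [DecidableEq n] in
theorem emb₂_mul {A : Type*} [Semiring A] [Algebra ℂ A] (M N : Matrix n n A) :
    emb₂ m (M * N) = emb₂ m M * emb₂ m N := by
  ext1 ⟨a, b⟩ ⟨c, d⟩
  rw [emb₂_mul_apply]
  by_cases h : a = c <;> simp [emb₂, Matrix.kroneckerMap_apply, Matrix.mul_apply, h]

/-- The matrix of operators which represents `A_I`. -/
def opMatA (I : MatRep H n) : Matrix n n (Module.End ℂ (Module.Dual ℂ H)) :=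
  evalTwo (hActHom H) I R * evalTwo (hActHom H) I (swapped R : H ⊗[ℂ] H)

/-- The matrix of operators which represents `B_I`. -/
def opMatB (I : MatRep H n) : Matrix n n (Module.End ℂ (Module.Dual ℂ H)) :=
  evalTwo (hActHom H) I R * opT I * evalTwo (hActHom H) I (swapped R : H ⊗[ℂ] H)

variable {R} (hR : IsUniversalRMatrix R) (I : MatRep H m) (J : MatRep H n)
include hR

/-- No T occurs here, so everything takes place in H ⊗ H ⊗ H, the third leg being the one that acts
on H*. The coproduct turns R₁₃R'₁₃ into R₁₃R₂₃R'₂₃R'₁₃, and two forms of Yang–Baxter reorder it. -/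
theorem opMatA_fusion : opMatA R (tensorRep I J) =
    emb₁ n (opMatA R I) * scal _ (rep₂ I J (swapped R : H ⊗[ℂ] H)) * emb₂ m (opMatA R J) *
      scal _ (rep₂ I J (((swapped R)⁻¹ : (H ⊗[ℂ] H)ˣ) : H ⊗[ℂ] H)) := by
  simp only [opMatA, evalTwo_tensorRep, ← evalThree_leg13 _ _ J,
    ← evalThree_leg23 _ I J, ← evalThree_leg12 (hActHom H) I J, ← map_mul]
  congr 1
  simp only [map_mul]
  rw [hR.comulLeft_eq, hR.comulLeft_swapped]
  have h3 := hR.yangBaxter_231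
  have h4 := hR.yangBaxter_321
  have h5 : leg12 (swapped R : H ⊗[ℂ] H) *
      leg12 (((swapped R)⁻¹ : (H ⊗[ℂ] H)ˣ) : H ⊗[ℂ] H) = 1 := by
    rw [← map_mul, Units.mul_inv, map_one]
  generalize leg12 (((swapped R)⁻¹ : (H ⊗[ℂ] H)ˣ) : H ⊗[ℂ] H) = i12 at *
  generalize leg12 (swapped R : H ⊗[ℂ] H) = s12 at *
  generalize leg13 (swapped R : H ⊗[ℂ] H) = s13 at *
  generalize leg23 (swapped R : H ⊗[ℂ] H) = s23 at *
  generalize leg13 (R : H ⊗[ℂ] H) = r13 at *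
  generalize leg23 (R : H ⊗[ℂ] H) = r23 at *
  calc r13 * r23 * (s23 * s13) = r13 * r23 * (s23 * s13 * s12) * i12 := by
        simp only [mul_assoc, h5, mul_one]
    _ = r13 * (r23 * s12 * s13) * s23 * i12 := by rw [h4]; simp only [mul_assoc]
    _ = r13 * s13 * s12 * (r23 * s23) * i12 := by rw [h3]; simp only [mul_assoc]

/-- The pattern is that of A, with T₁T₂ in the middle. Passing R₂₃ through T₁ creates a factor R'₁₂,
and T₂ can absorb such a factor through T₂R'₁₂R'₁₃ = R'₁₃T₂. The remaining moves are Yang–Baxter. -/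
theorem opMatB_fusion : opMatB R (tensorRep I J) =
    emb₁ n (opMatB R I) * scal _ (rep₂ I J (swapped R : H ⊗[ℂ] H)) * emb₂ m (opMatB R J) *
      scal _ (rep₂ I J (((swapped R)⁻¹ : (H ⊗[ℂ] H)ˣ) : H ⊗[ℂ] H)) := by
  have h1 := emb₁_mul_opT I J (swapped R : H ⊗[ℂ] H)
  have h2 := emb₂_mul_opT I J (R : H ⊗[ℂ] H)
  rw [hR.comulRight_swapped] at h1
  rw [hR.comulRight_eq, map_mul, swap12_leg13, swap12_leg12, ← coe_swapped] at h2
  simp only [opMatB, emb₁_mul, emb₂_mul, evalTwo_tensorRep, opT_tensorRep,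
    hR.comulLeft_eq, hR.comulLeft_swapped, ← evalThree_leg13 _ _ J,
    ← evalThree_leg23 _ I J, ← evalThree_leg12 (hActHom H) I J] at h1 h2 ⊢
  have h3 := congrArg (evalThree (hActHom H) I J) hR.yangBaxter_231
  have h4 := congrArg (evalThree (hActHom H) I J) hR.yangBaxter_321
  have h5 : evalThree (hActHom H) I J (leg12 (swapped R : H ⊗[ℂ] H)) * evalThree (hActHom H) I J
      (leg12 (((swapped R)⁻¹ : (H ⊗[ℂ] H)ˣ) : H ⊗[ℂ] H)) = 1 := by
    rw [← map_mul, ← map_mul, Units.mul_inv, map_one, map_one]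
  simp only [map_mul] at h1 h2 h3 h4 ⊢
  generalize evalThree (hActHom H) I J
    (leg12 (((swapped R)⁻¹ : (H ⊗[ℂ] H)ˣ) : H ⊗[ℂ] H)) = i12 at *
  generalize evalThree (hActHom H) I J (leg12 (swapped R : H ⊗[ℂ] H)) = s12 at *
  generalize evalThree (hActHom H) I J (leg13 (swapped R : H ⊗[ℂ] H)) = s13 at *
  generalize evalThree (hActHom H) I J (leg23 (swapped R : H ⊗[ℂ] H)) = s23 at *
  generalize evalThree (hActHom H) I J (leg13 (R : H ⊗[ℂ] H)) = r13 at *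
  generalize evalThree (hActHom H) I J (leg23 (R : H ⊗[ℂ] H)) = r23 at *
  generalize emb₁ n (opT I) = T1 at *
  generalize emb₂ m (opT J) = T2 at *
  calc r13 * r23 * (T1 * T2) * (s23 * s13) = r13 * (r23 * T1) * T2 * (s23 * s13 * s12) * i12 := by
        simp only [mul_assoc, h5, mul_one]
    _ = r13 * T1 * r23 * s12 * (T2 * (s12 * s13)) * s23 * i12 := by
        rw [h4, h2]; simp only [mul_assoc]
    _ = r13 * T1 * (r23 * s12 * s13) * T2 * s23 * i12 := by rw [← h1]; simp only [mul_assoc]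
    _ = r13 * T1 * s13 * s12 * (r23 * T2 * s23) * i12 := by rw [h3]; simp only [mul_assoc]

/-- Only T₁ is present. The rules R₂₃T₁ = T₁R₂₃R'₁₂ and R'₂₃T₁ = T₁R₁₂R'₂₃ carry the matrix of A
from one side of T₁ to the other; the factors on legs 1 and 2 are collected with four forms of
Yang–Baxter. -/
theorem opMat_exchange : scal _ (rep₂ I J (R : H ⊗[ℂ] H)) * emb₁ n (opMatB R I) *
    scal _ (rep₂ I J (swapped R : H ⊗[ℂ] H)) * emb₂ m (opMatA R J) =
    emb₂ m (opMatA R J) * scal _ (rep₂ I J (R : H ⊗[ℂ] H)) *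
    emb₁ n (opMatB R I) * scal _ (rep₂ I J ((R⁻¹ : (H ⊗[ℂ] H)ˣ) : H ⊗[ℂ] H)) := by
  have h1 := emb₂_mul_opT I J (swapped R : H ⊗[ℂ] H)
  have h2 := emb₂_mul_opT I J (R : H ⊗[ℂ] H)
  have hflip : flip (swapped R : H ⊗[ℂ] H) = R := by rw [coe_swapped, flip_flip]
  rw [hR.comulRight_swapped, map_mul, swap12_leg13, swap12_leg12, hflip] at h1
  rw [hR.comulRight_eq, map_mul, swap12_leg13, swap12_leg12, ← coe_swapped] at h2
  simp only [opMatA, opMatB, emb₁_mul, emb₂_mul, ← evalThree_leg13 _ _ J,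
    ← evalThree_leg23 _ I J, ← evalThree_leg12 (hActHom H) I J] at h1 h2 ⊢
  have h3 := congrArg (evalThree (hActHom H) I J) hR.yangBaxter_231
  have h4 := congrArg (evalThree (hActHom H) I J) hR.yangBaxter_132
  have h6 := congrArg (evalThree (hActHom H) I J) hR.yangBaxter_312
  have h7 := congrArg (evalThree (hActHom H) I J) hR.yangBaxter
  have h5 : evalThree (hActHom H) I J (leg12 (R : H ⊗[ℂ] H)) * evalThree (hActHom H) I J
      (leg12 ((R⁻¹ : (H ⊗[ℂ] H)ˣ) : H ⊗[ℂ] H)) = 1 := by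
    rw [← map_mul, ← map_mul, Units.mul_inv, map_one, map_one]
  simp only [map_mul] at h1 h2 h3 h4 h6 h7 ⊢
  generalize evalThree (hActHom H) I J (leg12 ((R⁻¹ : (H ⊗[ℂ] H)ˣ) : H ⊗[ℂ] H)) = i12 at *
  generalize evalThree (hActHom H) I J (leg12 (swapped R : H ⊗[ℂ] H)) = s12 at *
  generalize evalThree (hActHom H) I J (leg13 (swapped R : H ⊗[ℂ] H)) = s13 at *
  generalize evalThree (hActHom H) I J (leg23 (swapped R : H ⊗[ℂ] H)) = s23 at *
  generalize evalThree (hActHom H) I J (leg12 (R : H ⊗[ℂ] H)) = r12 at *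
  generalize evalThree (hActHom H) I J (leg13 (R : H ⊗[ℂ] H)) = r13 at *
  generalize evalThree (hActHom H) I J (leg23 (R : H ⊗[ℂ] H)) = r23 at *
  generalize emb₁ n (opT I) = T1 at *
  calc r12 * (r13 * T1 * s13) * s12 * (r23 * s23)
      = r12 * r13 * T1 * (s13 * s12 * r23) * s23 := by simp only [mul_assoc]
    _ = r12 * r13 * (T1 * (r23 * s12)) * s13 * s23 := by rw [← h3]; simp only [mul_assoc]
    _ = r12 * r13 * r23 * T1 * (s13 * s23 * r12) * i12 := by
        rw [← h2]; simp only [mul_assoc, h5, mul_one]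
    _ = r23 * r13 * r12 * (T1 * (r12 * s23)) * s13 * i12 := by
        rw [h7, h6]; simp only [mul_assoc]
    _ = r23 * (r13 * r12 * s23) * T1 * s13 * i12 := by rw [← h1]; simp only [mul_assoc]
    _ = r23 * s23 * r12 * (r13 * T1 * s13) * i12 := by rw [h4]; simp only [mul_assoc]

end Relations

/-! #### Construction of the representation -/

section Construction

variable {E : Type*} [Ring E] [Algebra ℂ E] {m n : Type} [Fintype m] [DecidableEq m] [Fintype n]
  [DecidableEq n]

omit [Fintype m] [DecidableEq m] in
theorem map_emb₁ {A : Type*} [Semiring A] [Algebra ℂ A] (F : A →ₐ[ℂ] E) (M : Matrix m m A) :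
    (emb₁ n M).map F = emb₁ n (M.map F) := by
  ext ⟨a, b⟩ ⟨c, d⟩
  by_cases h : b = d <;> simp [emb₁, Matrix.kroneckerMap_apply, h]

omit [Fintype n] [DecidableEq n] in
theorem map_emb₂ {A : Type*} [Semiring A] [Algebra ℂ A] (F : A →ₐ[ℂ] E) (M : Matrix n n A) :
    (emb₂ m M).map F = emb₂ m (M.map F) := by
  ext ⟨a, b⟩ ⟨c, d⟩
  by_cases h : a = c <;> simp [emb₂, Matrix.kroneckerMap_apply, h]

omit [Fintype n] [DecidableEq n] in
theorem map_scal {A : Type*} [Semiring A] [Algebra ℂ A] (F : A →ₐ[ℂ] E) (M : Matrix n n ℂ) :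
    (scal A M).map F = scal E M := by
  ext a b
  simp [scal]

/-- The matrix of the values of `j` on the matrix coefficients of `I`. -/
def valMat (j : Module.Dual ℂ H →ₗ[ℂ] E) (I : MatRep H n) : Matrix n n E :=
  Matrix.of fun a b => j (coeff I a b)

/-- The linear map `j` is compatible with the fusion relations. -/
def IsFusion (R : (H ⊗[ℂ] H)ˣ) (j : Module.Dual ℂ H →ₗ[ℂ] E) : Prop :=
  ∀ (m n : ℕ) (I : MatRep H (Fin m)) (J : MatRep H (Fin n)), valMat j (tensorRep I J) =
    emb₁ (Fin n) (valMat j I) * scal _ (rep₂ I J (swapped R : H ⊗[ℂ] H)) *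
      emb₂ (Fin m) (valMat j J) *
      scal _ (rep₂ I J (((swapped R)⁻¹ : (H ⊗[ℂ] H)ˣ) : H ⊗[ℂ] H))

/-- The morphism from the loop algebra defined by a linear map compatible with the fusion
relations. -/
def loopLift {R : (H ⊗[ℂ] H)ˣ} {j : Module.Dual ℂ H →ₗ[ℂ] E} (hj : IsFusion R j) :
    LoopAlgebra R →ₐ[ℂ] E :=
  RingQuot.liftAlgHom ℂ ⟨TensorAlgebra.lift ℂ j, by
    rintro _ _ ⟨I, J, p, q⟩
    have hM : ∀ {k : Type} [Fintype k] [DecidableEq k] (K : MatRep H k),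
        (freeMat K).map (TensorAlgebra.lift ℂ j) = valMat j K := by
      intro k _ _ K
      ext
      simp [freeMat, valMat]
    have h1 := congrFun (congrFun (hM (tensorRep I J)) p) q
    rw [Matrix.map_apply] at h1
    have h2 : (fusionMat R I J).map (TensorAlgebra.lift ℂ j) = valMat j (tensorRep I J) := by
      rw [hj, fusionMat]
      simp only [Matrix.map_mul, map_emb₁, map_emb₂, map_scal, hM]
    rw [h1, ← h2, Matrix.map_apply]⟩

@[simp] theorem loopLift_loopι {R : (H ⊗[ℂ] H)ˣ} {j : Module.Dual ℂ H →ₗ[ℂ] E}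
    (hj : IsFusion R j) (β : Module.Dual ℂ H) : loopLift hj (loopι R β) = j β := by
  simp [loopLift, loopι]

variable {R : (H ⊗[ℂ] H)ˣ} {jb ja : Module.Dual ℂ H →ₗ[ℂ] E} (hb : IsFusion R jb)
  (ha : IsFusion R ja)

/-- The morphism from the free product of two loop algebras defined by two linear maps compatible
with the fusion relations. -/
def freeLift : LoopFree R →ₐ[ℂ] E :=
  LinearAlgebra.FreeProduct.lift ℂ (fun _ : Bool => LoopAlgebra R)
    (fun {i} => bif i then loopLift ha else loopLift hb)

theorem freeLift_false (x : LoopAlgebra R) : freeLift hb ha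
    (LinearAlgebra.FreeProduct.ι ℂ (fun _ : Bool => LoopAlgebra R) false x) = loopLift hb x := by
  have := LinearAlgebra.FreeProduct.lift_comp_ι ℂ (fun _ : Bool => LoopAlgebra R) (i := false)
    (maps := fun {i} => bif i then loopLift ha else loopLift hb)
  exact DFunLike.congr_fun this x

theorem freeLift_true (x : LoopAlgebra R) : freeLift hb ha
    (LinearAlgebra.FreeProduct.ι ℂ (fun _ : Bool => LoopAlgebra R) true x) = loopLift ha x := by
  have := LinearAlgebra.FreeProduct.lift_comp_ι ℂ (fun _ : Bool => LoopAlgebra R) (i := true)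
    (maps := fun {i} => bif i then loopLift ha else loopLift hb)
  exact DFunLike.congr_fun this x

/-- The morphism from the handle algebra defined by two linear maps compatible with the fusion
and exchange relations. -/
def handleLift (hex : ∀ (m n : ℕ) (I : MatRep H (Fin m)) (J : MatRep H (Fin n)),
    scal _ (rep₂ I J (R : H ⊗[ℂ] H)) * emb₁ (Fin n) (valMat jb I) *
    scal _ (rep₂ I J (swapped R : H ⊗[ℂ] H)) * emb₂ (Fin m) (valMat ja J) =
    emb₂ (Fin m) (valMat ja J) * scal _ (rep₂ I J (R : H ⊗[ℂ] H)) *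
    emb₁ (Fin n) (valMat jb I) * scal _ (rep₂ I J ((R⁻¹ : (H ⊗[ℂ] H)ˣ) : H ⊗[ℂ] H))) :
    HandleAlgebra R →ₐ[ℂ] E :=
  RingQuot.liftAlgHom ℂ ⟨freeLift hb ha, by
    rintro _ _ ⟨I, J, p, q⟩
    have hB : ∀ {k : ℕ} (K : MatRep H (Fin k)), (freeB R K).map (freeLift hb ha) =
        valMat jb K := by
      intro k K
      ext
      simp [freeB, valMat, matM, freeLift_false]
    have hA : ∀ {k : ℕ} (K : MatRep H (Fin k)), (freeA R K).map (freeLift hb ha) =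
        valMat ja K := by
      intro k K
      ext
      simp [freeA, valMat, matM, freeLift_true]
    have h2 : (exchangeLeft R I J).map (freeLift hb ha) =
        (exchangeRight R I J).map (freeLift hb ha) := by
      rw [exchangeLeft, exchangeRight]
      simp only [Matrix.map_mul, map_emb₁, map_emb₂, map_scal, hA, hB]
      exact hex _ _ I J
    exact congrFun (congrFun h2 p) q⟩

end Construction

/-! #### The linear maps behind `A` and `B` -/

section Values

/-- `(β ⊗ id)(X)`, linear in `β`, for `X` in `H ⊗ E`. -/
def sliceLeft {E : Type*} [AddCommGroup E] [Module ℂ E] (X : H ⊗[ℂ] E) :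
    Module.Dual ℂ H →ₗ[ℂ] E :=
  (TensorProduct.lid ℂ E).toLinearMap ∘ₗ LinearMap.applyₗ X ∘ₗ LinearMap.rTensorHom E

@[simp] theorem sliceLeft_tmul {E : Type*} [AddCommGroup E] [Module ℂ E] (x : H) (y : E)
    (β : Module.Dual ℂ H) : sliceLeft (x ⊗ₜ[ℂ] y) β = β x • y := by
  simp [sliceLeft]

theorem sliceLeft_add {E : Type*} [AddCommGroup E] [Module ℂ E] (X Y : H ⊗[ℂ] E) :
    sliceLeft (X + Y) = sliceLeft X + sliceLeft Y := by
  ext β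
  simp [sliceLeft]

theorem sliceLeft_zero {E : Type*} [AddCommGroup E] [Module ℂ E] :
    sliceLeft (0 : H ⊗[ℂ] E) = 0 := by
  ext β
  simp [sliceLeft]

theorem evalLeft_apply {E : Type*} [Ring E] [Algebra ℂ E] {n : Type} [Fintype n] [DecidableEq n]
    (I : MatRep H n) (X : H ⊗[ℂ] E) (a b : n) :
    evalLeft I E X a b = sliceLeft X (coeff I a b) := by
  induction X with
  | zero => simp [sliceLeft_zero]
  | tmul x y => rw [evalLeft_tmul, sliceLeft_tmul]; rfl
  | add X Y hX hY => rw [map_add, Matrix.add_apply, hX, hY, sliceLeft_add]; rfl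

variable [FiniteDimensional ℂ H]

variable (H) in
/-- The canonical element `∑ eᵢ ⊗ eⁱ`, with `eⁱ` acting on `H*` by multiplication. -/
def canonicalElement : H ⊗[ℂ] Module.End ℂ (Module.Dual ℂ H) :=
  ∑ i, Module.finBasis ℂ H i ⊗ₜ dAct ((Module.finBasis ℂ H).coord i)

/-- Expansion of the form β(a ? c) in the dual basis. This gives the action of B on an arbitrary
linear form, not only on a matrix coefficient, as is needed for the form Ψ⁻¹(v⁻¹). -/
theorem sliceLeft_canonicalElement (a b c d : H) (β : Module.Dual ℂ H) :
    sliceLeft (a ⊗ₜ hAct b * canonicalElement H * c ⊗ₜ hAct d) β =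
      hAct b * dAct (β ∘ₗ LinearMap.mulLeft ℂ a ∘ₗ LinearMap.mulRight ℂ c) * hAct d := by
  have h1 : ∀ s : Finset (Fin (Module.finrank ℂ H)),
      sliceLeft (a ⊗ₜ hAct b * (∑ i ∈ s, Module.finBasis ℂ H i ⊗ₜ[ℂ]
        dAct ((Module.finBasis ℂ H).coord i)) * c ⊗ₜ hAct d) β =
      ∑ i ∈ s, β (a * (Module.finBasis ℂ H i * c)) •
        (hAct b * dAct ((Module.finBasis ℂ H).coord i) * hAct d) := by
    intro s
    induction s using Finset.induction_on with
    | empty => simp [sliceLeft_zero]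
    | insert i s hi ih =>
      rw [Finset.sum_insert hi, Finset.sum_insert hi, mul_add, add_mul, sliceLeft_add,
        LinearMap.add_apply, ih]
      simp [mul_assoc]
  rw [canonicalElement, h1]
  have h2 := (Module.finBasis ℂ H).sum_dual_apply_smul_coord
    (β ∘ₗ LinearMap.mulLeft ℂ a ∘ₗ LinearMap.mulRight ℂ c)
  conv_rhs => rw [← h2, ← dActLin_apply, map_sum, Finset.mul_sum, Finset.sum_mul]
  refine Finset.sum_congr rfl fun i _ => ?_
  simp

theorem evalLeft_canonicalElement {n : Type} [Fintype n] [DecidableEq n] (I : MatRep H n) :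
    evalLeft I _ (canonicalElement H) = opT I := by
  ext1 a b
  have h := sliceLeft_canonicalElement (1 : H) 1 1 1 (coeff I a b)
  have h1 : hAct (1 : H) = 1 := (hActHom H).map_one
  rw [h1, ← Algebra.TensorProduct.one_def, one_mul, mul_one, one_mul, mul_one] at h
  rw [evalLeft_apply, h, opT, Matrix.of_apply]
  congr 1
  ext x
  simp

/-- The linear map `H* → End(H*)`, `T ↦ L⁽⁺⁾ T (L⁽⁻⁾)⁻¹`. -/
def valB (R : (H ⊗[ℂ] H)ˣ) : Module.Dual ℂ H →ₗ[ℂ] Module.End ℂ (Module.Dual ℂ H) :=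
  sliceLeft (Algebra.TensorProduct.map (AlgHom.id ℂ H) (hActHom H) (R : H ⊗[ℂ] H) *
    canonicalElement H *
    Algebra.TensorProduct.map (AlgHom.id ℂ H) (hActHom H) (swapped R : H ⊗[ℂ] H))

/-- The linear map `H* → End(H*)`, `T ↦ L⁽⁺⁾ (L⁽⁻⁾)⁻¹`. -/
def valA (R : (H ⊗[ℂ] H)ˣ) : Module.Dual ℂ H →ₗ[ℂ] Module.End ℂ (Module.Dual ℂ H) :=
  (hActHom H).toLinearMap ∘ₗ psiMap R

theorem valMat_valB (R : (H ⊗[ℂ] H)ˣ) {n : Type} [Fintype n] [DecidableEq n] (I : MatRep H n) :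
    valMat (valB R) I = opMatB R I := by
  ext1 a b
  rw [valMat, Matrix.of_apply, valB, ← evalLeft_apply, map_mul, map_mul,
    evalLeft_canonicalElement]
  rfl

omit [FiniteDimensional ℂ H] in
theorem valMat_valA (R : (H ⊗[ℂ] H)ˣ) {n : Type} [Fintype n] [DecidableEq n] (I : MatRep H n) :
    valMat (valA R) I = opMatA R I := by
  ext1 a b
  rw [valMat, Matrix.of_apply, opMatA, ← map_mul, ← matEval_map, Matrix.map_apply, matEval_apply]
  rfl

/-- The value of `ρ(B)` at `β`, in Sweedler notation
`∑ β(aᵢ x' bᵢ' bⱼ) φ(x'' bᵢ'' aⱼ)`. -/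
theorem valB_apply_apply (R : (H ⊗[ℂ] H)ˣ) (β φ : Module.Dual ℂ H) (x : H) :
    valB R β φ x = LinearMap.mul' ℂ ℂ (TensorProduct.map β φ
      (LinearMap.mul' ℂ (H ⊗[ℂ] H) (TensorProduct.map
        (Algebra.TensorProduct.includeLeft (R := ℂ) (S := ℂ) (A := H) (B := H)).toLinearMap
        (Coalgebra.comul ∘ₗ LinearMap.mulLeft ℂ x) (R : H ⊗[ℂ] H)) * (swapped R : H ⊗[ℂ] H))) := by
  rw [valB]
  have h0 : ∀ X Y : H ⊗[ℂ] H,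
      sliceLeft (Algebra.TensorProduct.map (AlgHom.id ℂ H) (hActHom H) X *
        canonicalElement H * Algebra.TensorProduct.map (AlgHom.id ℂ H) (hActHom H) Y) β φ x =
      LinearMap.mul' ℂ ℂ (TensorProduct.map β φ
      (LinearMap.mul' ℂ (H ⊗[ℂ] H) (TensorProduct.map
        (Algebra.TensorProduct.includeLeft (R := ℂ) (S := ℂ) (A := H) (B := H)).toLinearMap
        (Coalgebra.comul ∘ₗ LinearMap.mulLeft ℂ x) X) * Y)) := by
    intro X Y
    induction X with
    | zero => simp [sliceLeft_zero]
    | add X X' hX hX' => simp only [map_add, add_mul, sliceLeft_add, LinearMap.add_apply, hX, hX']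
    | tmul a b =>
      induction Y with
      | zero => simp [sliceLeft_zero]
      | add Y Y' hY hY' =>
        simp only [map_add, mul_add, sliceLeft_add, LinearMap.add_apply, hY, hY']
      | tmul c d =>
        simp only [Algebra.TensorProduct.map_tmul, AlgHom.id_apply, hActHom_apply,
          sliceLeft_canonicalElement, Module.End.mul_apply, hAct_apply, dAct_apply,
          TensorProduct.map_tmul, LinearMap.mul'_apply, LinearMap.comp_apply,
          LinearMap.mulLeft_apply]
        induction Coalgebra.comul (R := ℂ) (x * b) with
        | zero => simp
        | add Z Z' hZ hZ' => simp only [map_add, add_mul, mul_add, hZ, hZ']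
        | tmul y z => simp [mul_assoc]
  exact h0 _ _

theorem isFusion_valB {R : (H ⊗[ℂ] H)ˣ} (hR : IsUniversalRMatrix R) : IsFusion R (valB R) := by
  intro m n I J
  simp only [valMat_valB]
  exact opMatB_fusion hR I J

omit [FiniteDimensional ℂ H] in
theorem isFusion_valA {R : (H ⊗[ℂ] H)ˣ} (hR : IsUniversalRMatrix R) : IsFusion R (valA R) := by
  intro m n I J
  simp only [valMat_valA]
  exact opMatA_fusion hR I J

/-- The representation of the handle algebra on `H*`. -/
def handleRep {R : (H ⊗[ℂ] H)ˣ} (hR : IsUniversalRMatrix R) :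
    HandleAlgebra R →ₐ[ℂ] Module.End ℂ (Module.Dual ℂ H) :=
  handleLift (isFusion_valB hR) (isFusion_valA hR) (by
    intro m n I J
    simp only [valMat_valB, valMat_valA]
    exact opMat_exchange hR I J)

theorem handleRep_jB {R : (H ⊗[ℂ] H)ˣ} (hR : IsUniversalRMatrix R) (β : Module.Dual ℂ H) :
    handleRep hR (jB R (loopι R β)) = valB R β := by
  simp [handleRep, handleLift, jB, freeLift_false]

theorem handleRep_jA {R : (H ⊗[ℂ] H)ˣ} (hR : IsUniversalRMatrix R) (β : Module.Dual ℂ H) :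
    handleRep hR (jA R (loopι R β)) = valA R β := by
  simp [handleRep, handleLift, jA, freeLift_true]

theorem isHandleRep_handleRep {R : (H ⊗[ℂ] H)ˣ} (hR : IsUniversalRMatrix R) :
    IsHandleRep R (handleRep hR) where
  map_B I := by
    have h : (matB R I).map (handleRep hR) = valMat (valB R) I := by
      ext1 a b
      exact handleRep_jB hR _
    have h' : ∀ X : H ⊗[ℂ] H, (matEval I X).map hAct = evalTwo (hActHom H) I X :=
      matEval_map (hActHom H) I
    rw [h, valMat_valB, opMatB, Lplus, LminusInv, h', h']
  map_A I := by
    have h : (matA R I).map (handleRep hR) = valMat (valA R) I := by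
      ext1 a b
      exact handleRep_jA hR _
    have h' : ∀ X : H ⊗[ℂ] H, (matEval I X).map hAct = evalTwo (hActHom H) I X :=
      matEval_map (hActHom H) I
    rw [h, valMat_valA, opMatA, Lplus, LminusInv, h', h']

/-- The element `x_A` acts by `φ ↦ φ(? x)`. -/
theorem handleRep_jA_loopOf {R : (H ⊗[ℂ] H)ˣ} (hR : IsUniversalRMatrix R)
    (hfac : IsFactorizable R) (x : H) : handleRep hR (jA R (loopOf hfac x)) = hAct x := by
  rw [loopOf, handleRep_jA, valA, LinearMap.comp_apply]
  exact congrArg hAct (LinearEquiv.apply_symm_apply (LinearEquiv.ofBijective (psiMap R) hfac) x)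

end Values

end HandleRep

/-! ### Linear maps on tensor products given by multilinear expressions (Sweedler calculus). -/

section Sweedler

variable {M N P V : Type*} [AddCommGroup M] [Module ℂ M] [AddCommGroup N] [Module ℂ N]
  [AddCommGroup P] [Module ℂ P] [AddCommGroup V] [Module ℂ V]

/-- The linear map given by a linear expression. -/
def lin₁ (f : M → V)
    (ha : ∀ x x', f (x + x') = f x + f x' := by
      intros
      simp only [map_add, LinearMap.add_apply, add_mul, mul_add, TensorProduct.add_tmul,
        TensorProduct.tmul_add, add_smul, smul_add])
    (hs : ∀ (c : ℂ) x, f (c • x) = c • f x := by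
      intros
      try simp only [map_smul, LinearMap.smul_apply, smul_mul_assoc, mul_smul_comm,
        ← TensorProduct.smul_tmul', TensorProduct.tmul_smul, smul_assoc]
      try module) : M →ₗ[ℂ] V where
  toFun := f
  map_add' := ha
  map_smul' := hs

@[simp] theorem lin₁_apply (f : M → V) (ha hs) (x : M) : lin₁ f ha hs x = f x := rfl

/-- The linear map on a tensor product given by a bilinear expression. -/
def lin₂ (f : M → N → V)
    (ha : ∀ x x' y, f (x + x') y = f x y + f x' y := by
      intros
      simp only [map_add, LinearMap.add_apply, add_mul, mul_add, TensorProduct.add_tmul,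
        TensorProduct.tmul_add, add_smul, smul_add])
    (hs : ∀ (c : ℂ) x y, f (c • x) y = c • f x y := by
      intros
      try simp only [map_smul, LinearMap.smul_apply, smul_mul_assoc, mul_smul_comm,
        ← TensorProduct.smul_tmul', TensorProduct.tmul_smul, smul_assoc]
      try module)
    (ha' : ∀ x y y', f x (y + y') = f x y + f x y' := by
      intros
      simp only [map_add, LinearMap.add_apply, add_mul, mul_add, TensorProduct.add_tmul,
        TensorProduct.tmul_add, add_smul, smul_add])
    (hs' : ∀ (c : ℂ) x y, f x (c • y) = c • f x y := by
      intros
      try simp only [map_smul, LinearMap.smul_apply, smul_mul_assoc, mul_smul_comm,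
        ← TensorProduct.smul_tmul', TensorProduct.tmul_smul, smul_assoc]
      try module) : M ⊗[ℂ] N →ₗ[ℂ] V :=
  TensorProduct.lift (LinearMap.mk₂ ℂ f ha hs ha' hs')

@[simp] theorem lin₂_tmul (f : M → N → V) (h₁ h₂ h₃ h₄) (x : M) (y : N) :
    lin₂ f h₁ h₂ h₃ h₄ (x ⊗ₜ y) = f x y := by
  simp [lin₂]

/-- The linear map on a triple tensor product given by a trilinear expression. -/
def lin₃ (f : M → N → P → V)
    (h₁ : ∀ x x' y z, f (x + x') y z = f x y z + f x' y z := by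
      intros
      simp only [map_add, LinearMap.add_apply, add_mul, mul_add, TensorProduct.add_tmul,
        TensorProduct.tmul_add, add_smul, smul_add])
    (h₂ : ∀ (c : ℂ) x y z, f (c • x) y z = c • f x y z := by
      intros
      try simp only [map_smul, LinearMap.smul_apply, smul_mul_assoc, mul_smul_comm,
        ← TensorProduct.smul_tmul', TensorProduct.tmul_smul, smul_assoc]
      try module)
    (h₃ : ∀ x y y' z, f x (y + y') z = f x y z + f x y' z := by
      intros
      simp only [map_add, LinearMap.add_apply, add_mul, mul_add, TensorProduct.add_tmul,
        TensorProduct.tmul_add, add_smul, smul_add])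
    (h₄ : ∀ (c : ℂ) x y z, f x (c • y) z = c • f x y z := by
      intros
      try simp only [map_smul, LinearMap.smul_apply, smul_mul_assoc, mul_smul_comm,
        ← TensorProduct.smul_tmul', TensorProduct.tmul_smul, smul_assoc]
      try module)
    (h₅ : ∀ x y z z', f x y (z + z') = f x y z + f x y z' := by
      intros
      simp only [map_add, LinearMap.add_apply, add_mul, mul_add, TensorProduct.add_tmul,
        TensorProduct.tmul_add, add_smul, smul_add])
    (h₆ : ∀ (c : ℂ) x y z, f x y (c • z) = c • f x y z := by
      intros
      try simp only [map_smul, LinearMap.smul_apply, smul_mul_assoc, mul_smul_comm,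
        ← TensorProduct.smul_tmul', TensorProduct.tmul_smul, smul_assoc]
      try module) : M ⊗[ℂ] (N ⊗[ℂ] P) →ₗ[ℂ] V :=
  TensorProduct.lift
    { toFun := fun x => lin₂ (f x) (h₃ x) (fun c => h₄ c x) (h₅ x) (fun c => h₆ c x)
      map_add' := fun x x' => TensorProduct.ext' fun y z => by simp [h₁]
      map_smul' := fun c x => TensorProduct.ext' fun y z => by simp [h₂] }

theorem lin₃_tmul (f : M → N → P → V) (h₁ h₂ h₃ h₄ h₅ h₆) (x : M) (Y : N ⊗[ℂ] P) :
    lin₃ f h₁ h₂ h₃ h₄ h₅ h₆ (x ⊗ₜ Y) =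
      lin₂ (f x) (h₃ x) (fun c => h₄ c x) (h₅ x) (fun c => h₆ c x) Y := rfl

@[simp] theorem lin₃_tmul_tmul (f : M → N → P → V) (h₁ h₂ h₃ h₄ h₅ h₆) (x : M) (y : N) (z : P) :
    lin₃ f h₁ h₂ h₃ h₄ h₅ h₆ (x ⊗ₜ (y ⊗ₜ z)) = f x y z := by
  rw [lin₃_tmul, lin₂_tmul]

end Sweedler

/-! ### Hopf algebra axioms under a linear map, and Δ ∘ S. -/

section HopfIdentities

variable {H : Type*} [Ring H] [HopfAlgebra ℂ H]

local notation "𝐒" => HopfAlgebra.antipode ℂ (A := H)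
local notation "Δ" => Coalgebra.comul (R := ℂ) (A := H)
local notation "ε" => Coalgebra.counit (R := ℂ) (A := H)

variable {V : Type*} [AddCommGroup V] [Module ℂ V]

theorem comulRight_comul (x : H) : comulRight H (Δ x) = comulLeft H (Δ x) :=
  (Coalgebra.coassoc_apply x).symm

/-- This and the next three lemmas allow a factor S(x')x'', x'S(x''), ε(x') or ε(x'') to be
collapsed inside a longer expression: it is enough that F depends on pure tensors only through that
factor. -/
theorem comul_antipode_left (F : H ⊗[ℂ] H →ₗ[ℂ] V) (G : H →ₗ[ℂ] V)
    (h : ∀ a b, F (a ⊗ₜ b) = G (𝐒 a * b)) (x : H) : F (Δ x) = ε x • G 1 := by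
  have : F = G ∘ₗ LinearMap.mul' ℂ H ∘ₗ (𝐒).rTensor H := TensorProduct.ext' fun a b => by simp [h]
  rw [this, LinearMap.comp_apply, LinearMap.comp_apply,
    HopfAlgebra.mul_antipode_rTensor_comul_apply, Algebra.algebraMap_eq_smul_one, map_smul]

theorem comul_antipode_right (F : H ⊗[ℂ] H →ₗ[ℂ] V) (G : H →ₗ[ℂ] V)
    (h : ∀ a b, F (a ⊗ₜ b) = G (a * 𝐒 b)) (x : H) : F (Δ x) = ε x • G 1 := by
  have : F = G ∘ₗ LinearMap.mul' ℂ H ∘ₗ (𝐒).lTensor H := TensorProduct.ext' fun a b => by simp [h]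
  rw [this, LinearMap.comp_apply, LinearMap.comp_apply,
    HopfAlgebra.mul_antipode_lTensor_comul_apply, Algebra.algebraMap_eq_smul_one, map_smul]

theorem comul_counit_left (F : H ⊗[ℂ] H →ₗ[ℂ] V) (G : H →ₗ[ℂ] V)
    (h : ∀ a b, F (a ⊗ₜ b) = ε a • G b) (x : H) : F (Δ x) = G x := by
  have : F = G ∘ₗ (TensorProduct.lid ℂ H).toLinearMap ∘ₗ (ε).rTensor H :=
    TensorProduct.ext' fun a b => by simp [h]
  simp [this]

theorem comul_counit_right (F : H ⊗[ℂ] H →ₗ[ℂ] V) (G : H →ₗ[ℂ] V)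
    (h : ∀ a b, F (a ⊗ₜ b) = ε b • G a) (x : H) : F (Δ x) = G x := by
  have : F = G ∘ₗ (TensorProduct.rid ℂ H).toLinearMap ∘ₗ (ε).lTensor H :=
    TensorProduct.ext' fun a b => by simp [h]
  simp [this]

/-- Evaluation of a linear map on `(Δ ⊗ id)(x ⊗ y)`. -/
theorem apply_comulLeft_tmul (F : H ⊗[ℂ] (H ⊗[ℂ] H) →ₗ[ℂ] V) (x y : H) :
    F (comulLeft H (x ⊗ₜ y)) = (lin₂ fun a b => F (a ⊗ₜ (b ⊗ₜ y))) (Δ x) := by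
  rw [comulLeft_tmul]
  induction Δ x with
  | zero => simp
  | tmul a b => simp
  | add X Y hX hY => simp only [map_add, add_mul, hX, hY]

/-- Evaluation of a linear map on `(id ⊗ Δ)(x ⊗ y)`. -/
theorem apply_comulRight_tmul (F : H ⊗[ℂ] (H ⊗[ℂ] H) →ₗ[ℂ] V) (x y : H) :
    F (comulRight H (x ⊗ₜ y)) = (lin₂ fun a b => F (x ⊗ₜ (a ⊗ₜ b))) (Δ y) := by
  rw [comulRight_tmul]
  induction Δ y with
  | zero => simp
  | tmul a b => simp
  | add X Y hX hY => simp only [map_add, TensorProduct.tmul_add, hX, hY]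

/-- The antipode is an antimorphism of coalgebras. -/
theorem comul_antipode (x : H) : Δ (𝐒 x) = flip (TensorProduct.map 𝐒 𝐒 (Δ x)) := by
  -- In Sweedler notation, ∑ S(q')q'' ⊗ q''' = 1 ⊗ q.
  have h1 : ∀ q : H, (lin₂ fun a b => (𝐒 a ⊗ₜ[ℂ] (1 : H)) * Δ b) (Δ q) = (1 : H) ⊗ₜ[ℂ] q := by
    intro q
    let F : H ⊗[ℂ] (H ⊗[ℂ] H) →ₗ[ℂ] H ⊗[ℂ] H := lin₃ fun a b c => (𝐒 a * b) ⊗ₜ c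
    have h2 : ∀ X : H ⊗[ℂ] H, (lin₂ fun a b => (𝐒 a ⊗ₜ[ℂ] (1 : H)) * Δ b) X =
        F (comulRight H X) := by
      intro X
      induction X with
      | zero => simp
      | add X Y hX hY => simp only [map_add, hX, hY]
      | tmul a b =>
        rw [lin₂_tmul, apply_comulRight_tmul]
        induction Δ b with
        | zero => simp
        | tmul y z => simp [F]
        | add X Y hX hY => simp only [map_add, mul_add, hX, hY]
    rw [h2, comulRight_comul]
    refine comul_counit_left (F.comp (comulLeft H).toLinearMap) (lin₁ fun y => (1 : H) ⊗ₜ[ℂ] y)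
      (fun a b => ?_) q
    rw [LinearMap.comp_apply, AlgHom.toLinearMap_apply, apply_comulLeft_tmul]
    exact comul_antipode_left _ ((TensorProduct.mk ℂ H H).flip b) (fun y z => by simp [F]) a
  let G : H →ₗ[ℂ] H ⊗[ℂ] H := (flip (H := H)).toLinearMap ∘ₗ TensorProduct.map 𝐒 𝐒 ∘ₗ Δ
  have hG : WithConv.toConv G * WithConv.toConv Δ = 1 := by
    apply WithConv.ext
    ext x
    change LinearMap.mul' ℂ (H ⊗[ℂ] H) (TensorProduct.map G Δ (Δ x)) =
      algebraMap ℂ (H ⊗[ℂ] H) (ε x)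
    let F : H ⊗[ℂ] (H ⊗[ℂ] H) →ₗ[ℂ] H ⊗[ℂ] H := lin₃ fun a b c => (𝐒 b ⊗ₜ[ℂ] 𝐒 a) * Δ c
    have h3 : ∀ X : H ⊗[ℂ] H, LinearMap.mul' ℂ (H ⊗[ℂ] H) (TensorProduct.map G Δ X) =
        F (comulLeft H X) := by
      intro X
      induction X with
      | zero => simp
      | add X Y hX hY => simp only [map_add, hX, hY]
      | tmul a b =>
        rw [apply_comulLeft_tmul]
        simp only [TensorProduct.map_tmul, LinearMap.mul'_apply, G, LinearMap.comp_apply]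
        induction Δ a with
        | zero => simp
        | tmul y z => simp [F]
        | add X Y hX hY => simp only [map_add, add_mul, hX, hY]
    rw [h3, ← comulRight_comul, Algebra.algebraMap_eq_smul_one]
    refine comul_antipode_left (F.comp (comulRight H).toLinearMap) (lin₁ fun y => (1 : H) ⊗ₜ[ℂ] y)
      (fun a b => ?_) x
    rw [LinearMap.comp_apply, AlgHom.toLinearMap_apply, apply_comulRight_tmul]
    have h4 := congrArg (fun X => ((1 : H) ⊗ₜ[ℂ] 𝐒 a) * X) (h1 b)
    simp only [Algebra.TensorProduct.tmul_mul_tmul, one_mul] at h4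
    rw [lin₁_apply, ← h4]
    induction Δ b with
    | zero => simp
    | add X Y hX hY => simp only [map_add, mul_add, hX, hY]
    | tmul y z => simp [F, ← mul_assoc]
  -- Both sides are convolution inverses of Δ, one on the left and Δ ∘ S on the right, so they
  -- coincide.
  have := left_inv_eq_right_inv hG LinearMap.comul_right_inv
  exact (LinearMap.congr_fun (congrArg WithConv.ofConv this) x).symm

end HopfIdentities

/-! ### The antipode on the R-matrix and the Drinfeld element. -/

section RMatrixIdentities

variable {H : Type*} [Ring H] [HopfAlgebra ℂ H]

local notation "𝐒" => HopfAlgebra.antipode ℂ (A := H)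
local notation "Δ" => Coalgebra.comul (R := ℂ) (A := H)
local notation "ε" => Coalgebra.counit (R := ℂ) (A := H)

theorem antipode_mul (x y : H) : 𝐒 (x * y) = 𝐒 y * 𝐒 x := HopfAlgebra.antipode_mul_antidistrib x y

theorem antipode_one : 𝐒 (1 : H) = 1 := HopfAlgebra.antipode_one

theorem map_inv_of_map_eq {A B : Type*} [Ring A] [Algebra ℂ A] [Ring B] [Algebra ℂ B]
    (F G₁ G₂ : A →ₐ[ℂ] B) (r : Aˣ) (h : F r = G₁ r * G₂ r) :
    F (r⁻¹ : Aˣ) = G₂ (r⁻¹ : Aˣ) * G₁ (r⁻¹ : Aˣ) := by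
  refine left_inv_eq_right_inv (a := F r) ?_ ?_
  · rw [← map_mul, Units.inv_mul, map_one]
  · rw [h, mul_assoc, ← mul_assoc (G₂ r), ← map_mul, Units.mul_inv, map_one, one_mul, ← map_mul,
      Units.mul_inv, map_one]

/-- `R₁₂ (Δ ⊗ id)(X) = (Δᵒᵖ ⊗ id)(X) R₁₂`. -/
theorem IsUniversalRMatrix.leg12_mul_comulLeft {R : (H ⊗[ℂ] H)ˣ} (hR : IsUniversalRMatrix R)
    (X : H ⊗[ℂ] H) : leg12 (R : H ⊗[ℂ] H) * comulLeft H X =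
      swap12 H (comulLeft H X) * leg12 (R : H ⊗[ℂ] H) := by
  induction X with
  | zero => simp
  | tmul x y =>
    have hc : ∀ Z : H ⊗[ℂ] H, (1 : H) ⊗ₜ[ℂ] ((1 : H) ⊗ₜ[ℂ] y) * leg12 Z =
        leg12 Z * (1 : H) ⊗ₜ[ℂ] ((1 : H) ⊗ₜ[ℂ] y) := by
      intro Z
      induction Z with
      | zero => simp
      | tmul a b => simp
      | add X Y hX hY => simp only [map_add, mul_add, add_mul, hX, hY]
    rw [comulLeft_tmul, map_mul, swap12_leg12, swap12_tmul, ← mul_assoc, ← map_mul,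
      hR.comul_op, map_mul, mul_assoc, mul_assoc, hc]
  | add X Y hX hY => simp only [map_add, mul_add, add_mul, hX, hY]

variable (H) in
/-- `ε ⊗ id`. -/
def counitLeft : H ⊗[ℂ] H →ₐ[ℂ] H :=
  (Algebra.TensorProduct.lid ℂ H).toAlgHom.comp
    (Algebra.TensorProduct.map (Bialgebra.counitAlgHom ℂ H) (AlgHom.id ℂ H))

variable (H) in
/-- `id ⊗ ε`. -/
def counitRight : H ⊗[ℂ] H →ₐ[ℂ] H :=
  (Algebra.TensorProduct.rid ℂ ℂ H).toAlgHom.comp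
    (Algebra.TensorProduct.map (AlgHom.id ℂ H) (Bialgebra.counitAlgHom ℂ H))

@[simp] theorem counitLeft_tmul (x y : H) : counitLeft H (x ⊗ₜ y) = ε x • y := by
  simp [counitLeft]

@[simp] theorem counitRight_tmul (x y : H) : counitRight H (x ⊗ₜ y) = ε y • x := by
  simp [counitRight]

/-- The map `a ⊗ b ↦ S(b) a`. -/
def antipodeMulSwap : H ⊗[ℂ] H →ₗ[ℂ] H := lin₂ fun a b => 𝐒 b * a

theorem drinfeldElement_eq (R : (H ⊗[ℂ] H)ˣ) :
    drinfeldElement R = antipodeMulSwap (R : H ⊗[ℂ] H) := by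
  rw [drinfeldElement, coe_swapped]
  induction (R : H ⊗[ℂ] H) with
  | zero => simp
  | tmul a b => simp [antipodeMulSwap]
  | add X Y hX hY => simp only [map_add, hX, hY]

theorem mul'_rTensor_comul_three (x y : H) : (lin₃ fun a b c => (𝐒 a * b) ⊗ₜ[ℂ] c :
    H ⊗[ℂ] (H ⊗[ℂ] H) →ₗ[ℂ] H ⊗[ℂ] H) (comulLeft H (x ⊗ₜ y)) = ε x • ((1 : H) ⊗ₜ[ℂ] y) := by
  rw [apply_comulLeft_tmul]
  exact comul_antipode_left _ ((TensorProduct.mk ℂ H H).flip y) (fun a b => by simp) x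

namespace IsUniversalRMatrix

variable {R : (H ⊗[ℂ] H)ˣ} (hR : IsUniversalRMatrix R)
include hR

/-- Applying ε ⊗ id ⊗ id to (Δ ⊗ id)(R) = R₁₃R₂₃ gives R = (1 ⊗ (ε ⊗ id)(R)) R, and R is invertible.
-/
theorem counitLeft_eq : counitLeft H (R : H ⊗[ℂ] H) = 1 := by
  let F : H ⊗[ℂ] (H ⊗[ℂ] H) →ₐ[ℂ] H ⊗[ℂ] H :=
    (Algebra.TensorProduct.lid ℂ (H ⊗[ℂ] H)).toAlgHom.comp
      (Algebra.TensorProduct.map (Bialgebra.counitAlgHom ℂ H) (AlgHom.id ℂ (H ⊗[ℂ] H)))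
  have hF : ∀ x y z : H, F (x ⊗ₜ (y ⊗ₜ z)) = ε x • (y ⊗ₜ z) := fun x y z => by simp [F]
  have h1 : ∀ X : H ⊗[ℂ] H, F (comulLeft H X) = X := by
    intro X
    induction X with
    | zero => simp
    | add X Y hX hY => simp only [map_add, hX, hY]
    | tmul x y =>
      change F.toLinearMap _ = _
      rw [apply_comulLeft_tmul]
      exact comul_counit_left _ ((TensorProduct.mk ℂ H H).flip y) (fun a b => by simp [hF]) x
  have h2 : ∀ X : H ⊗[ℂ] H, F (leg13 X) = (1 : H) ⊗ₜ counitLeft H X := by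
    intro X
    induction X with
    | zero => simp
    | add X Y hX hY => simp only [map_add, hX, hY, TensorProduct.tmul_add]
    | tmul x y => simp [hF]
  have h3 : ∀ X : H ⊗[ℂ] H, F (leg23 X) = X := by
    intro X
    induction X with
    | zero => simp
    | add X Y hX hY => simp only [map_add, hX, hY]
    | tmul x y => simp [hF]
  have h4 := congrArg F hR.comulLeft_eq
  rw [map_mul, h1, h2, h3] at h4
  have h5 : (1 : H) ⊗ₜ[ℂ] counitLeft H (R : H ⊗[ℂ] H) = 1 := by
    rwa [← Units.mul_left_inj R, one_mul, eq_comm]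
  have h6 := congrArg (counitLeft H) h5
  rwa [counitLeft_tmul, Bialgebra.counit_one, one_smul, map_one] at h6

theorem counitRight_eq : counitRight H (R : H ⊗[ℂ] H) = 1 := by
  let F : H ⊗[ℂ] (H ⊗[ℂ] H) →ₐ[ℂ] H ⊗[ℂ] H :=
      (Algebra.TensorProduct.map (AlgHom.id ℂ H) (counitLeft H))
  have hF : ∀ x y z : H, F (x ⊗ₜ (y ⊗ₜ z)) = ε y • (x ⊗ₜ z) := fun x y z => by simp [F]
  have h1 : ∀ X : H ⊗[ℂ] H, F (comulRight H X) = X := by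
    intro X
    induction X with
    | zero => simp
    | add X Y hX hY => simp only [map_add, hX, hY]
    | tmul x y =>
      have h := apply_comulRight_tmul F.toLinearMap x y
      rw [AlgHom.toLinearMap_apply] at h
      rw [h]
      exact comul_counit_left _ (TensorProduct.mk ℂ H H x) (fun a b => by simp [hF]) y
  have h2 : ∀ X : H ⊗[ℂ] H, F (leg12 X) = counitRight H X ⊗ₜ (1 : H) := by
    intro X
    induction X with
    | zero => simp
    | add X Y hX hY => simp only [map_add, hX, hY, TensorProduct.add_tmul]
    | tmul x y => simp [hF, TensorProduct.smul_tmul']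
  have h3 : ∀ X : H ⊗[ℂ] H, F (leg13 X) = X := by
    intro X
    induction X with
    | zero => simp
    | add X Y hX hY => simp only [map_add, hX, hY]
    | tmul x y => simp [hF]
  have h4 := congrArg F hR.comulRight_eq
  rw [map_mul, h1, h2, h3] at h4
  have h5 : counitRight H (R : H ⊗[ℂ] H) ⊗ₜ[ℂ] (1 : H) = 1 := by
    rwa [← Units.mul_right_inj R, mul_one, eq_comm]
  have h6 := congrArg (counitRight H) h5
  rwa [counitRight_tmul, Bialgebra.counit_one, one_smul, map_one] at h6

/-- `(S ⊗ id)(R) = R⁻¹`. -/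
theorem rTensor_antipode : (𝐒).rTensor H (R : H ⊗[ℂ] H) = (R⁻¹ : (H ⊗[ℂ] H)ˣ) := by
  -- This map turns (Δ ⊗ id)(R) = R₁₃R₂₃ into 1 = (S ⊗ id)(R) R.
  let F : H ⊗[ℂ] (H ⊗[ℂ] H) →ₗ[ℂ] H ⊗[ℂ] H := lin₃ fun a b c => (𝐒 a * b) ⊗ₜ[ℂ] c
  have h1 : ∀ X : H ⊗[ℂ] H, F (comulLeft H X) = (1 : H) ⊗ₜ counitLeft H X := by
    intro X
    induction X with
    | zero => simp
    | add X Y hX hY => simp only [map_add, hX, hY, TensorProduct.tmul_add]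
    | tmul x y => simp [F, mul'_rTensor_comul_three]
  have h2 : ∀ X Y : H ⊗[ℂ] H, F (leg13 X * leg23 Y) = (𝐒).rTensor H X * Y := by
    intro X Y
    induction X with
    | zero => simp
    | add X X' hX hX' => simp only [map_add, add_mul, hX, hX']
    | tmul x y =>
      induction Y with
      | zero => simp
      | add Y Y' hY hY' => simp only [map_add, mul_add, hY, hY']
      | tmul z t => simp [F]
  have h3 := congrArg F hR.comulLeft_eq
  rw [h1, h2, hR.counitLeft_eq, ← Algebra.TensorProduct.one_def] at h3
  exact left_inv_eq_right_inv h3.symm (Units.mul_inv R)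

/-- `(id ⊗ S)(R⁻¹) = R`. -/
theorem lTensor_antipode_inv :
    (𝐒).lTensor H ((R⁻¹ : (H ⊗[ℂ] H)ˣ) : H ⊗[ℂ] H) = R := by
  let F : H ⊗[ℂ] (H ⊗[ℂ] H) →ₗ[ℂ] H ⊗[ℂ] H := lin₃ fun a b c => a ⊗ₜ[ℂ] (𝐒 b * c)
  have hF : ∀ a b c : H, F (a ⊗ₜ (b ⊗ₜ c)) = a ⊗ₜ[ℂ] (𝐒 b * c) := fun a b c =>
    lin₃_tmul_tmul _ _ _ _ _ _ _ a b c
  have h1 : ∀ X : H ⊗[ℂ] H, F (comulRight H X) = counitRight H X ⊗ₜ (1 : H) := by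
    intro X
    induction X with
    | zero => simp
    | add X Y hX hY => simp only [map_add, hX, hY, TensorProduct.add_tmul]
    | tmul x y =>
      rw [apply_comulRight_tmul, counitRight_tmul, ← TensorProduct.smul_tmul']
      exact comul_antipode_left _ (TensorProduct.mk ℂ H H x) (fun a b => by simp [hF]) y
  have h2 : ∀ X Y : H ⊗[ℂ] H, F (leg12 X * leg13 Y) = (𝐒).lTensor H X * Y := by
    intro X Y
    induction X with
    | zero => simp
    | add X X' hX hX' => simp only [map_add, add_mul, hX, hX']
    | tmul x y =>
      induction Y with
      | zero => simp
      | add Y Y' hY hY' => simp only [map_add, mul_add, hY, hY']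
      | tmul z t => simp [hF]
  -- For R⁻¹ the order of the legs is reversed, which suits F: the result is 1 = (id ⊗ S)(R⁻¹) R⁻¹.
  have hc : comulRight H ((R⁻¹ : (H ⊗[ℂ] H)ˣ) : H ⊗[ℂ] H) =
      leg12 ((R⁻¹ : (H ⊗[ℂ] H)ˣ) : H ⊗[ℂ] H) * leg13 ((R⁻¹ : (H ⊗[ℂ] H)ˣ) : H ⊗[ℂ] H) :=
    map_inv_of_map_eq _ _ _ R hR.comulRight_eq
  have h3 := congrArg F hc
  have h4 : counitRight H ((R⁻¹ : (H ⊗[ℂ] H)ˣ) : H ⊗[ℂ] H) = 1 := by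
    have := congrArg (counitRight H) (Units.inv_mul R)
    rwa [map_mul, map_one, hR.counitRight_eq, mul_one] at this
  rw [h1, h2, h4, ← Algebra.TensorProduct.one_def] at h3
  exact left_inv_eq_right_inv h3.symm (Units.inv_mul R)

/-- `(S ⊗ S)(R) = R`. -/
theorem map_antipode : TensorProduct.map 𝐒 𝐒 (R : H ⊗[ℂ] H) = R := by
  rw [← LinearMap.lTensor_comp_rTensor, LinearMap.comp_apply, hR.rTensor_antipode,
    hR.lTensor_antipode_inv]

/-- `(S² ⊗ S²)(R) = R`. -/
theorem map_antipode_sq : TensorProduct.map (𝐒 ∘ₗ 𝐒) (𝐒 ∘ₗ 𝐒) (R : H ⊗[ℂ] H) = R := by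
  rw [TensorProduct.map_comp, LinearMap.comp_apply, hR.map_antipode, hR.map_antipode]

/-- `S²(x) u = u x`. -/
theorem antipode_sq_mul (x : H) :
    𝐒 (𝐒 x) * drinfeldElement R = drinfeldElement R * x := by
  rw [drinfeldElement_eq]
  -- Applied to R₁₂ (Δ ⊗ id)Δ(x) = (Δᵒᵖ ⊗ id)Δ(x) R₁₂: on the left x'' S(x''') collapses under S and
  -- leaves u x, on the right S(x')x'' collapses and leaves S²(x) u.
  let F : H ⊗[ℂ] (H ⊗[ℂ] H) →ₗ[ℂ] H := lin₃ fun a b c => 𝐒 (𝐒 c) * 𝐒 b * a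
  have h1 : ∀ X Y : H ⊗[ℂ] H, F (leg12 X * comulRight H Y) =
      antipodeMulSwap X * counitRight H Y := by
    intro X Y
    induction X with
    | zero => simp
    | add X X' hX hX' => simp only [map_add, add_mul, hX, hX']
    | tmul a b =>
      induction Y with
      | zero => simp
      | add Y Y' hY hY' => simp only [map_add, mul_add, hY, hY']
      | tmul y z =>
        have h := apply_comulRight_tmul (F ∘ₗ LinearMap.mulLeft ℂ (leg12 (a ⊗ₜ b))) y z
        rw [LinearMap.comp_apply, LinearMap.mulLeft_apply] at h
        rw [h, counitRight_tmul, mul_smul_comm]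
        refine (comul_antipode_right _ (lin₁ fun t => 𝐒 t * 𝐒 b * a * y) (fun p q => ?_) z).trans ?_
        · simp [F, antipode_mul, mul_assoc]
        · simp [antipodeMulSwap]
  have h2 : ∀ X Y : H ⊗[ℂ] H, F (swap12 H (comulLeft H Y) * leg12 X) =
      𝐒 (𝐒 (counitLeft H Y)) * antipodeMulSwap X := by
    intro X Y
    induction X with
    | zero => simp
    | add X X' hX hX' => simp only [map_add, mul_add, hX, hX']
    | tmul a b =>
      induction Y with
      | zero => simp
      | add Y Y' hY hY' => simp only [map_add, add_mul, hY, hY']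
      | tmul y z =>
        have h := apply_comulLeft_tmul (F ∘ₗ LinearMap.mulRight ℂ (leg12 (a ⊗ₜ b)) ∘ₗ
          (swap12 H).toLinearMap) y z
        simp only [LinearMap.comp_apply, LinearMap.mulRight_apply, AlgHom.toLinearMap_apply] at h
        rw [h, counitLeft_tmul]
        refine (comul_antipode_left _ (lin₁ fun t => 𝐒 (𝐒 z) * (𝐒 b * (t * a)))
          (fun p q => ?_) y).trans ?_
        · simp [F, antipode_mul, mul_assoc]
        · simp [antipodeMulSwap]
  have h3 := congrArg F (hR.leg12_mul_comulLeft (Δ x))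
  rw [← comulRight_comul, h1, comulRight_comul, h2] at h3
  have h4 : counitRight H (Δ x) = x :=
    comul_counit_right (counitRight H).toLinearMap LinearMap.id (fun a b => by simp) x
  have h5 : counitLeft H (Δ x) = x :=
    comul_counit_left (counitLeft H).toLinearMap LinearMap.id (fun a b => by simp) x
  rw [h4, h5] at h3
  exact h3.symm

/-- `∑ aᵢ S(bᵢ) = S(u)`. -/
theorem mul_antipode_eq :
    (lin₂ fun a b => a * 𝐒 b : H ⊗[ℂ] H →ₗ[ℂ] H) R = 𝐒 (drinfeldElement R) := by
  have h : ∀ X : H ⊗[ℂ] H, (lin₂ fun a b => a * 𝐒 b : H ⊗[ℂ] H →ₗ[ℂ] H)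
      (TensorProduct.map 𝐒 𝐒 X) = 𝐒 (antipodeMulSwap X) := by
    intro X
    induction X with
    | zero => simp
    | add X Y hX hY => simp only [map_add, hX, hY]
    | tmul a b => simp [antipodeMulSwap, antipode_mul]
  rw [drinfeldElement_eq, ← h, hR.map_antipode]

/-- The formula `u⁻¹ = ∑ bᵢ S²(aᵢ)`. -/
theorem drinfeldElement_mul_eq_one : drinfeldElement R *
    (lin₂ fun a b => b * 𝐒 (𝐒 a) : H ⊗[ℂ] H →ₗ[ℂ] H) R = 1 := by
  have h1 : ∀ X Y : H ⊗[ℂ] H, antipodeMulSwap (X * Y) =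
      (lin₂ fun a b => b * antipodeMulSwap X * a : H ⊗[ℂ] H →ₗ[ℂ] H) ((𝐒).lTensor H Y) := by
    intro X Y
    induction Y with
    | zero => simp
    | add Y Y' hY hY' => simp only [map_add, mul_add, hY, hY']
    | tmul c d =>
      induction X with
      | zero => simp
      | tmul a b => simp [antipodeMulSwap, antipode_mul, mul_assoc]
      | add X X' hX hX' =>
        rw [add_mul, map_add, hX, hX']
        simp only [LinearMap.lTensor_tmul, lin₂_tmul, map_add, mul_add, add_mul]
  -- From R R⁻¹ = 1 comes 1 = ∑ bᵢ u aᵢ; by S² ⊗ S² invariance this is ∑ S²(bᵢ) u S²(aᵢ) = u ∑ bᵢ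
  -- S²(aᵢ).
  have h2 := h1 (R : H ⊗[ℂ] H) ((R⁻¹ : (H ⊗[ℂ] H)ˣ) : H ⊗[ℂ] H)
  rw [Units.mul_inv, hR.lTensor_antipode_inv, ← drinfeldElement_eq] at h2
  have h3 : ∀ X : H ⊗[ℂ] H, (lin₂ fun a b => b * drinfeldElement R * a : H ⊗[ℂ] H →ₗ[ℂ] H)
      (TensorProduct.map (𝐒 ∘ₗ 𝐒) (𝐒 ∘ₗ 𝐒) X) = drinfeldElement R *
      (lin₂ fun a b => b * 𝐒 (𝐒 a) : H ⊗[ℂ] H →ₗ[ℂ] H) X := by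
    intro X
    induction X with
    | zero => simp
    | add X Y hX hY => simp only [map_add, mul_add, hX, hY]
    | tmul a b =>
      simp only [TensorProduct.map_tmul, LinearMap.comp_apply, lin₂_tmul]
      rw [hR.antipode_sq_mul, mul_assoc]
  rw [← h3, hR.map_antipode_sq, ← h2, Algebra.TensorProduct.one_def]
  simp [antipodeMulSwap]

/-- The element `(R')⁻¹` is a universal `R`-matrix too. -/
theorem inv_swapped : IsUniversalRMatrix (swapped R)⁻¹ where
  comul_op h := by
    have h1 := congrArg flip (hR.comul_op h)
    rw [map_mul, map_mul, flip_flip, ← coe_swapped] at h1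
    rw [Units.inv_mul_eq_iff_eq_mul, ← mul_assoc, h1, mul_assoc, Units.mul_inv, mul_one]
  comul_left := map_inv_of_map_eq (comulLeft H) leg23 leg13 _ hR.comulLeft_swapped
  comul_right := map_inv_of_map_eq (comulRight H) leg12 leg13 _ hR.comulRight_swapped

/-- The Drinfeld element of `(R')⁻¹` is the inverse of `S(u)`. -/
theorem antipode_mul_drinfeldElement_inv_swapped :
    drinfeldElement (swapped R)⁻¹ * 𝐒 (drinfeldElement R) = 1 := by
  have h : ∀ X : H ⊗[ℂ] H, antipodeMulSwap (flip ((𝐒).rTensor H X)) =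
      (lin₂ fun a b => 𝐒 (𝐒 a) * b : H ⊗[ℂ] H →ₗ[ℂ] H) X := by
    intro X
    induction X with
    | zero => simp
    | add X Y hX hY => simp only [map_add, hX, hY]
    | tmul a b => simp [antipodeMulSwap]
  have h' : ∀ X : H ⊗[ℂ] H, (lin₂ fun a b => 𝐒 (𝐒 a) * b : H ⊗[ℂ] H →ₗ[ℂ] H)
      (TensorProduct.map 𝐒 𝐒 X) =
      𝐒 ((lin₂ fun a b => b * 𝐒 (𝐒 a) : H ⊗[ℂ] H →ₗ[ℂ] H) X) := by
    intro X
    induction X with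
    | zero => simp
    | add X Y hX hY => simp only [map_add, hX, hY]
    | tmul a b => simp [antipode_mul]
  rw [drinfeldElement_eq (swapped R)⁻¹, coe_swapped_inv, ← hR.rTensor_antipode, h]
  nth_rw 1 [← hR.map_antipode]
  rw [h', ← antipode_mul, hR.drinfeldElement_mul_eq_one, antipode_one]

end IsUniversalRMatrix

end RMatrixIdentities

/-! ### Left integrals, cointegrals and nondegeneracy. -/

section Integrals

variable {H : Type*} [Ring H] [HopfAlgebra ℂ H]

local notation "𝐒" => HopfAlgebra.antipode ℂ (A := H)
local notation "Δ" => Coalgebra.comul (R := ℂ) (A := H)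
local notation "ε" => Coalgebra.counit (R := ℂ) (A := H)

/-- The map `id ⊗ β`. -/
def rightSlice (β : Module.Dual ℂ H) : H ⊗[ℂ] H →ₗ[ℂ] H := lin₂ fun a b => β b • a

@[simp] theorem rightSlice_tmul (β : Module.Dual ℂ H) (a b : H) :
    rightSlice β (a ⊗ₜ b) = β b • a := lin₂_tmul _ _ _ _ _ a b

theorem rightSlice_eq (β : Module.Dual ℂ H) (X : H ⊗[ℂ] H) :
    rightSlice β X = TensorProduct.rid ℂ H (β.lTensor H X) := by
  induction X with
  | zero => simp
  | tmul a b => simp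
  | add X Y hX hY => simp only [map_add, hX, hY]

theorem rightSlice_add (β γ : Module.Dual ℂ H) (X : H ⊗[ℂ] H) :
    rightSlice (β + γ) X = rightSlice β X + rightSlice γ X := by
  simp [rightSlice_eq, LinearMap.lTensor_add]

theorem rightSlice_smul (c : ℂ) (β : Module.Dual ℂ H) (X : H ⊗[ℂ] H) :
    rightSlice (c • β) X = c • rightSlice β X := by
  simp [rightSlice_eq, LinearMap.lTensor_smul]

theorem rightSlice_tmul_mul (β : Module.Dual ℂ H) (a b : H) (X : H ⊗[ℂ] H) :
    rightSlice β ((a ⊗ₜ b) * X) = a * rightSlice (β ∘ₗ LinearMap.mulLeft ℂ b) X := by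
  induction X with
  | zero => simp
  | tmul a b => simp
  | add X Y hX hY => simp only [map_add, mul_add, hX, hY]

theorem rightSlice_mul_tmul (β : Module.Dual ℂ H) (a b : H) (X : H ⊗[ℂ] H) :
    rightSlice β (X * (a ⊗ₜ b)) = rightSlice (β ∘ₗ LinearMap.mulRight ℂ b) X * a := by
  induction X with
  | zero => simp
  | tmul a b => simp
  | add X Y hX hY => simp only [map_add, add_mul, hX, hY]

/-- The form `x ↦ β(y x)`. -/
def actL (β : Module.Dual ℂ H) : H →ₗ[ℂ] Module.Dual ℂ H where
  toFun y := β ∘ₗ LinearMap.mulLeft ℂ y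
  map_add' y z := by ext x; simp [add_mul]
  map_smul' c y := by ext x; simp

/-- The form `x ↦ β(x y)`. -/
def actR (β : Module.Dual ℂ H) : H →ₗ[ℂ] Module.Dual ℂ H where
  toFun y := β ∘ₗ LinearMap.mulRight ℂ y
  map_add' y z := by ext x; simp [mul_add]
  map_smul' c y := by ext x; simp

@[simp] theorem actL_apply (β : Module.Dual ℂ H) (y x : H) : actL β y x = β (y * x) := rfl
@[simp] theorem actR_apply (β : Module.Dual ℂ H) (y x : H) : actR β y x = β (x * y) := rfl

theorem rightSlice_tmul_mul' (β : Module.Dual ℂ H) (a b : H) (X : H ⊗[ℂ] H) :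
    rightSlice β ((a ⊗ₜ b) * X) = a * rightSlice (actL β b) X := rightSlice_tmul_mul β a b X

theorem apply_cointegral {μ : Module.Dual ℂ H} {Λ : H}
    (hΛ : ∀ x : H, μ (x * Λ) = Coalgebra.counit (R := ℂ) x) : μ Λ = 1 := by
  rw [← one_mul Λ, hΛ, Bialgebra.counit_one]

namespace IsLeftIntegral

variable {μ : Module.Dual ℂ H} (hμ : IsLeftIntegral μ)
include hμ

theorem rightSlice_comul (x : H) : rightSlice μ (Δ x) = μ x • (1 : H) := by
  rw [rightSlice_eq, hμ.integral]

/-- `∑ y' μ(x y'') = ∑ S(x') μ(x'' y)`. -/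
theorem rightSlice_actL_comul (x y : H) :
    rightSlice (actL μ x) (Δ y) = (lin₂ fun a b => μ (b * y) • 𝐒 a) (Δ x) := by
  -- Both sides equal ∑ S(x') x'' y' μ(x''' y''): collapse S(x')x'' for one, and use the integral
  -- property on Δ(x''y) for the other.
  let F : H ⊗[ℂ] (H ⊗[ℂ] H) →ₗ[ℂ] H := lin₃ (fun a b c => 𝐒 a * (b * rightSlice (actL μ c) (Δ y)))
    (by simp [add_mul]) (by simp) (by simp [mul_add, add_mul]) (by simp)
    (by intros; rw [map_add, rightSlice_add, mul_add, mul_add])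
    (by intros; rw [map_smul, rightSlice_smul, mul_smul_comm, mul_smul_comm])
  have hF : ∀ a b c, F (a ⊗ₜ (b ⊗ₜ c)) = 𝐒 a * (b * rightSlice (actL μ c) (Δ y)) :=
    fun a b c => lin₃_tmul_tmul _ _ _ _ _ _ _ a b c
  have h1 : F (comulLeft H (Δ x)) = rightSlice (actL μ x) (Δ y) := by
    refine comul_counit_left (F ∘ₗ (comulLeft H).toLinearMap)
      (lin₁ (fun c => rightSlice (actL μ c) (Δ y)) (by intros; rw [map_add, rightSlice_add])
        (by intros; rw [map_smul, rightSlice_smul])) (fun a c => ?_) x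
    rw [LinearMap.comp_apply, AlgHom.toLinearMap_apply, apply_comulLeft_tmul]
    refine (comul_antipode_left _ (LinearMap.mulRight ℂ (rightSlice (actL μ c) (Δ y)))
      (fun a b => ?_) a).trans ?_
    · simp [hF, mul_assoc]
    · simp
  have h2 : ∀ X : H ⊗[ℂ] H, F (comulRight H X) = (lin₂ fun a b => μ (b * y) • 𝐒 a) X := by
    intro X
    induction X with
    | zero => simp
    | add X Y hX hY => simp only [map_add, hX, hY]
    | tmul a b =>
      rw [apply_comulRight_tmul, lin₂_tmul]
      have h3 : ∀ X : H ⊗[ℂ] H, (lin₂ fun p q => F (a ⊗ₜ[ℂ] (p ⊗ₜ[ℂ] q))) X =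
          𝐒 a * rightSlice μ (X * Δ y) := by
        intro X
        induction X with
        | zero => simp
        | add X Y hX hY => simp only [map_add, add_mul, mul_add, hX, hY]
        | tmul p q => rw [lin₂_tmul, hF, rightSlice_tmul_mul']
      rw [h3, ← Bialgebra.comul_mul, hμ.rightSlice_comul, mul_smul_comm, mul_one]
  rw [← h1, ← comulRight_comul, h2]

/-- Let N be the kernel. The previous identity shows Δ(N) ⊆ H ⊗ N; then ε vanishes on N, because
ε(y)μ(z) = ∑ μ(z S(y') y'') = 0 for y in N, with z chosen so that μ(z) ≠ 0. Hence y = ∑ y' ε(y'') =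
0. Finite dimension plays no role. -/
theorem actR_injective : Function.Injective (actR μ) := by
  rw [← LinearMap.ker_eq_bot, Submodule.eq_bot_iff]
  let ℬ := Module.Basis.ofVectorSpace ℂ H
  have key : ∀ y : H, actR μ y = 0 → ∃ c : Module.Basis.ofVectorSpaceIndex ℂ H →₀ H,
      Δ y = c.sum (fun i z => ℬ i ⊗ₜ z) ∧ ∀ i, actR μ (c i) = 0 := by
    intro y hy
    obtain ⟨c, hc⟩ := TensorProduct.eq_repr_basis_left ℬ (Δ y)
    refine ⟨c, hc.symm, fun i => ?_⟩
    ext x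
    have h1 := hμ.rightSlice_actL_comul x y
    have h2 : (lin₂ fun a b => μ (b * y) • 𝐒 a : H ⊗[ℂ] H →ₗ[ℂ] H) = 0 :=
      TensorProduct.ext' fun a b => by
        have := LinearMap.congr_fun hy b
        simp only [actR_apply, LinearMap.zero_apply] at this
        simp [this]
    rw [h2, LinearMap.zero_apply, ← hc, Finsupp.sum, map_sum] at h1
    simp only [rightSlice_tmul, actL_apply] at h1
    by_cases hi : i ∈ c.support
    · exact linearIndependent_iff'.1 ℬ.linearIndependent c.support (fun i => μ (x * c i)) h1 i hi
    · simp [Finsupp.notMem_support_iff.1 hi]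
  have hε : ∀ y : H, actR μ y = 0 → ε y = 0 := by
    intro y hy
    obtain ⟨c, hc, h0⟩ := key y hy
    obtain ⟨z, hz⟩ : ∃ z, μ z ≠ 0 := by
      by_contra! h
      exact hμ.ne_zero (LinearMap.ext h)
    have h1 := comul_antipode_left (lin₂ fun a b => μ (z * (𝐒 a * b))) (μ ∘ₗ LinearMap.mulLeft ℂ z)
      (fun a b => by simp) y
    rw [hc, Finsupp.sum, map_sum] at h1
    have h2 : ∀ i ∈ c.support, (lin₂ fun a b => μ (z * (𝐒 a * b))) (ℬ i ⊗ₜ[ℂ] c i) = 0 := by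
      intro i _
      have := LinearMap.congr_fun (h0 i) (z * 𝐒 (ℬ i))
      rw [lin₂_tmul, ← mul_assoc]
      exact this
    rw [Finset.sum_eq_zero h2] at h1
    simpa [hz] using h1
  intro y hy
  obtain ⟨c, hc, h0⟩ := key y hy
  have h1 := comul_counit_right (lin₂ fun a b => ε b • a) LinearMap.id (fun a b => by simp) y
  rw [hc, Finsupp.sum, map_sum] at h1
  rw [← LinearMap.id_apply (R := ℂ) y, ← h1]
  refine Finset.sum_eq_zero fun i _ => ?_
  rw [lin₂_tmul, hε _ (h0 i), zero_smul]

section Cointegral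

variable {Λ : H} (hΛ : ∀ x : H, μ (x * Λ) = Coalgebra.counit (R := ℂ) x)
include hΛ

/-- By injectivity it suffices to apply μ(y ?), where both sides give ε(y)ε(x). -/
theorem mul_cointegral (x : H) : x * Λ = ε x • Λ :=
  hμ.actR_injective <| by
    ext y
    rw [actR_apply, map_smul, LinearMap.smul_apply, actR_apply, ← mul_assoc, hΛ, hΛ,
      Bialgebra.counit_mul, smul_eq_mul, mul_comm]

/-- The element Λx is again a left cointegral, hence a multiple of Λ. The factor μ(Λx) is the
modular character, which unimodularity will identify with ε. -/
theorem cointegral_mul (x : H) : Λ * x = μ (Λ * x) • Λ :=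
  hμ.actR_injective <| by
    ext y
    rw [actR_apply, map_smul, LinearMap.smul_apply, actR_apply, ← mul_assoc,
      hμ.mul_cointegral hΛ, smul_mul_assoc, map_smul, map_smul, apply_cointegral hΛ, smul_eq_mul, smul_eq_mul, smul_eq_mul,
      mul_one, mul_comm]

/-- `∑ Λ' μ(x Λ'') = S(x)`. -/
theorem rightSlice_comul_cointegral (x : H) : rightSlice (actL μ x) (Δ Λ) = 𝐒 x := by
  rw [hμ.rightSlice_actL_comul]
  exact comul_counit_right _ 𝐒 (fun a b => by simp [hΛ]) x

/-- `∑ S(x) Λ' ⊗ Λ'' = ∑ Λ' ⊗ x Λ''`. -/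
theorem antipode_mul_comul_cointegral (x : H) :
    (𝐒 x ⊗ₜ[ℂ] (1 : H)) * Δ Λ = ((1 : H) ⊗ₜ[ℂ] x) * Δ Λ := by
  let F : H ⊗[ℂ] (H ⊗[ℂ] H) →ₗ[ℂ] H ⊗[ℂ] H := lin₃ fun a b c => ((𝐒 a * b) ⊗ₜ[ℂ] c) * Δ Λ
  have hF : ∀ a b c, F (a ⊗ₜ (b ⊗ₜ c)) = ((𝐒 a * b) ⊗ₜ[ℂ] c) * Δ Λ :=
    fun a b c => lin₃_tmul_tmul _ _ _ _ _ _ _ a b c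
  have h1 : F (comulLeft H (Δ x)) = ((1 : H) ⊗ₜ[ℂ] x) * Δ Λ := by
    refine comul_counit_left (F ∘ₗ (comulLeft H).toLinearMap)
      (lin₁ fun c => ((1 : H) ⊗ₜ[ℂ] c) * Δ Λ) (fun a c => ?_) x
    rw [LinearMap.comp_apply, AlgHom.toLinearMap_apply, apply_comulLeft_tmul]
    refine (comul_antipode_left _ (lin₁ fun t => (t ⊗ₜ[ℂ] c) * Δ Λ) (fun p q => ?_) a).trans ?_
    · rw [lin₂_tmul, hF, lin₁_apply]
    · rw [lin₁_apply, lin₁_apply]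
  rw [← h1, ← comulRight_comul]
  refine (comul_counit_right (F ∘ₗ (comulRight H).toLinearMap)
      (lin₁ fun c => (𝐒 c ⊗ₜ[ℂ] (1 : H)) * Δ Λ) (fun a b => ?_) x).symm
  rw [LinearMap.comp_apply, AlgHom.toLinearMap_apply, apply_comulRight_tmul]
  have h3 : ∀ X : H ⊗[ℂ] H, (lin₂ fun p q => F (a ⊗ₜ[ℂ] (p ⊗ₜ[ℂ] q))) X =
      (𝐒 a ⊗ₜ[ℂ] (1 : H)) * (X * Δ Λ) := by
    intro X
    induction X with
    | zero => simp
    | add X Y hX hY => simp only [map_add, add_mul, mul_add, hX, hY]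
    | tmul p q => rw [lin₂_tmul, hF, ← mul_assoc, Algebra.TensorProduct.tmul_mul_tmul, one_mul]
  rw [h3, ← Bialgebra.comul_mul, hμ.mul_cointegral hΛ, map_smul, mul_smul_comm, lin₁_apply]

/-- `∑ Λ' x ⊗ Λ'' = ∑ μ(Λ x') Λ' ⊗ Λ'' S(x'')`. -/
theorem comul_cointegral_mul (x : H) : Δ Λ * (x ⊗ₜ[ℂ] (1 : H)) =
    (lin₂ fun a b => μ (Λ * a) • (Δ Λ * ((1 : H) ⊗ₜ[ℂ] 𝐒 b))) (Δ x) := by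
  -- Inserting x''S(x''') turns Δ(Λ)(x ⊗ 1) into ∑ Δ(Λx')(1 ⊗ S(x'')), and Λx' is a multiple of Λ.
  let F : H ⊗[ℂ] (H ⊗[ℂ] H) →ₗ[ℂ] H ⊗[ℂ] H := lin₃ fun a b c => Δ Λ * (a ⊗ₜ[ℂ] (b * 𝐒 c))
  have hF : ∀ a b c, F (a ⊗ₜ (b ⊗ₜ c)) = Δ Λ * (a ⊗ₜ[ℂ] (b * 𝐒 c)) :=
    fun a b c => lin₃_tmul_tmul _ _ _ _ _ _ _ a b c
  have h1 : F (comulRight H (Δ x)) = Δ Λ * (x ⊗ₜ[ℂ] (1 : H)) := by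
    refine comul_counit_right (F ∘ₗ (comulRight H).toLinearMap)
      (lin₁ fun c => Δ Λ * (c ⊗ₜ[ℂ] (1 : H))) (fun a c => ?_) x
    rw [LinearMap.comp_apply, AlgHom.toLinearMap_apply, apply_comulRight_tmul]
    refine (comul_antipode_right _ (lin₁ fun t => Δ Λ * (a ⊗ₜ[ℂ] t)) (fun p q => ?_) c).trans ?_
    · rw [lin₂_tmul, hF, lin₁_apply]
    · rw [lin₁_apply, lin₁_apply]
  rw [← h1, comulRight_comul]
  induction Δ x with
  | zero => simp
  | add X Y hX hY => simp only [map_add, hX, hY]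
  | tmul a b =>
    rw [lin₂_tmul, apply_comulLeft_tmul]
    have h3 : ∀ X : H ⊗[ℂ] H, (lin₂ fun p q => F (p ⊗ₜ[ℂ] (q ⊗ₜ[ℂ] b))) X =
        Δ Λ * X * ((1 : H) ⊗ₜ[ℂ] 𝐒 b) := by
      intro X
      induction X with
      | zero => simp
      | add X Y hX hY => simp only [map_add, add_mul, mul_add, hX, hY]
      | tmul p q => rw [lin₂_tmul, hF, mul_assoc, Algebra.TensorProduct.tmul_mul_tmul, mul_one]
    rw [h3, ← Bialgebra.comul_mul, hμ.cointegral_mul hΛ, map_smul, smul_mul_assoc, map_smul,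
      apply_cointegral hΛ, smul_eq_mul, mul_one]

end Cointegral

variable [FiniteDimensional ℂ H]

theorem actR_bijective : Function.Bijective (actR μ) :=
  ⟨hμ.actR_injective, (LinearMap.injective_iff_surjective_of_finrank_eq_finrank
    Subspace.dual_finrank_eq.symm).1 hμ.actR_injective⟩

/-- If μ(x ?) = 0 then every form kills x, since every form is some μ(? y). -/
theorem actL_bijective : Function.Bijective (actL μ) := by
  have h : Function.Injective (actL μ) := by
    rw [← LinearMap.ker_eq_bot, Submodule.eq_bot_iff]
    intro x hx
    rw [← Module.forall_dual_apply_eq_zero_iff ℂ]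
    intro β
    obtain ⟨y, rfl⟩ := hμ.actR_bijective.2 β
    exact LinearMap.congr_fun hx y
  exact ⟨h, (LinearMap.injective_iff_surjective_of_finrank_eq_finrank
    Subspace.dual_finrank_eq.symm).1 h⟩

/-- There is `Λ` in `H` with `μ(x Λ) = ε(x)` for all `x`. -/
theorem exists_cointegral : ∃ Λ : H, ∀ x, μ (x * Λ) = ε x := by
  obtain ⟨Λ, h⟩ := hμ.actR_bijective.2 ε
  exact ⟨Λ, fun x => LinearMap.congr_fun h x⟩

end IsLeftIntegral

end Integrals

/-! ### Unimodularity, cyclicity of the left integral and the right integral. -/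

section Unimodularity

variable {H : Type*} [Ring H] [HopfAlgebra ℂ H]

local notation "𝐒" => HopfAlgebra.antipode ℂ (A := H)
local notation "Δ" => Coalgebra.comul (R := ℂ) (A := H)
local notation "ε" => Coalgebra.counit (R := ℂ) (A := H)

theorem IsRibbonElement.commute {R : (H ⊗[ℂ] H)ˣ} {v : Hˣ} (hv : IsRibbonElement R v) (x : H) :
    (v : H) * x = x * v := (Subalgebra.mem_center_iff.1 hv.central x).symm

theorem IsRibbonElement.inv_commute {R : (H ⊗[ℂ] H)ˣ} {v : Hˣ} (hv : IsRibbonElement R v) (x : H) :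
    ((v⁻¹ : Hˣ) : H) * x = x * (v⁻¹ : Hˣ) := by
  rw [Units.inv_mul_eq_iff_eq_mul, ← mul_assoc, hv.commute, mul_assoc, Units.mul_inv, mul_one]

theorem antipode_units_inv (v : Hˣ) (h : 𝐒 (v : H) = v) :
    𝐒 ((v⁻¹ : Hˣ) : H) = (v⁻¹ : Hˣ) := by
  refine left_inv_eq_right_inv (a := (v : H)) ?_ (Units.mul_inv v)
  rw [← h, ← antipode_mul, Units.mul_inv, antipode_one]

section Drinfeld

variable [FiniteDimensional ℂ H]

variable (H) in
theorem mul_eq_one_symm_of_finiteDimensional {x y : H} (h : x * y = 1) : y * x = 1 := by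
  have : IsArtinianRing H := IsArtinianRing.of_finite ℂ H
  exact mul_eq_one_symm h

namespace IsUniversalRMatrix

variable {R : (H ⊗[ℂ] H)ˣ} (hR : IsUniversalRMatrix R)

/-- The Drinfeld element as a unit. -/
def drinfeldUnit : Hˣ where
  val := drinfeldElement R
  inv := (lin₂ fun a b => b * 𝐒 (𝐒 a) : H ⊗[ℂ] H →ₗ[ℂ] H) R
  val_inv := hR.drinfeldElement_mul_eq_one
  inv_val := mul_eq_one_symm_of_finiteDimensional H hR.drinfeldElement_mul_eq_one

theorem coe_drinfeldUnit : (hR.drinfeldUnit : H) = drinfeldElement R := rfl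

theorem antipode_sq_mul_drinfeldUnit (x : H) :
    𝐒 (𝐒 x) * hR.drinfeldUnit = hR.drinfeldUnit * x := hR.antipode_sq_mul x

theorem antipode_antipode (x : H) :
    𝐒 (𝐒 x) = hR.drinfeldUnit * x * (hR.drinfeldUnit⁻¹ : Hˣ) := by
  rw [← hR.antipode_sq_mul_drinfeldUnit, mul_assoc, Units.mul_inv, mul_one]

include hR in
theorem antipode_injective : Function.Injective 𝐒 := by
  intro x y h
  have h1 := hR.antipode_antipode x
  rw [h, hR.antipode_antipode] at h1
  simpa using h1.symm

include hR in
theorem antipode_surjective : Function.Surjective 𝐒 := fun x =>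
  ⟨𝐒 ((hR.drinfeldUnit⁻¹ : Hˣ) * x * hR.drinfeldUnit), by
    rw [hR.antipode_antipode, ← mul_assoc, ← mul_assoc, Units.mul_inv, one_mul, mul_assoc,
      Units.mul_inv, mul_one]⟩

theorem antipode_drinfeldUnit {v : Hˣ} (hv : IsRibbonElement R v) :
    𝐒 (hR.drinfeldUnit : H) = v * v * (hR.drinfeldUnit⁻¹ : Hˣ) := by
  have h := hv.sq_eq
  rw [← hR.coe_drinfeldUnit] at h
  rw [Units.eq_mul_inv_iff_mul_eq, ← sq]
  have h2 : 𝐒 (hR.drinfeldUnit : H) = (hR.drinfeldUnit⁻¹ : Hˣ) * (v : H) ^ 2 := by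
    rw [h, Units.inv_mul_cancel_left]
  rw [h2, sq, mul_assoc, mul_assoc, hv.commute, mul_assoc, hv.commute, Units.inv_mul_eq_iff_eq_mul,
    mul_assoc]

end IsUniversalRMatrix

end Drinfeld

namespace IsLeftIntegral

variable {μ : Module.Dual ℂ H} (hμ : IsLeftIntegral μ)
  {Λ : H} (hΛ : ∀ x : H, μ (x * Λ) = Coalgebra.counit (R := ℂ) x)
include hμ hΛ

/-- `∑ Λ' ⊗ u Λ'' = ∑ Λ'' u A ⊗ Λ'`, where `A = (id ⊗ α)(R)`, `α(x) = μ(Λ x)`. -/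
theorem drinfeld_mul_comul_cointegral {R : (H ⊗[ℂ] H)ˣ} (hR : IsUniversalRMatrix R) :
    ((1 : H) ⊗ₜ[ℂ] drinfeldElement R) * Δ Λ =
      flip (Δ Λ) * ((drinfeldElement R * rightSlice (actL μ Λ) R) ⊗ₜ[ℂ] (1 : H)) := by
  have h1 : ∀ X : H ⊗[ℂ] H, X * Δ Λ =
      ((lin₂ fun a b => a * 𝐒 b : H ⊗[ℂ] H →ₗ[ℂ] H) X ⊗ₜ[ℂ] (1 : H)) * Δ Λ := by
    intro X
    induction X with
    | zero => simp
    | add X Y hX hY => rw [add_mul, hX, hY, map_add, TensorProduct.add_tmul, add_mul]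
    | tmul a b =>
      have h : a ⊗ₜ[ℂ] b = (a ⊗ₜ[ℂ] (1 : H)) * ((1 : H) ⊗ₜ[ℂ] b) := by simp
      rw [h, mul_assoc, ← hμ.antipode_mul_comul_cointegral hΛ, ← mul_assoc, ← h]
      simp
  let G : H ⊗[ℂ] (H ⊗[ℂ] H) →ₗ[ℂ] H := lin₃ fun a p q => actL μ Λ p • (𝐒 q * a)
  have h2 : ∀ X : H ⊗[ℂ] H, flip (Δ Λ) * X =
      flip (Δ Λ) * (G (comulRight H X) ⊗ₜ[ℂ] (1 : H)) := by
    intro X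
    induction X with
    | zero => simp
    | add X Y hX hY => simp only [map_add, mul_add, TensorProduct.add_tmul, hX, hY]
    | tmul a b =>
      have h : a ⊗ₜ[ℂ] b = flip ((b ⊗ₜ[ℂ] (1 : H)) * ((1 : H) ⊗ₜ[ℂ] a)) := by simp
      rw [h, ← map_mul, ← mul_assoc, hμ.comul_cointegral_mul hΛ, ← h, comulRight_tmul]
      induction Δ b with
      | zero => simp
      | add X Y hX hY =>
        simp only [map_add, mul_add, add_mul, TensorProduct.add_tmul, TensorProduct.tmul_add,
          hX, hY]
      | tmul p q =>
        simp only [lin₂_tmul, G, lin₃_tmul_tmul, actL_apply, smul_mul_assoc, map_smul, map_mul,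
          flip_tmul, ← TensorProduct.smul_tmul', mul_smul_comm, mul_assoc,
          Algebra.TensorProduct.tmul_mul_tmul, mul_one]
  have h3 : ∀ X Y : H ⊗[ℂ] H, G (leg13 X * leg12 Y) =
      antipodeMulSwap X * rightSlice (actL μ Λ) Y := by
    intro X Y
    induction X with
    | zero => simp
    | add X X' hX hX' => simp only [map_add, add_mul, hX, hX']
    | tmul a b =>
      induction Y with
      | zero => simp
      | add Y Y' hY hY' => simp only [map_add, mul_add, hY, hY']
      | tmul c d => simp [G, antipodeMulSwap, mul_assoc]
  -- Both sides of RΔ(Λ) = Δᵒᵖ(Λ)R are brought to one leg. On the left R acts through ∑ aᵢS(bᵢ) =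
  -- S(u), then moves to leg 2 as u. On the right (id ⊗ Δ)(R) = R₁₃R₁₂ produces u times the slice of
  -- R by the modular character.
  have h4 := hR.comul_op Λ
  rw [h1, h2, hR.mul_antipode_eq, hμ.antipode_mul_comul_cointegral hΛ, hR.comulRight_eq, h3,
    ← drinfeldElement_eq] at h4
  exact h4

theorem antipode_mul_drinfeld {R : (H ⊗[ℂ] H)ˣ} (hR : IsUniversalRMatrix R) (x : H) :
    𝐒 (x * drinfeldElement R) = rightSlice (actL μ x) (flip (Δ Λ)) *
      (drinfeldElement R * rightSlice (actL μ Λ) R) := by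
  have h := congrArg (rightSlice (actL μ x)) (hμ.drinfeld_mul_comul_cointegral hΛ hR)
  have h1 : actL (actL μ x) (drinfeldElement R) = actL μ (x * drinfeldElement R) := by
    ext y; simp [mul_assoc]
  rw [rightSlice_tmul_mul', one_mul, rightSlice_mul_tmul, LinearMap.mulRight_one,
    LinearMap.comp_id, h1, hμ.rightSlice_comul_cointegral hΛ] at h
  exact h

variable [FiniteDimensional ℂ H] {R : (H ⊗[ℂ] H)ˣ} (hR : IsUniversalRMatrix R)
  {v : Hˣ} (hv : IsRibbonElement R v)
include hR hv

/-- The preceding formula at x = 1 reads S(u) = E u A for R. For R'⁻¹, whose Drinfeld element is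
S(u)⁻¹ = u v⁻², it gives S(u) = E u B with the same E after cancelling the central factor v⁻². As
S(u) is invertible, so is E u, whence A = B. -/
theorem rightSlice_eq_rightSlice_inv_swapped :
    rightSlice (actL μ Λ) (R : H ⊗[ℂ] H) =
      rightSlice (actL μ Λ) (((swapped R)⁻¹ : (H ⊗[ℂ] H)ˣ) : H ⊗[ℂ] H) := by
  set A := rightSlice (actL μ Λ) (R : H ⊗[ℂ] H)
  set B := rightSlice (actL μ Λ) (((swapped R)⁻¹ : (H ⊗[ℂ] H)ˣ) : H ⊗[ℂ] H)
  set u := hR.drinfeldUnit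
  have hS := hR.antipode_drinfeldUnit hv
  have h1 := hμ.antipode_mul_drinfeld hΛ hR 1
  have h2 := hμ.antipode_mul_drinfeld hΛ hR.inv_swapped 1
  have h3 : drinfeldElement (swapped R)⁻¹ = u * ((v⁻¹ : Hˣ) * (v⁻¹ : Hˣ)) := by
    refine left_inv_eq_right_inv hR.antipode_mul_drinfeldElement_inv_swapped ?_
    rw [← hR.coe_drinfeldUnit, hS]
    rw [mul_assoc, Units.inv_mul_cancel_left, mul_assoc, Units.mul_inv_cancel_left, Units.mul_inv]
  have h4 : 𝐒 (drinfeldElement (swapped R)⁻¹) =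
      𝐒 (u : H) * ((v⁻¹ : Hˣ) * (v⁻¹ : Hˣ)) := by
    rw [h3, antipode_mul, antipode_mul, antipode_units_inv v hv.antipode_eq, mul_assoc,
      hv.inv_commute, mul_assoc, hv.inv_commute, mul_assoc, hv.inv_commute]
  rw [one_mul, ← hR.coe_drinfeldUnit] at h1
  rw [one_mul, h4, h3] at h2
  set E := rightSlice (actL μ 1) (flip (Δ Λ))
  have h5 : 𝐒 (u : H) = E * (u * B) := by
    have h8 : ((v⁻¹ : Hˣ) : H) * (v⁻¹ : Hˣ) * B = B * ((v⁻¹ : Hˣ) * (v⁻¹ : Hˣ)) := by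
      rw [mul_assoc, hv.inv_commute, mul_assoc, hv.inv_commute, mul_assoc]
    rw [mul_assoc (u : H), h8, ← mul_assoc (u : H), ← mul_assoc E, ← Units.val_mul,
      Units.mul_left_inj] at h2
    exact h2
  have h9 : E * u * (A * (u * ((v⁻¹ : Hˣ) * (v⁻¹ : Hˣ)))) = 1 := by
    rw [← mul_assoc, mul_assoc E, ← h1, hS, mul_assoc, Units.inv_mul_cancel_left, mul_assoc,
      Units.mul_inv_cancel_left, Units.mul_inv]
  have h10 := mul_eq_one_symm_of_finiteDimensional H h9
  have h11 : ∀ X, A * (u * ((v⁻¹ : Hˣ) * (v⁻¹ : Hˣ))) * (E * (u * X)) = X := by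
    intro X
    rw [← mul_assoc E, ← mul_assoc, h10, one_mul]
  rw [← h11 A, ← h1, h5, h11]

/-- A factorizable ribbon Hopf algebra is unimodular. -/
theorem apply_cointegral_mul (hfac : IsFactorizable R) (x : H) : μ (Λ * x) = ε x := by
  have hα := hμ.cointegral_mul hΛ
  let α : H →ₐ[ℂ] ℂ := AlgHom.ofLinearMap (actL μ Λ)
    (by rw [actL_apply, mul_one, apply_cointegral hΛ])
    (fun x y => by
      rw [actL_apply, actL_apply, actL_apply, ← mul_assoc, hα x, smul_mul_assoc, map_smul,
        map_smul, apply_cointegral hΛ]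
      simp)
  let αL : H ⊗[ℂ] H →ₐ[ℂ] H := (Algebra.TensorProduct.lid ℂ H).toAlgHom.comp
    (Algebra.TensorProduct.map α (AlgHom.id ℂ H))
  have h1 : ∀ X : H ⊗[ℂ] H, αL X = slice X (actL μ Λ) := by
    intro X
    induction X with
    | zero => simp [slice]
    | add X Y hX hY => rw [map_add, hX, hY]; simp [slice]
    | tmul x y => simp [αL, α, slice_tmul]
  have h2 : ∀ X : H ⊗[ℂ] H, αL (flip X) = rightSlice (actL μ Λ) X := by
    intro X
    induction X with
    | zero => simp
    | add X Y hX hY => simp only [map_add, hX, hY]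
    | tmul x y => simp [αL, α]
  -- The character α = μ(Λ ?) being multiplicative, Ψ(α) = (α ⊗ id)(R) (α ⊗ id)(R'). The second
  -- factor equals (α ⊗ id)(R⁻¹) by the equality A = B.
  have h3 : psiMap R (actL μ Λ) = 1 := by
    rw [psiMap, ← h1, map_mul, coe_swapped, h2,
      hμ.rightSlice_eq_rightSlice_inv_swapped hΛ hR hv, coe_swapped_inv, ← h2, flip_flip,
      ← map_mul, Units.mul_inv, map_one]
  have h4 : ∀ X : H ⊗[ℂ] H, counitLeft H X = slice X ε := by
    intro X
    induction X with
    | zero => simp [slice]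
    | add X Y hX hY => rw [map_add, hX, hY]; simp [slice]
    | tmul x y => simp [slice_tmul]
  have h5 : ∀ X : H ⊗[ℂ] H, counitLeft H (flip X) = counitRight H X := by
    intro X
    induction X with
    | zero => simp
    | add X Y hX hY => simp only [map_add, hX, hY]
    | tmul x y => simp
  have h6 : psiMap R ε = 1 := by
    rw [psiMap, ← h4, map_mul, coe_swapped, h5, hR.counitLeft_eq, hR.counitRight_eq, one_mul]
  exact LinearMap.congr_fun (hfac.1 (h3.trans h6.symm)) x

omit hμ hΛ in
include hμ in
/-- `μ(x S²(y)) = μ(y x)`. -/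
theorem apply_mul_antipode_sq (hfac : IsFactorizable R) (x y : H) :
    μ (x * 𝐒 (𝐒 y)) = μ (y * x) := by
  obtain ⟨Λ, hΛ⟩ := hμ.exists_cointegral
  -- By unimodularity Δ(Λ)(x ⊗ 1) = Δ(Λ)(1 ⊗ S(x)); then apply id ⊗ μ and μ(Λ) = 1.
  have h1 : ∀ x, rightSlice (actR μ (𝐒 x)) (Δ Λ) = x := by
    intro x
    have h2 := congrArg (rightSlice μ) (hμ.comul_cointegral_mul hΛ x)
    have h3 : (lin₂ fun a b => μ (Λ * a) • (Δ Λ * ((1 : H) ⊗ₜ[ℂ] 𝐒 b))) (Δ x) =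
        Δ Λ * ((1 : H) ⊗ₜ[ℂ] 𝐒 x) :=
      comul_counit_left _ (lin₁ fun b => Δ Λ * ((1 : H) ⊗ₜ[ℂ] 𝐒 b))
        (fun a b => by rw [lin₂_tmul, hμ.apply_cointegral_mul hΛ hR hv hfac, lin₁_apply]) x
    rw [h3, rightSlice_mul_tmul, rightSlice_mul_tmul, LinearMap.mulRight_one, LinearMap.comp_id,
      hμ.rightSlice_comul, apply_cointegral hΛ, one_smul, one_mul, mul_one] at h2
    exact h2.symm
  let G : Module.Dual ℂ H →ₗ[ℂ] H :=
    { toFun := fun β => rightSlice β (Δ Λ)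
      map_add' := fun β γ => rightSlice_add β γ _
      map_smul' := fun c β => rightSlice_smul c β _ }
  have hG : Function.Injective G :=
    (LinearMap.injective_iff_surjective_of_finrank_eq_finrank Subspace.dual_finrank_eq).2
      fun x => ⟨_, h1 x⟩
  -- Both forms slice Δ(Λ) to S(y), and slicing Δ(Λ) is injective on forms.
  have h4 : actR μ (𝐒 (𝐒 y)) = actL μ y :=
    hG ((h1 (𝐒 y)).trans (hμ.rightSlice_comul_cointegral hΛ y).symm)
  exact LinearMap.congr_fun h4 x

omit hμ hΛ in
include hμ in
/-- The right integral `ν = μ ∘ S⁻¹` is proportional to `μ(v² u⁻² ?)`. -/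
theorem exists_right_integral_eq (hfac : IsFactorizable R) {ν : Module.Dual ℂ H}
    (hν : ν ∘ₗ 𝐒 = μ) : ∃ c : ℂ, c ≠ 0 ∧ ∀ x : H,
      ν (hR.drinfeldUnit * (v⁻¹ : Hˣ) * (v⁻¹ : Hˣ) * x) = c * μ ((hR.drinfeldUnit⁻¹ : Hˣ) * x) := by
  obtain ⟨Λ, hΛ⟩ := hμ.exists_cointegral
  obtain ⟨k, rfl⟩ := hμ.actL_bijective.2 ν
  set u := hR.drinfeldUnit
  have h1 : ∀ x, rightSlice (actL μ k) (flip (Δ x)) = actL μ k x • (1 : H) := by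
    intro x
    obtain ⟨y, rfl⟩ := hR.antipode_surjective x
    have h2 : ∀ X : H ⊗[ℂ] H, rightSlice (actL μ k) (TensorProduct.map 𝐒 𝐒 X) =
        𝐒 (rightSlice (actL μ k ∘ₗ 𝐒) X) := by
      intro X
      induction X with
      | zero => simp
      | add X Y hX hY => simp only [map_add, hX, hY]
      | tmul x y => simp
    rw [comul_antipode, flip_flip, h2, hν, hμ.rightSlice_comul, map_smul, antipode_one]
    exact congrArg (· • (1 : H)) (LinearMap.congr_fun hν y).symm
  have hA : rightSlice (actL μ Λ) (R : H ⊗[ℂ] H) = 1 := by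
    rw [← hR.counitRight_eq]
    induction (R : H ⊗[ℂ] H) with
    | zero => simp
    | add X Y hX hY => simp only [map_add, hX, hY]
    | tmul x y => simp [hμ.apply_cointegral_mul hΛ hR hv hfac]
  have h3 := hμ.antipode_mul_drinfeld hΛ hR k
  rw [h1, hA, mul_one, smul_mul_assoc, one_mul, ← hR.coe_drinfeldUnit] at h3
  have h4 : 𝐒 (𝐒 (u : H)) = u := by
    rw [hR.antipode_antipode, mul_assoc, Units.mul_inv, mul_one]
  -- The right integral property and unimodularity give S(ku) = ν(Λ)u; moreover S(u) = v²u⁻¹ and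
  -- S²(u) = u. The constant c is ν(Λ), nonzero since otherwise k = 0.
  have h5 : k * u = actL μ k Λ • (v * v * (u⁻¹ : Hˣ)) := by
    apply hR.antipode_injective
    rw [h3, map_smul, ← hR.antipode_drinfeldUnit hv, h4]
  refine ⟨actL μ k Λ, ?_, ?_⟩
  · intro h
    rw [h, zero_smul, Units.mul_left_eq_zero] at h5
    apply hμ.ne_zero
    rw [← hν, h5, map_zero, LinearMap.zero_comp]
  · intro x
    rw [actL_apply, ← mul_assoc, ← mul_assoc, ← mul_assoc, h5, ← hv.inv_commute, ← hv.inv_commute]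
    simp [mul_assoc]

end IsLeftIntegral

end Unimodularity

/-! ### Slices of the monodromy R'R on the centre. -/

section Monodromy

variable {H : Type*} [Ring H] [HopfAlgebra ℂ H]

local notation "𝐒" => HopfAlgebra.antipode ℂ (A := H)
local notation "Δ" => Coalgebra.comul (R := ℂ) (A := H)
local notation "ε" => Coalgebra.counit (R := ℂ) (A := H)

/-- The map `z ↦ (id ⊗ μ(z ?))(X)`. -/
def sliceMap (μ : Module.Dual ℂ H) (X : H ⊗[ℂ] H) : H →ₗ[ℂ] H where
  toFun z := rightSlice (actL μ z) X
  map_add' y z := by rw [map_add, rightSlice_add]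
  map_smul' c z := by rw [map_smul, rightSlice_smul]; rfl

theorem sliceMap_apply (μ : Module.Dual ℂ H) (X : H ⊗[ℂ] H) (z : H) :
    sliceMap μ X z = rightSlice (actL μ z) X := rfl

/-- `v` is central and `Δ(v) = (R'R)⁻¹ (v ⊗ v)`. -/
structure IsBalancing (R : (H ⊗[ℂ] H)ˣ) (v : Hˣ) : Prop where
  commute : ∀ x : H, (v : H) * x = x * v
  comul_eq : Coalgebra.comul (R := ℂ) (v : H) =
    ((swapped R * R)⁻¹ : (H ⊗[ℂ] H)ˣ) * ((v : H) ⊗ₜ[ℂ] (v : H))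

theorem IsRibbonElement.isBalancing {R : (H ⊗[ℂ] H)ˣ} {v : Hˣ} (hv : IsRibbonElement R v) :
    IsBalancing R v := ⟨hv.commute, hv.comul_eq⟩

theorem swapped_inv_swapped (R : (H ⊗[ℂ] H)ˣ) : swapped (swapped R)⁻¹ = R⁻¹ :=
  Units.ext (flip_flip _)

theorem monodromy_inv_swapped (R : (H ⊗[ℂ] H)ˣ) :
    swapped (swapped R)⁻¹ * (swapped R)⁻¹ = (swapped R * R)⁻¹ := by
  rw [swapped_inv_swapped, mul_inv_rev]

namespace IsBalancing

variable {R : (H ⊗[ℂ] H)ˣ} {v : Hˣ} (hv : IsBalancing R v)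
include hv

theorem inv_commute (x : H) : ((v⁻¹ : Hˣ) : H) * x = x * (v⁻¹ : Hˣ) := by
  rw [Units.inv_mul_eq_iff_eq_mul, ← mul_assoc, hv.commute, mul_assoc, Units.mul_inv, mul_one]

theorem monodromy_eq : ((swapped R * R : (H ⊗[ℂ] H)ˣ) : H ⊗[ℂ] H) =
    Δ (v⁻¹ : Hˣ) * ((v : H) ⊗ₜ[ℂ] (v : H)) := by
  have h1 : Δ (v⁻¹ : Hˣ) * Δ v = 1 := by
    rw [← Bialgebra.comul_mul, Units.inv_mul, Bialgebra.comul_one]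
  have h2 : ∀ X : H ⊗[ℂ] H, X * ((v : H) ⊗ₜ[ℂ] (v : H)) = ((v : H) ⊗ₜ[ℂ] (v : H)) * X := by
    intro X
    induction X with
    | zero => simp
    | add X Y hX hY => simp only [mul_add, add_mul, hX, hY]
    | tmul a b => simp [hv.commute]
  rw [hv.comul_eq, h2, ← mul_assoc, Units.mul_inv_eq_one] at h1
  exact h1.symm

/-- Passing to R'⁻¹ inverts both the monodromy and v. Every statement about R'R therefore yields one
about (R'R)⁻¹, which is how the second modular relation is obtained. -/
theorem inv_swapped : IsBalancing (swapped R)⁻¹ v⁻¹ where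
  commute := hv.inv_commute
  comul_eq := by
    rw [monodromy_inv_swapped, inv_inv, hv.monodromy_eq, mul_assoc,
      Algebra.TensorProduct.tmul_mul_tmul, Units.mul_inv, ← Algebra.TensorProduct.one_def, mul_one]

/-- `(id ⊗ μ(v⁻¹ ?))(R'R) = μ(v⁻¹) v`. -/
theorem sliceMap_monodromy_inv {μ : Module.Dual ℂ H} (hμ : IsLeftIntegral μ) :
    sliceMap μ (swapped R * R : (H ⊗[ℂ] H)ˣ) (v⁻¹ : Hˣ) = μ (v⁻¹ : Hˣ) • (v : H) := by
  have h : actL μ (v⁻¹ : Hˣ) ∘ₗ LinearMap.mulRight ℂ (v : H) = μ := by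
    ext x
    simp [← hv.commute]
  rw [sliceMap_apply, hv.monodromy_eq, rightSlice_mul_tmul, h, hμ.rightSlice_comul,
    smul_mul_assoc, one_mul]

end IsBalancing

theorem IsUniversalRMatrix.monodromy_mul_comul {R : (H ⊗[ℂ] H)ˣ} (hR : IsUniversalRMatrix R)
    (x : H) : ((swapped R * R : (H ⊗[ℂ] H)ˣ) : H ⊗[ℂ] H) * Δ x =
      Δ x * (swapped R * R : (H ⊗[ℂ] H)ˣ) := by
  have h1 := congrArg flip (hR.comul_op x)
  rw [map_mul, map_mul, flip_flip, ← coe_swapped] at h1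
  rw [Units.val_mul, mul_assoc, hR.comul_op, ← mul_assoc, h1, mul_assoc]

section Central

variable {μ : Module.Dual ℂ H} (hcyc : ∀ x y : H,
  μ (x * HopfAlgebra.antipode ℂ (HopfAlgebra.antipode ℂ y)) = μ (y * x))
include hcyc

/-- The slices of an element which commutes with the coproducts are central. -/
theorem sliceMap_mul_comm {X : H ⊗[ℂ] H} (hX : ∀ h : H, X * Δ h = Δ h * X) {z : H}
    (hz : ∀ x, z * x = x * z) (h : H) : sliceMap μ X z * h = h * sliceMap μ X z := by
  set β := actL μ z
  have hβ : ∀ x y : H, β (x * 𝐒 (𝐒 y)) = β (y * x) := fun x y => by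
    rw [actL_apply, actL_apply, ← mul_assoc, hcyc, ← mul_assoc, ← mul_assoc, hz]
  -- F slices (h' ⊗ h'') X (1 ⊗ S(h''')) and G slices X (h' ⊗ h''S(h''')). They agree as X commutes
  -- with Δ(h'). In G the factor h''S(h''') collapses; in F cyclicity brings h'' behind S(h''') as
  -- S²(h''), and S(S(h'')h''') collapses.
  let F : H ⊗[ℂ] (H ⊗[ℂ] H) →ₗ[ℂ] H := lin₃ fun a b c =>
    rightSlice β ((a ⊗ₜ[ℂ] b) * X * ((1 : H) ⊗ₜ[ℂ] 𝐒 c))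
  let G : H ⊗[ℂ] (H ⊗[ℂ] H) →ₗ[ℂ] H := lin₃ fun a b c =>
    rightSlice β (X * (a ⊗ₜ[ℂ] (b * 𝐒 c)))
  have hF : ∀ a b c, F (a ⊗ₜ (b ⊗ₜ c)) = rightSlice β ((a ⊗ₜ[ℂ] b) * X * ((1 : H) ⊗ₜ[ℂ] 𝐒 c)) :=
    fun a b c => lin₃_tmul_tmul _ _ _ _ _ _ _ a b c
  have hG : ∀ a b c, G (a ⊗ₜ (b ⊗ₜ c)) = rightSlice β (X * (a ⊗ₜ[ℂ] (b * 𝐒 c))) :=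
    fun a b c => lin₃_tmul_tmul _ _ _ _ _ _ _ a b c
  have h1 : F (comulLeft H (Δ h)) = G (comulLeft H (Δ h)) := by
    induction Δ h with
    | zero => simp
    | add X Y hX hY => simp only [map_add, hX, hY]
    | tmul a c =>
      have h2 : ∀ Y : H ⊗[ℂ] H, (lin₂ fun p q => F (p ⊗ₜ[ℂ] (q ⊗ₜ[ℂ] c))) Y =
          rightSlice β (Y * X * ((1 : H) ⊗ₜ[ℂ] 𝐒 c)) := by
        intro Y
        induction Y with
        | zero => simp
        | add Y Z hY hZ => simp only [map_add, add_mul, hY, hZ]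
        | tmul p q => rw [lin₂_tmul, hF]
      have h3 : ∀ Y : H ⊗[ℂ] H, (lin₂ fun p q => G (p ⊗ₜ[ℂ] (q ⊗ₜ[ℂ] c))) Y =
          rightSlice β (X * Y * ((1 : H) ⊗ₜ[ℂ] 𝐒 c)) := by
        intro Y
        induction Y with
        | zero => simp
        | add Y Z hY hZ => simp only [map_add, add_mul, mul_add, hY, hZ]
        | tmul p q =>
          rw [lin₂_tmul, hG, mul_assoc, Algebra.TensorProduct.tmul_mul_tmul, mul_one]
      rw [apply_comulLeft_tmul, apply_comulLeft_tmul, h2, h3, hX]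
  have h4 : G (comulRight H (Δ h)) = sliceMap μ X z * h := by
    refine (comul_counit_right (G ∘ₗ (comulRight H).toLinearMap)
      (lin₁ fun c => rightSlice β (X * (c ⊗ₜ[ℂ] (1 : H)))) (fun a c => ?_) h).trans ?_
    · rw [LinearMap.comp_apply, AlgHom.toLinearMap_apply, apply_comulRight_tmul]
      refine (comul_antipode_right _ (lin₁ fun t => rightSlice β (X * (a ⊗ₜ[ℂ] t)))
        (fun p q => ?_) c).trans ?_
      · rw [lin₂_tmul, hG, lin₁_apply]
      · rw [lin₁_apply, lin₁_apply]
    · rw [lin₁_apply, rightSlice_mul_tmul, LinearMap.mulRight_one, LinearMap.comp_id,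
        sliceMap_apply]
  have h5 : F (comulRight H (Δ h)) = h * sliceMap μ X z := by
    refine (comul_counit_right (F ∘ₗ (comulRight H).toLinearMap)
      (LinearMap.mulRight ℂ (sliceMap μ X z)) (fun a c => ?_) h).trans ?_
    · rw [LinearMap.comp_apply, AlgHom.toLinearMap_apply, apply_comulRight_tmul]
      refine (comul_antipode_left _ (lin₁ (fun t => a * rightSlice (actR β (𝐒 t)) X)
        (by intros; rw [map_add, map_add, rightSlice_add, mul_add])
        (by intros; rw [map_smul, map_smul, rightSlice_smul, mul_smul_comm]))
        (fun p q => ?_) c).trans ?_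
      · rw [lin₂_tmul, hF, lin₁_apply, mul_assoc, rightSlice_tmul_mul', rightSlice_mul_tmul,
          mul_one]
        congr 3
        ext x
        rw [antipode_mul, actR_apply, ← mul_assoc, hβ, ← mul_assoc, mul_assoc]
        rfl
      · rw [lin₁_apply, antipode_one, LinearMap.mulRight_apply, sliceMap_apply]
        congr 4
        ext x
        change β (x * 1) = β x
        rw [mul_one]
    · rfl
  rw [← h4, ← h5, comulRight_comul, h1]

variable (hμ : IsLeftIntegral μ) {R : (H ⊗[ℂ] H)ˣ} (hR : IsUniversalRMatrix R)

include hR in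
/-- `S((id ⊗ μ(z ?))((R'R)⁻¹)) = (id ⊗ μ(z ?))(R'R)`, for `z` central. -/
theorem antipode_sliceMap_monodromy_inv {z : H} (hz : ∀ x, z * x = x * z) :
    𝐒 (sliceMap μ ((swapped R * R)⁻¹ : (H ⊗[ℂ] H)ˣ) z) =
      sliceMap μ (swapped R * R : (H ⊗[ℂ] H)ˣ) z := by
  -- The antipode reverses the product in the first leg, and cyclicity reverses it in the second at
  -- the cost of S². Then (S ⊗ S²)(R⁻¹) = R and (id ⊗ S)(R⁻¹) = R finish.
  have h1 : ∀ X Y : H ⊗[ℂ] H, 𝐒 (rightSlice (actL μ z) (X * flip Y)) =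
      rightSlice (actL μ z) (flip ((𝐒).lTensor H Y) * TensorProduct.map 𝐒 (𝐒 ∘ₗ 𝐒) X) := by
    intro X Y
    induction X with
    | zero => simp
    | add X X' hX hX' => simp only [map_add, add_mul, mul_add, hX, hX']
    | tmul a b =>
      induction Y with
      | zero => simp
      | add Y Y' hY hY' => simp only [map_add, add_mul, mul_add, hY, hY']
      | tmul c d =>
        simp only [flip_tmul, LinearMap.lTensor_tmul, TensorProduct.map_tmul,
          Algebra.TensorProduct.tmul_mul_tmul, rightSlice_tmul, map_smul, antipode_mul,
          LinearMap.comp_apply, actL_apply]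
        rw [← mul_assoc z c, hcyc, ← mul_assoc z, hz b, mul_assoc]
  have h2 : TensorProduct.map 𝐒 (𝐒 ∘ₗ 𝐒) ((R⁻¹ : (H ⊗[ℂ] H)ˣ) : H ⊗[ℂ] H) = R := by
    have h3 : TensorProduct.map 𝐒 (𝐒 ∘ₗ 𝐒) = TensorProduct.map 𝐒 𝐒 ∘ₗ (𝐒).lTensor H :=
      TensorProduct.ext' fun a b => by simp
    rw [h3, LinearMap.comp_apply, hR.lTensor_antipode_inv, hR.map_antipode]
  rw [mul_inv_rev, sliceMap_apply, sliceMap_apply, Units.val_mul, Units.val_mul, coe_swapped_inv,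
    h1, hR.lTensor_antipode_inv, h2, coe_swapped]

include hμ hR in
/-- The relation between the operators `z ↦ (id ⊗ μ(z ?))(R'R)` and `z ↦ v z` on the centre. -/
theorem sliceMap_monodromy_relation {v : Hˣ} (hv : IsBalancing R v) {y : H}
    (hy : ∀ x, y * x = x * y) :
    sliceMap μ (swapped R * R : (H ⊗[ℂ] H)ˣ)
        ((v⁻¹ : Hˣ) * sliceMap μ (swapped R * R : (H ⊗[ℂ] H)ˣ) y) =
      μ (v⁻¹ : Hˣ) • (v * 𝐒 (sliceMap μ (swapped R * R : (H ⊗[ℂ] H)ˣ) (v * y))) := by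
  set Q : H ⊗[ℂ] H := ((swapped R * R : (H ⊗[ℂ] H)ˣ) : H ⊗[ℂ] H) with hQ'
  have hQ : Q = flip (R : H ⊗[ℂ] H) * R := rfl
  set c := sliceMap μ Q y
  have hc : ∀ x, c * x = x * c := sliceMap_mul_comm hcyc hR.monodromy_mul_comul hy
  let w : H := (v⁻¹ : Hˣ)
  have hw : ∀ x, w * x = x * w := hv.inv_commute
  -- Here Q = Δ(w)(v ⊗ v) and the v in the second leg cancels w. The remaining slice of Δ(w) is ∑
  -- S(c')μ(c''w), so Δ(c) must be computed.
  have h1 : sliceMap μ Q (w * c) = v * rightSlice (actL μ c) (Δ w) := by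
    have h : actL μ (w * c) ∘ₗ LinearMap.mulRight ℂ (v : H) = actL μ c := by
      ext x
      simp only [w, LinearMap.comp_apply, LinearMap.mulRight_apply, actL_apply]
      rw [← hv.commute, mul_assoc, hc, mul_assoc, Units.inv_mul_cancel_left, ← hc]
    rw [sliceMap_apply, show Q = _ from hv.monodromy_eq, rightSlice_mul_tmul, h, hv.commute]
  let N : H ⊗[ℂ] (H ⊗[ℂ] H) →ₗ[ℂ] H := lin₃ fun a b d => actL μ y d • actR μ w b • 𝐒 a
  have h2 : ∀ X : H ⊗[ℂ] H, (lin₂ fun a b => μ (b * w) • 𝐒 a : H ⊗[ℂ] H →ₗ[ℂ] H)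
      (Δ (rightSlice (actL μ y) X)) = N (comulLeft H X) := by
    intro X
    induction X with
    | zero => simp
    | add X Y hX hY => simp only [map_add, hX, hY]
    | tmul a d =>
      rw [rightSlice_tmul, map_smul, map_smul, apply_comulLeft_tmul]
      induction Δ a with
      | zero => simp
      | add X Y hX hY => simp only [map_add, smul_add, hX, hY]
      | tmul p q => simp [N]
  let P : H ⊗[ℂ] H →ₗ[ℂ] H := lin₂ fun s t =>
    actR μ w s • 𝐒 (rightSlice (actL μ y) (Q * ((1 : H) ⊗ₜ[ℂ] t)))
  have hP : ∀ s t, P (s ⊗ₜ t) =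
      actR μ w s • 𝐒 (rightSlice (actL μ y) (Q * ((1 : H) ⊗ₜ[ℂ] t))) :=
    fun s t => lin₂_tmul _ _ _ _ _ s t
  -- Since (Δ ⊗ id)(Q) = R'₂₃Q₁₃R₂₃, cyclicity in legs 2 and 3 moves R'₂₃ to the right, up to the
  -- harmless S² ⊗ S², and R R' is the flip of Q.
  have h3 : ∀ X Z : H ⊗[ℂ] H, N (leg23 (flip X) * leg13 Q * leg23 Z) =
      P (Z * flip (TensorProduct.map (𝐒 ∘ₗ 𝐒) (𝐒 ∘ₗ 𝐒) X)) := by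
    intro X Z
    induction X with
    | zero => simp
    | add X X' hX hX' => simp only [map_add, add_mul, mul_add, hX, hX']
    | tmul a b =>
      induction Z with
      | zero => simp
      | add Y Y' hY hY' => simp only [map_add, add_mul, mul_add, hY, hY']
      | tmul s t =>
        simp only [flip_tmul, TensorProduct.map_tmul, Algebra.TensorProduct.tmul_mul_tmul, hP,
          LinearMap.comp_apply]
        induction Q with
        | zero => simp
        | add Y Y' hY hY' => simp only [map_add, add_mul, mul_add, smul_add, hY, hY']
        | tmul q r =>
          have e1 : μ (s * 𝐒 (𝐒 b) * w) = μ (b * s * w) := by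
            rw [mul_assoc, ← hw, ← mul_assoc, hcyc, mul_assoc]
          have e2 : μ (y * (r * (t * 𝐒 (𝐒 a)))) = μ (y * (a * r * t)) := by
            rw [← mul_assoc r, ← mul_assoc y, hcyc, ← mul_assoc, ← hy, mul_assoc, ← mul_assoc a]
          simp [N, e1, e2, smul_smul, mul_comm]
  have h4 : N (comulLeft H Q) = P (flip Q) := by
    rw [hQ, map_mul, ← coe_swapped, hR.comulLeft_swapped, hR.comulLeft_eq, ← mul_assoc,
      mul_assoc (leg23 _), ← map_mul leg13, coe_swapped, ← hQ, h3, hR.map_antipode_sq, hQ, map_mul flip,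
      flip_flip]
  let T : H →ₗ[ℂ] H := lin₁ fun p => 𝐒 (rightSlice (actL μ (v * y)) (Q * ((1 : H) ⊗ₜ[ℂ] p)))
  -- Writing Q once more as Δ(w)(v ⊗ v), one v cancels w and the other joins y; what is left is the
  -- integral of Δ(w), namely μ(w)1.
  have h5 : ∀ X : H ⊗[ℂ] H, P (flip (X * ((v : H) ⊗ₜ[ℂ] (v : H)))) = T (rightSlice μ X) := by
    intro X
    induction X with
    | zero => simp
    | add X Y hX hY => simp only [map_add, add_mul, hX, hY]
    | tmul p q =>
      rw [Algebra.TensorProduct.tmul_mul_tmul, flip_tmul, hP, rightSlice_tmul, map_smul,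
        actR_apply, mul_assoc, Units.mul_inv, mul_one, lin₁_apply, rightSlice_mul_tmul,
        rightSlice_mul_tmul]
      congr 5
      ext x
      simp only [LinearMap.comp_apply, LinearMap.mulRight_apply, actL_apply]
      rw [← mul_assoc x, ← hv.commute, ← mul_assoc y, ← hv.commute y]
  have h6 : rightSlice (actL μ c) (Δ w) = μ w • 𝐒 (sliceMap μ Q (v * y)) := by
    have hQw : Q = Δ w * ((v : H) ⊗ₜ[ℂ] (v : H)) := hv.monodromy_eq
    have h7 : P (flip Q) = T (rightSlice μ (Δ w)) := by rw [hQw, h5]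
    rw [hμ.rightSlice_actL_comul, show c = rightSlice (actL μ y) Q from rfl, h2, h4, h7,
      hμ.rightSlice_comul, map_smul, lin₁_apply, ← Algebra.TensorProduct.one_def, mul_one,
      sliceMap_apply]
  rw [h1, h6, mul_smul_comm]

end Central

theorem opS_apply_of_central (R : (H ⊗[ℂ] H)ˣ) (μ : Module.Dual ℂ H) {z : H}
    (hz : ∀ x, z * x = x * z) :
    opS R μ z = sliceMap μ ((swapped R * R)⁻¹ : (H ⊗[ℂ] H)ˣ) z := by
  have h : ∀ X : H ⊗[ℂ] H, X * ((1 : H) ⊗ₜ[ℂ] z) = ((1 : H) ⊗ₜ[ℂ] z) * X := by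
    intro X
    induction X with
    | zero => simp
    | add X Y hX hY => simp only [add_mul, mul_add, hX, hY]
    | tmul a b => simp [hz]
  change TensorProduct.rid ℂ H (μ.lTensor H (((R⁻¹ : (H ⊗[ℂ] H)ˣ) : H ⊗[ℂ] H) *
    (((1 : H) ⊗ₜ[ℂ] z) * (((swapped R)⁻¹ : (H ⊗[ℂ] H)ˣ) : H ⊗[ℂ] H)))) = _
  rw [← rightSlice_eq, ← mul_assoc, h, mul_assoc, rightSlice_tmul_mul', one_mul, mul_inv_rev,
    Units.val_mul, sliceMap_apply]

/-- RR' is the flip of R'R. This is where factorizability enters the study of the operators on the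
centre. -/
theorem psiMap_actL (R : (H ⊗[ℂ] H)ˣ) (μ : Module.Dual ℂ H) (z : H) :
    psiMap R (actL μ z) = sliceMap μ (swapped R * R : (H ⊗[ℂ] H)ˣ) z := by
  have h : ∀ X : H ⊗[ℂ] H, slice X (actL μ z) = rightSlice (actL μ z) (flip X) := by
    intro X
    induction X with
    | zero => simp [slice]
    | add X Y hX hY => rw [map_add, map_add, ← hX, ← hY]; simp [slice]
    | tmul x y => simp [slice_tmul]
  rw [psiMap, h, map_mul, coe_swapped, flip_flip, sliceMap_apply, Units.val_mul, coe_swapped]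

end Monodromy

/-! ### The action of B on H* for the form μ(v ?). -/

section TwistAction

variable {H : Type*} [Ring H] [HopfAlgebra ℂ H]

local notation "𝐒" => HopfAlgebra.antipode ℂ (A := H)
local notation "Δ" => Coalgebra.comul (R := ℂ) (A := H)
local notation "ε" => Coalgebra.counit (R := ℂ) (A := H)

/-- The map `t ↦ (p ⊗ q ↦ μ(q t) S(p))`. -/
def antipodeSlice (μ : Module.Dual ℂ H) : H →ₗ[ℂ] H ⊗[ℂ] H →ₗ[ℂ] H :=
  lin₁ (fun t => lin₂ fun p q => μ (q * t) • 𝐒 p)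
    (fun s t => TensorProduct.ext' fun p q => by simp [mul_add, add_smul])
    (fun c t => TensorProduct.ext' fun p q => by simp [mul_smul])

@[simp] theorem antipodeSlice_tmul (μ : Module.Dual ℂ H) (t p q : H) :
    antipodeSlice μ t (p ⊗ₜ q) = μ (q * t) • 𝐒 p := lin₂_tmul _ _ _ _ _ p q

theorem IsLeftIntegral.rightSlice_actL_comul_eq {μ : Module.Dual ℂ H} (hμ : IsLeftIntegral μ)
    (x y : H) : rightSlice (actL μ x) (Δ y) = antipodeSlice μ y (Δ x) :=
  hμ.rightSlice_actL_comul x y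

theorem antipodeSlice_mul_tmul (μ : Module.Dual ℂ H) (t : H) (Z : H ⊗[ℂ] H) (p q : H) :
    antipodeSlice μ t (Z * (p ⊗ₜ q)) = 𝐒 p * antipodeSlice μ (q * t) Z := by
  induction Z with
  | zero => simp
  | add X Y hX hY => simp only [map_add, add_mul, mul_add, hX, hY]
  | tmul a b => simp [antipode_mul, mul_assoc]

variable [FiniteDimensional ℂ H] {R : (H ⊗[ℂ] H)ˣ} (hR : IsUniversalRMatrix R)

theorem IsUniversalRMatrix.antipode_drinfeldUnit_mul (x : H) :
    𝐒 (hR.drinfeldUnit : H) * 𝐒 (𝐒 x) = x * 𝐒 (hR.drinfeldUnit : H) := by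
  obtain ⟨y, rfl⟩ := hR.antipode_surjective x
  rw [← antipode_mul, ← antipode_mul, hR.antipode_sq_mul_drinfeldUnit]

theorem IsUniversalRMatrix.antipode_sq_drinfeldUnit_inv :
    𝐒 (𝐒 ((hR.drinfeldUnit⁻¹ : Hˣ) : H)) = (hR.drinfeldUnit⁻¹ : Hˣ) := by
  rw [hR.antipode_antipode, Units.mul_inv, one_mul]

variable {μ : Module.Dual ℂ H} (hcyc : ∀ x y : H,
  μ (x * HopfAlgebra.antipode ℂ (HopfAlgebra.antipode ℂ y)) = μ (y * x))

include hcyc in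
/-- The form `μ(u⁻¹ ?)` is symmetric. -/
theorem apply_drinfeldUnit_inv_mul_comm (x y : H) :
    μ ((hR.drinfeldUnit⁻¹ : Hˣ) * (x * y)) = μ ((hR.drinfeldUnit⁻¹ : Hˣ) * (y * x)) := by
  have h : 𝐒 (𝐒 ((hR.drinfeldUnit⁻¹ : Hˣ) * y)) = y * 𝐒 (𝐒 ((hR.drinfeldUnit⁻¹ : Hˣ) : H)) := by
    rw [hR.antipode_sq_drinfeldUnit_inv, hR.antipode_antipode, Units.mul_inv_cancel_left]
  rw [← mul_assoc _ y x, ← hcyc x, h, ← mul_assoc x, hcyc]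

include hcyc in
omit [FiniteDimensional ℂ H] in
theorem antipodeSlice_tmul_mul (t a l : H) (V : H ⊗[ℂ] H) :
    antipodeSlice μ t ((a ⊗ₜ l) * V) = antipodeSlice μ (t * 𝐒 (𝐒 l)) ((a ⊗ₜ[ℂ] (1 : H)) * V) := by
  induction V with
  | zero => simp
  | add X Y hX hY => simp only [map_add, mul_add, hX, hY]
  | tmul p q =>
    rw [Algebra.TensorProduct.tmul_mul_tmul, Algebra.TensorProduct.tmul_mul_tmul,
      antipodeSlice_tmul, antipodeSlice_tmul, one_mul, ← mul_assoc q t, hcyc, mul_assoc l]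

/-- The form `(c ⊗ d, a ⊗ b) ↦ ∑ φ(c S(u) S(a' v')) μ(a'' v'' d x b)`. -/
def twistForm (μ φ : Module.Dual ℂ H) (s v x : H) :
    H ⊗[ℂ] H →ₗ[ℂ] H ⊗[ℂ] H →ₗ[ℂ] ℂ := lin₂
  (fun c d => lin₂ fun a b => φ (c * (s * antipodeSlice μ (d * (x * b)) (Δ (a * v)))))
  (fun c c' d => TensorProduct.ext' fun a b => by simp [add_mul])
  (fun k c d => TensorProduct.ext' fun a b => by simp)
  (fun c d d' => TensorProduct.ext' fun a b => by simp [add_mul, mul_add])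
  (fun k c d => TensorProduct.ext' fun a b => by simp)

omit [FiniteDimensional ℂ H] in
theorem twistForm_tmul_tmul (φ : Module.Dual ℂ H) (s v x a b c d : H) :
    twistForm μ φ s v x (c ⊗ₜ d) (a ⊗ₜ b) =
      φ (c * (s * antipodeSlice μ (d * (x * b)) (Δ (a * v)))) := by
  simp [twistForm]

-- Here (Δ ⊗ id)(R) = R₁₃R₂₃ is used: the leg of R₂₃ at the front of μ moves to the end as S², where
-- it meets its partner and forms u⁻¹ = ∑ bᵢS²(aᵢ).
include hcyc in
theorem twistForm_tmul (φ : Module.Dual ℂ H) (s v x c d : H) :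
    twistForm μ φ s v x (c ⊗ₜ d) R = (lin₂ fun p q => φ (c * (s * 𝐒 p)) *
      μ ((hR.drinfeldUnit⁻¹ : Hˣ) * (q * (d * x))) : H ⊗[ℂ] H →ₗ[ℂ] ℂ) ((R : H ⊗[ℂ] H) * Δ v) := by
  let κ : H ⊗[ℂ] H →ₗ[ℂ] H := lin₂ fun a b => b * 𝐒 (𝐒 a)
  have hκ : κ R = (hR.drinfeldUnit⁻¹ : Hˣ) := rfl
  let L : H ⊗[ℂ] (H ⊗[ℂ] H) →ₗ[ℂ] ℂ := lin₃ fun p q b =>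
    φ (c * (s * antipodeSlice μ (d * (x * b)) ((p ⊗ₜ q) * Δ v)))
  have hL : ∀ p q b, L (p ⊗ₜ (q ⊗ₜ b)) =
      φ (c * (s * antipodeSlice μ (d * (x * b)) ((p ⊗ₜ q) * Δ v))) :=
    fun p q b => lin₃_tmul_tmul _ _ _ _ _ _ _ p q b
  have h1 : ∀ X : H ⊗[ℂ] H, twistForm μ φ s v x (c ⊗ₜ d) X = L (comulLeft H X) := by
    intro X
    induction X with
    | zero => simp
    | add X Y hX hY => simp only [map_add, hX, hY]
    | tmul a b =>
      rw [twistForm_tmul_tmul, apply_comulLeft_tmul, Bialgebra.comul_mul]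
      induction Δ a with
      | zero => simp
      | add X Y hX hY => simp only [map_add, add_mul, mul_add, hX, hY]
      | tmul p q => rw [lin₂_tmul, hL]
  have h2 : ∀ X Y : H ⊗[ℂ] H, L (leg13 X * leg23 Y) =
      (lin₂ fun a b => φ (c * (s * antipodeSlice μ (d * (x * (b * κ Y)))
        ((a ⊗ₜ[ℂ] (1 : H)) * Δ v))) : H ⊗[ℂ] H →ₗ[ℂ] ℂ) X := by
    intro X Y
    induction X with
    | zero => simp
    | add X X' hX hX' => simp only [map_add, add_mul, hX, hX']
    | tmul a b =>
      rw [lin₂_tmul]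
      induction Y with
      | zero => simp
      | add Y Y' hY hY' => simp only [map_add, mul_add, LinearMap.add_apply, hY, hY']
      | tmul l b' =>
        simp only [leg13_tmul, leg23_tmul, Algebra.TensorProduct.tmul_mul_tmul, one_mul, mul_one,
          hL, κ, lin₂_tmul]
        rw [antipodeSlice_tmul_mul hcyc]
        simp only [mul_assoc]
  rw [h1, hR.comulLeft_eq, h2, hκ]
  induction (R : H ⊗[ℂ] H) with
  | zero => simp
  | add X Y hX hY => simp only [map_add, add_mul, hX, hY]
  | tmul a b =>
    rw [lin₂_tmul]
    induction Δ v with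
    | zero => simp
    | add X Y hX hY => simp only [map_add, mul_add, hX, hY]
    | tmul p q =>
      have h3 : μ (q * (d * (x * (b * (hR.drinfeldUnit⁻¹ : Hˣ))))) =
          μ ((hR.drinfeldUnit⁻¹ : Hˣ) * (b * q * (d * x))) := by
        rw [mul_assoc b, apply_drinfeldUnit_inv_mul_comm hR hcyc b, ← hcyc (q * (d * x) * b),
          hR.antipode_sq_drinfeldUnit_inv]
        simp only [mul_assoc]
      simp only [Algebra.TensorProduct.tmul_mul_tmul, one_mul, antipodeSlice_tmul, lin₂_tmul, h3,
        mul_smul_comm, map_smul, smul_eq_mul]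
      ring

variable (hμ : IsLeftIntegral μ)

-- Rewriting Δ(xb)R' as the flip of RΔ(xb) prepares the identity ∑ y'μ(py'') = ∑ S(p')μ(p''y) with y
-- = xb. The coproduct then falls on a leg of R, and (id ⊗ Δ)(R) = R₁₃R₁₂ leaves ∑ aᵢS(bᵢ) = S(u).
include hμ in
theorem apply_comul_mul_swapped {v : Hˣ} (hv : IsBalancing R v) (φ : Module.Dual ℂ H) (x a b : H) :
    (LinearMap.mul' ℂ ℂ ∘ₗ TensorProduct.map (actL μ v) φ)
      ((a ⊗ₜ[ℂ] (1 : H)) * Δ (x * b) * swapped R) =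
      twistForm μ φ (𝐒 (hR.drinfeldUnit : H)) v x R (a ⊗ₜ b) := by
    have h1 : Δ (x * b) * (swapped R : H ⊗[ℂ] H) = flip ((R : H ⊗[ℂ] H) * Δ (x * b)) := by
      rw [hR.comul_op, map_mul flip, flip_flip, coe_swapped]
    let E : H ⊗[ℂ] (H ⊗[ℂ] H) →ₗ[ℂ] ℂ := lin₃ fun c p q =>
      φ (c * antipodeSlice μ (x * b) (Δ (a * v) * (p ⊗ₜ q)))
    have hE : ∀ c Z, E (c ⊗ₜ Z) = φ (c * antipodeSlice μ (x * b) (Δ (a * v) * Z)) := by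
      intro c Z
      induction Z with
      | zero => simp
      | add X Y hX hY => simp only [TensorProduct.tmul_add, map_add, mul_add, hX, hY]
      | tmul p q => exact lin₃_tmul_tmul _ _ _ _ _ _ _ c p q
    have h2 : ∀ X : H ⊗[ℂ] H, (LinearMap.mul' ℂ ℂ ∘ₗ TensorProduct.map (actL μ v) φ)
        ((a ⊗ₜ[ℂ] (1 : H)) * flip (X * Δ (x * b))) = E (comulRight H X) := by
      intro X
      induction X with
      | zero => simp
      | add X Y hX hY => simp only [map_add, add_mul, mul_add, hX, hY]
      | tmul c d =>
        rw [comulRight_tmul, hE, ← Bialgebra.comul_mul, ← hμ.rightSlice_actL_comul_eq]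
        induction Δ (x * b) with
        | zero => simp
        | add X Y hX hY => simp only [map_add, mul_add, hX, hY]
        | tmul p q =>
          simp [hv.commute, mul_assoc]
    have h3 : ∀ X Y : H ⊗[ℂ] H, E (leg13 X * leg12 Y) =
        (lin₂ fun c d => φ (c * ((lin₂ fun s t => s * 𝐒 t : H ⊗[ℂ] H →ₗ[ℂ] H) Y *
          antipodeSlice μ (d * (x * b)) (Δ (a * v)))) : H ⊗[ℂ] H →ₗ[ℂ] ℂ) X := by
      intro X Y
      induction X with
      | zero => simp
      | add X X' hX hX' => simp only [map_add, add_mul, hX, hX']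
      | tmul c d =>
        induction Y with
        | zero => simp
        | add Y Y' hY hY' =>
          rw [map_add, mul_add, map_add, hY, hY']
          simp only [lin₂_tmul, map_add, mul_add, add_mul]
        | tmul s t =>
          simp only [leg13_tmul, leg12_tmul, Algebra.TensorProduct.tmul_mul_tmul, hE, lin₂_tmul,
            antipodeSlice_mul_tmul, mul_assoc, one_mul, mul_one]
    rw [mul_assoc, h1, h2, hR.comulRight_eq, h3, hR.mul_antipode_eq]
    induction (R : H ⊗[ℂ] H) with
    | zero => simp
    | add X Y hX hY => simp only [map_add, LinearMap.add_apply, hX, hY]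
    | tmul c d => rw [twistForm_tmul_tmul, lin₂_tmul]; rfl

-- After the two preceding reductions two copies of R remain, one of them in RΔ(v) = Δᵒᵖ(v)R. Moving
-- the first leg of the other copy through S(u) applies S², and the two copies combine into R (S ⊗
-- id)(R) = R R⁻¹ = 1.
include hcyc hμ in
theorem valB_actL_apply {v : Hˣ} (hv : IsBalancing R v) (φ : Module.Dual ℂ H) (x : H) :
    valB R (actL μ v) φ x = (lin₂ fun p q => φ (𝐒 (hR.drinfeldUnit : H) * 𝐒 q) *
      μ ((hR.drinfeldUnit⁻¹ : Hˣ) * (p * x)) : H ⊗[ℂ] H →ₗ[ℂ] ℂ) (Δ v) := by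
  set u := hR.drinfeldUnit
  have h1 : valB R (actL μ v) φ x = twistForm μ φ (𝐒 (u : H)) v x R R := by
    rw [valB_apply_apply]
    have h2 : ∀ X : H ⊗[ℂ] H, LinearMap.mul' ℂ ℂ (TensorProduct.map (actL μ v) φ
        (LinearMap.mul' ℂ (H ⊗[ℂ] H) (TensorProduct.map
        (Algebra.TensorProduct.includeLeft (R := ℂ) (S := ℂ) (A := H) (B := H)).toLinearMap
        (Δ ∘ₗ LinearMap.mulLeft ℂ x) X) * (swapped R : H ⊗[ℂ] H))) =
        twistForm μ φ (𝐒 (u : H)) v x R X := by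
      intro X
      induction X with
      | zero => simp
      | add X Y hX hY => simp only [map_add, add_mul, hX, hY]
      | tmul a b => exact apply_comul_mul_swapped hR hμ hv φ x a b
    exact h2 R
  let ω : H → H → H ⊗[ℂ] H →ₗ[ℂ] ℂ := fun p q => lin₂ fun s t =>
    φ (𝐒 (u : H) * 𝐒 s * 𝐒 q) * μ ((u⁻¹ : Hˣ) * (p * (t * x)))
  let Ω : H ⊗[ℂ] H →ₗ[ℂ] H ⊗[ℂ] H →ₗ[ℂ] ℂ := lin₂
    (fun c d => lin₂ fun p q => φ (c * (𝐒 (u : H) * 𝐒 p)) * μ ((u⁻¹ : Hˣ) * (q * (d * x))))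
    (fun c c' d => TensorProduct.ext' fun a b => by simp [add_mul])
    (fun k c d => TensorProduct.ext' fun a b => by simp [mul_assoc])
    (fun c d d' => TensorProduct.ext' fun a b => by simp [add_mul, mul_add])
    (fun k c d => TensorProduct.ext' fun a b => by simp; ring)
  have hΩ : ∀ c d p q, Ω (c ⊗ₜ d) (p ⊗ₜ q) =
      φ (c * (𝐒 (u : H) * 𝐒 p)) * μ ((u⁻¹ : Hˣ) * (q * (d * x))) := by simp [Ω]
  have h3 : ∀ X : H ⊗[ℂ] H, twistForm μ φ (𝐒 (u : H)) v x X R = Ω X ((R : H ⊗[ℂ] H) * Δ v) := by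
    intro X
    induction X with
    | zero => simp
    | add X Y hX hY => simp only [map_add, LinearMap.add_apply, hX, hY]
    | tmul c d => rw [twistForm_tmul hR hcyc]; simp only [Ω, lin₂_tmul]; rfl
  have h4 : ∀ p q : H, ∀ X Y : H ⊗[ℂ] H, Ω X ((q ⊗ₜ p) * Y) = ω p q (Y * (𝐒).rTensor H X) := by
    intro p q X Y
    induction X with
    | zero => simp
    | add X X' hX hX' => simp only [map_add, LinearMap.add_apply, mul_add, hX, hX']
    | tmul c d =>
      induction Y with
      | zero => simp
      | add Y Y' hY hY' => simp only [map_add, mul_add, add_mul, hY, hY']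
      | tmul a b =>
        rw [Algebra.TensorProduct.tmul_mul_tmul, hΩ, LinearMap.rTensor_tmul,
          Algebra.TensorProduct.tmul_mul_tmul, lin₂_tmul, antipode_mul, antipode_mul,
          ← mul_assoc (𝐒 (u : H)) (𝐒 (𝐒 c)), hR.antipode_drinfeldUnit_mul]
        simp only [mul_assoc]
        rfl
  rw [h1, h3, hR.comul_op]
  induction Δ (v : H) with
  | zero => simp
  | add X Y hX hY => simp only [map_add, add_mul, hX, hY]
  | tmul p q =>
    rw [flip_tmul, h4, hR.rTensor_antipode, Units.mul_inv, Algebra.TensorProduct.one_def,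
      lin₂_tmul, lin₂_tmul, antipode_one, mul_one, one_mul]

end TwistAction

/-! ### Group-theoretic consequences of the relations, and scalars in PGL. -/

section ProjectiveClasses

/-- The relations between the classes of `𝒮`, `𝒯` and of the antipode. -/
theorem modular_relations {G : Type*} [Group G] {A X T : G} (hA : A * A = 1) (hAT : A * T = T * A)
    (h₁ : A * X * T * A * X = T⁻¹ * X * T⁻¹) (h₂ : X * T⁻¹ * X = T * A * X * T) :
    X * X = A ∧ X ^ 4 = 1 ∧ (X * T) ^ 3 = X ^ 2 := by
  -- Substituted in `h₂`, this gives (TAX)²X = (TAX)T, hence AX² = 1.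
  have hX : X * T⁻¹ = T * A * X * (T * A * X) := by
    have h := congrArg (fun g => T * g) h₁
    simp only [← mul_assoc, mul_inv_cancel, one_mul] at h
    rw [← h]
    simp only [← mul_assoc]
  have h3 : T * A * X * X = T := by
    rw [hX] at h₂
    have h4 : T * A * X * (T * A * X) * X = T * A * X * T := h₂
    rw [mul_assoc, mul_right_inj] at h4
    exact h4
  have h5 : X * X = A := by
    rw [mul_assoc, mul_assoc, mul_eq_left, ← mul_assoc] at h3
    rw [← mul_left_cancel_iff (a := A), hA, ← mul_assoc, h3]
  have h6 : A * X = X * A := by rw [← h5, mul_assoc]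
  have h7 : X * T * X = T⁻¹ * X * T⁻¹ := by
    rw [← h₁, h6, mul_assoc X A T, hAT, mul_assoc, mul_assoc, mul_assoc, mul_assoc, ← mul_assoc A A,
      hA, one_mul]
  refine ⟨h5, ?_, ?_⟩
  · rw [show 4 = 2 * 2 from rfl, pow_mul, sq X, h5, sq, hA]
  · calc (X * T) ^ 3 = X * T * X * (T * X * T) := by simp only [pow_succ, pow_zero, one_mul, mul_assoc]
      _ = X ^ 2 := by
        rw [h7, mul_assoc, mul_assoc T X T, inv_mul_cancel_left, mul_assoc, ← mul_assoc X X T, h5,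
          hAT, inv_mul_cancel_left, sq, h5]

variable {V : Type*} [AddCommGroup V] [Module ℂ V]

/-- Proportional automorphisms have the same class. -/
theorem PGL.mk_eq_mk {P Q : LinearMap.GeneralLinearGroup ℂ V} {c : ℂ} (hc : c ≠ 0)
    (h : ∀ x, (P : Module.End ℂ V) x = c • (Q : Module.End ℂ V) x) : (P : PGL V) = (Q : PGL V) := by
  let Z : LinearMap.GeneralLinearGroup ℂ V :=
    Units.map (algebraMap ℂ (Module.End ℂ V) : ℂ →* Module.End ℂ V) (Units.mk0 c hc)
  have hZ : Z ∈ Subgroup.center (LinearMap.GeneralLinearGroup ℂ V) := by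
    rw [Subgroup.mem_center_iff]
    intro g
    exact Units.ext (Algebra.commutes c (g : Module.End ℂ V)).symm
  have hP : P = Q * Z := by
    rw [Subgroup.mem_center_iff.1 hZ Q]
    exact Units.ext (LinearMap.ext fun x => h x)
  rw [eq_comm, QuotientGroup.eq, hP, inv_mul_cancel_left]
  exact hZ

end ProjectiveClasses

/-! ### The automorphisms of the centre and their relations in PGL. -/

section Centre

variable {H : Type*} [Ring H] [HopfAlgebra ℂ H]

local notation "𝐒" => HopfAlgebra.antipode ℂ (A := H)

theorem mem_centre_iff {z : H} : z ∈ centre H ↔ ∀ x, z * x = x * z := by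
  change z ∈ Subalgebra.center ℂ H ↔ _
  rw [Subalgebra.mem_center_iff]
  exact forall_congr' fun x => eq_comm

/-- Multiplication by a central element, on the centre. -/
def centreMul (w : H) (hw : ∀ x, w * x = x * w) : Module.End ℂ (centre H) :=
  (LinearMap.mulLeft ℂ w).restrict fun z hz => mem_centre_iff.2 fun x => by
    rw [LinearMap.mulLeft_apply, mul_assoc, mem_centre_iff.1 hz, ← mul_assoc, hw, mul_assoc]

@[simp] theorem coe_centreMul_apply (w : H) (hw : ∀ x, w * x = x * w) (z : centre H) :
    (centreMul w hw z : H) = w * z := rfl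

/-- Multiplication by the inverse of a central unit, as an automorphism of the centre. -/
def centreTwist {R : (H ⊗[ℂ] H)ˣ} {v : Hˣ} (hv : IsBalancing R v) :
    LinearMap.GeneralLinearGroup ℂ (centre H) where
  val := centreMul (v⁻¹ : Hˣ) hv.inv_commute
  inv := centreMul v hv.commute
  val_inv := by ext z; simp
  inv_val := by ext z; simp

variable [FiniteDimensional ℂ H] {R : (H ⊗[ℂ] H)ˣ} (hR : IsUniversalRMatrix R)

include hR in
theorem IsUniversalRMatrix.antipode_mem_centre {z : H} (hz : z ∈ centre H) : 𝐒 z ∈ centre H := by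
  refine mem_centre_iff.2 fun x => ?_
  obtain ⟨y, rfl⟩ := hR.antipode_surjective x
  rw [← antipode_mul, ← antipode_mul, mem_centre_iff.1 hz]

include hR in
theorem IsUniversalRMatrix.antipode_antipode_of_mem_centre {z : H} (hz : z ∈ centre H) :
    𝐒 (𝐒 z) = z := by
  rw [hR.antipode_antipode, ← mem_centre_iff.1 hz, mul_assoc, Units.mul_inv, mul_one]

/-- The antipode, as an automorphism of the centre. -/
def centreAntipode : LinearMap.GeneralLinearGroup ℂ (centre H) where
  val := (𝐒).restrict fun _ hz => hR.antipode_mem_centre hz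
  inv := (𝐒).restrict fun _ hz => hR.antipode_mem_centre hz
  val_inv := by ext z; exact hR.antipode_antipode_of_mem_centre z.2
  inv_val := by ext z; exact hR.antipode_antipode_of_mem_centre z.2

section

variable {μ : Module.Dual ℂ H} (hcyc : ∀ x y : H,
  μ (x * HopfAlgebra.antipode ℂ (HopfAlgebra.antipode ℂ y)) = μ (y * x))

/-- The operator `z ↦ (id ⊗ μ(z ?))((R'R)⁻¹)` on the centre. -/
def centreS : Module.End ℂ (centre H) :=
  (sliceMap μ ((swapped R * R)⁻¹ : (H ⊗[ℂ] H)ˣ)).restrict fun z hz => mem_centre_iff.2 fun x => by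
    refine sliceMap_mul_comm hcyc (fun h => ?_) (mem_centre_iff.1 hz) x
    rw [← monodromy_inv_swapped]
    exact hR.inv_swapped.monodromy_mul_comul h

omit [FiniteDimensional ℂ H] in
theorem coe_centreS_apply (z : centre H) : (centreS hR hcyc z : H) =
    sliceMap μ ((swapped R * R)⁻¹ : (H ⊗[ℂ] H)ˣ) z := rfl

variable (hμ : IsLeftIntegral μ) (hfac : IsFactorizable R)

include hμ hfac in
theorem sliceMap_monodromy_injective :
    Function.Injective (sliceMap μ (swapped R * R : (H ⊗[ℂ] H)ˣ)) := by
  intro y z h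
  rw [← psiMap_actL, ← psiMap_actL] at h
  exact hμ.actL_bijective.1 (hfac.1 h)

-- Composing with the antipode gives the slices of R'R, which are injective; finite dimension does
-- the rest.
include hμ hfac in
theorem isUnit_centreS : IsUnit (centreS hR hcyc) := by
  rw [LinearMap.isUnit_iff_ker_eq_bot, LinearMap.ker_eq_bot]
  intro y z h
  have h1 := congrArg (fun z : centre H => 𝐒 (z : H)) h
  simp only [coe_centreS_apply] at h1
  rw [antipode_sliceMap_monodromy_inv hcyc hR (mem_centre_iff.1 y.2),
    antipode_sliceMap_monodromy_inv hcyc hR (mem_centre_iff.1 z.2)] at h1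
  exact Subtype.ext (sliceMap_monodromy_injective hμ hfac h1)

/-- The operator `𝒮`, as an automorphism of the centre. -/
def centreSUnit : LinearMap.GeneralLinearGroup ℂ (centre H) := (isUnit_centreS hR hcyc hμ hfac).unit

omit [FiniteDimensional ℂ H] in
include hμ in
theorem IsLeftIntegral.nontrivial : Nontrivial H := by
  by_contra h
  rw [not_nontrivial_iff_subsingleton] at h
  exact hμ.ne_zero (LinearMap.ext fun x => by rw [Subsingleton.elim x 0, map_zero, map_zero])

variable {v : Hˣ} (hv : IsBalancing R v)

-- The slice of R'R by μ(v⁻¹ ?) is μ(v⁻¹)v, so μ(v⁻¹) = 0 would contradict injectivity. This makes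
-- the scalar in the modular relation harmless in PGL.
include hμ hfac hv in
theorem integral_inv_ne_zero : μ (v⁻¹ : Hˣ) ≠ 0 := by
  intro h
  have := hμ.nontrivial
  have h1 := hv.sliceMap_monodromy_inv hμ
  rw [h, zero_smul, ← map_zero (sliceMap μ (swapped R * R : (H ⊗[ℂ] H)ˣ))] at h1
  exact (v⁻¹).ne_zero (sliceMap_monodromy_injective hμ hfac h1)

omit [FiniteDimensional ℂ H] in
include hμ hv in
theorem sliceMap_monodromy_inv_apply :
    sliceMap μ ((swapped R * R)⁻¹ : (H ⊗[ℂ] H)ˣ) v = μ v • ((v⁻¹ : Hˣ) : H) := by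
  have h := hv.inv_swapped.sliceMap_monodromy_inv hμ
  rwa [monodromy_inv_swapped, inv_inv] at h

omit [FiniteDimensional ℂ H] in
include hR hcyc hμ hv in
theorem sliceMap_monodromy_apply (hS : 𝐒 ((v⁻¹ : Hˣ) : H) = (v⁻¹ : Hˣ)) :
    sliceMap μ (swapped R * R : (H ⊗[ℂ] H)ˣ) v = μ v • ((v⁻¹ : Hˣ) : H) := by
  rw [← antipode_sliceMap_monodromy_inv hcyc hR hv.commute, sliceMap_monodromy_inv_apply hμ hv,
    map_smul, hS]

include hR hcyc hμ hfac hv in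
theorem integral_ne_zero (hS : 𝐒 ((v⁻¹ : Hˣ) : H) = (v⁻¹ : Hˣ)) : μ v ≠ 0 := by
  intro h
  have := hμ.nontrivial
  have h1 := sliceMap_monodromy_apply hR hcyc hμ hv hS
  rw [h, zero_smul, ← map_zero (sliceMap μ (swapped R * R : (H ⊗[ℂ] H)ˣ))] at h1
  exact v.ne_zero (sliceMap_monodromy_injective hμ hfac h1)

theorem centreAntipode_mul_centreTwist (hS : 𝐒 ((v⁻¹ : Hˣ) : H) = (v⁻¹ : Hˣ)) :
    (centreAntipode hR : PGL (centre H)) * centreTwist hv = centreTwist hv * centreAntipode hR := by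
  rw [← QuotientGroup.mk_mul, ← QuotientGroup.mk_mul]
  refine congrArg _ (Units.ext (LinearMap.ext fun z => Subtype.ext ?_))
  change 𝐒 ((v⁻¹ : Hˣ) * (z : H)) = (v⁻¹ : Hˣ) * 𝐒 (z : H)
  rw [antipode_mul, hS, hv.inv_commute]

/-- The relations between the classes of the operators on the centre. -/
theorem centre_relations (hS : 𝐒 ((v⁻¹ : Hˣ) : H) = (v⁻¹ : Hˣ)) :
    ((centreSUnit hR hcyc hμ hfac : PGL (centre H)) * (centreSUnit hR hcyc hμ hfac : PGL (centre H))
        = (centreAntipode hR : PGL (centre H))) ∧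
    (centreSUnit hR hcyc hμ hfac : PGL (centre H)) ^ 4 = 1 ∧
    ((centreSUnit hR hcyc hμ hfac : PGL (centre H)) * (centreTwist hv : PGL (centre H))) ^ 3 =
      (centreSUnit hR hcyc hμ hfac : PGL (centre H)) ^ 2 := by
  have hSb : ∀ {z : H}, z ∈ centre H → 𝐒 (sliceMap μ ((swapped R * R)⁻¹ : (H ⊗[ℂ] H)ˣ) z) =
      sliceMap μ (swapped R * R : (H ⊗[ℂ] H)ˣ) z :=
    fun hz => antipode_sliceMap_monodromy_inv hcyc hR (mem_centre_iff.1 hz)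
  refine modular_relations ?_ (centreAntipode_mul_centreTwist hR hv hS) ?_ ?_
  · rw [← QuotientGroup.mk_mul, ← QuotientGroup.mk_one]
    refine congrArg _ (Units.ext (LinearMap.ext fun z => Subtype.ext ?_))
    exact hR.antipode_antipode_of_mem_centre z.2
  -- The relation for (R, v), with 𝒮₊ replaced by A𝒮₋ throughout.
  · simp only [← QuotientGroup.mk_mul, ← QuotientGroup.mk_inv]
    refine PGL.mk_eq_mk (integral_inv_ne_zero hμ hfac hv) fun z => Subtype.ext ?_
    have h := sliceMap_monodromy_relation hcyc hμ hR hv (mem_centre_iff.1 z.2)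
    have h1 : (v : H) * z ∈ centre H := (centreMul (v : H) hv.commute z).2
    have h2 : ((v⁻¹ : Hˣ) : H) * 𝐒 (sliceMap μ ((swapped R * R)⁻¹ : (H ⊗[ℂ] H)ˣ) z) ∈ centre H :=
      (centreMul _ hv.inv_commute ((centreAntipode hR).val (centreS hR hcyc z))).2
    have h3 : sliceMap μ ((swapped R * R)⁻¹ : (H ⊗[ℂ] H)ˣ) (v * z) ∈ centre H :=
      (centreS hR hcyc (centreMul (v : H) hv.commute z)).2
    rw [← hSb z.2, ← hSb h1, ← hSb h2, hR.antipode_antipode_of_mem_centre h3] at h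
    exact h
  -- The relation for (R'⁻¹, v⁻¹), which concerns 𝒮₋ directly.
  · simp only [← QuotientGroup.mk_mul, ← QuotientGroup.mk_inv]
    refine PGL.mk_eq_mk (integral_ne_zero hR hcyc hμ hfac hv hS) fun z => Subtype.ext ?_
    have h := sliceMap_monodromy_relation hcyc hμ hR.inv_swapped hv.inv_swapped
      (mem_centre_iff.1 z.2)
    rw [monodromy_inv_swapped, inv_inv] at h
    exact h

end

end Centre

/-! ### The map f and its compatibility with the Dehn twists. -/

section Intertwiner

variable {H : Type*} [Ring H] [HopfAlgebra ℂ H]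

local notation "𝐒" => HopfAlgebra.antipode ℂ (A := H)
local notation "Δ" => Coalgebra.comul (R := ℂ) (A := H)

variable [FiniteDimensional ℂ H] {R : (H ⊗[ℂ] H)ˣ} (hR : IsUniversalRMatrix R)
  {μ : Module.Dual ℂ H} (hcyc : ∀ x y : H,
    μ (x * HopfAlgebra.antipode ℂ (HopfAlgebra.antipode ℂ y)) = μ (y * x))

/-- The map `z ↦ c μ(u⁻¹ S(z) ?)`, from the centre to the symmetric linear forms. -/
def centreToSLF (c : ℂ) : centre H →ₗ[ℂ] SLF H where
  toFun z := ⟨c • actL μ ((hR.drinfeldUnit⁻¹ : Hˣ) * 𝐒 (z : H)), fun x y => by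
    have hz := mem_centre_iff.1 (hR.antipode_mem_centre z.2)
    simp only [LinearMap.smul_apply, actL_apply]
    rw [mul_assoc, ← mul_assoc (𝐒 (z : H)), apply_drinfeldUnit_inv_mul_comm hR hcyc,
      ← mul_assoc y, ← hz y]
    simp only [mul_assoc]⟩
  map_add' y z := by
    ext x
    simp [mul_add]
  map_smul' k z := by
    ext x
    simp [mul_left_comm]

theorem centreToSLF_apply (c : ℂ) (z : centre H) (x : H) :
    (centreToSLF hR hcyc c z : Module.Dual ℂ H) x =
      c * μ ((hR.drinfeldUnit⁻¹ : Hˣ) * (𝐒 (z : H) * x)) := by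
  simp [centreToSLF, mul_assoc]

theorem centreToSLF_bijective (hμ : IsLeftIntegral μ) {c : ℂ} (hc : c ≠ 0) :
    Function.Bijective (centreToSLF hR hcyc c) := by
  set u := hR.drinfeldUnit
  constructor
  · intro y z h
    have h1 : actL μ ((u⁻¹ : Hˣ) * 𝐒 (y : H)) = actL μ ((u⁻¹ : Hˣ) * 𝐒 (z : H)) := by
      have h2 : c • actL μ ((u⁻¹ : Hˣ) * 𝐒 (y : H)) = c • actL μ ((u⁻¹ : Hˣ) * 𝐒 (z : H)) :=
        congrArg Subtype.val h
      exact smul_right_injective _ hc h2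
    exact Subtype.ext (hR.antipode_injective
      ((Units.mul_right_inj _).1 (hμ.actL_bijective.1 h1)))
  · intro φ
    obtain ⟨k, hk⟩ := hμ.actL_bijective.2 φ
    have hφ : ∀ x y, μ (k * (x * y)) = μ (k * (y * x)) := fun x y => by
      have := φ.2 x y
      rwa [← hk] at this
    -- As μ(u⁻¹ ?) is symmetric and nondegenerate, the symmetry of φ = μ(u⁻¹(uk) ?) forces uk to be
    -- central.
    have hz : (u : H) * k ∈ centre H := by
      refine mem_centre_iff.2 fun x => ?_
      have h1 : actL μ ((u⁻¹ : Hˣ) * ((u : H) * k * x)) = actL μ ((u⁻¹ : Hˣ) * (x * (u * k))) := by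
        ext y
        rw [actL_apply, actL_apply, mul_assoc (u : H), Units.inv_mul_cancel_left, mul_assoc k,
          hφ, mul_assoc _ _ y, mul_assoc x, apply_drinfeldUnit_inv_mul_comm hR hcyc x,
          mul_assoc, mul_assoc, Units.inv_mul_cancel_left]
      exact (Units.mul_right_inj _).1 (hμ.actL_bijective.1 h1)
    refine ⟨⟨𝐒 (c⁻¹ • ((u : H) * k)), hR.antipode_mem_centre (Submodule.smul_mem _ _ hz)⟩, ?_⟩
    ext x
    rw [centreToSLF_apply, hR.antipode_antipode_of_mem_centre (Submodule.smul_mem _ _ hz),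
      smul_mul_assoc, mul_smul_comm, map_smul, smul_eq_mul, mul_inv_cancel_left₀ hc, mul_assoc,
      Units.inv_mul_cancel_left, ← hk, actL_apply]

variable (hfac : IsFactorizable R) {v : Hˣ} (hv : IsRibbonElement R v) (hμ : IsLeftIntegral μ)

include hv in
theorem centreToSLF_twist (c : ℂ) (z : centre H) :
    (centreToSLF hR hcyc c ((centreTwist hv.isBalancing).val z) : Module.Dual ℂ H) =
      hAct ((v⁻¹ : Hˣ) : H) (centreToSLF hR hcyc c z : Module.Dual ℂ H) := by
  ext x
  change _ = (centreToSLF hR hcyc c z : Module.Dual ℂ H) (x * (v⁻¹ : Hˣ))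
  rw [centreToSLF_apply, centreToSLF_apply]
  change c * μ (_ * (𝐒 ((v⁻¹ : Hˣ) * (z : H)) * x)) = _
  rw [antipode_mul, antipode_units_inv v hv.antipode_eq, mul_assoc, hv.isBalancing.inv_commute]

include hR hcyc hv hμ in
/-- The linear form identified with `v⁻¹` is proportional to `μ(v ?)`. -/
theorem loopOf_inv : loopOf hfac ((v⁻¹ : Hˣ) : H) = loopι R ((μ v)⁻¹ • actL μ v) := by
  rw [loopOf]
  congr 1
  have hS := antipode_units_inv v hv.antipode_eq
  rw [LinearEquiv.symm_apply_eq]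
  change _ = psiMap R _
  rw [map_smul, psiMap_actL,
    sliceMap_monodromy_apply hR hcyc hμ hv.isBalancing hS,
    inv_smul_smul₀ (integral_ne_zero hR hcyc hμ hfac hv.isBalancing hS)]

include hv hμ in
/-- The action of `μ(v ?)` on the form associated with a central element. -/
theorem valB_centreToSLF {ν : Module.Dual ℂ H} (hν : ν ∘ₗ 𝐒 = μ) {c : ℂ} (hc : c ≠ 0)
    (hνc : ∀ x : H, ν (hR.drinfeldUnit * (v⁻¹ : Hˣ) * (v⁻¹ : Hˣ) * x) =
      c * μ ((hR.drinfeldUnit⁻¹ : Hˣ) * x)) (z : centre H) :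
    valB R (actL μ v) (centreToSLF hR hcyc c z) = c⁻¹ • (centreToSLF hR hcyc c
      ((centreAntipode hR * (centreTwist hv.isBalancing)⁻¹ * centreSUnit hR hcyc hμ hfac *
        (centreTwist hv.isBalancing)⁻¹ : LinearMap.GeneralLinearGroup ℂ (centre H)).val z) :
      Module.Dual ℂ H) := by
  set u := hR.drinfeldUnit
  ext x
  let D : H := v * sliceMap μ ((swapped R * R)⁻¹ : (H ⊗[ℂ] H)ˣ) (v * z)
  have hD : D ∈ centre H := (((centreTwist hv.isBalancing)⁻¹ * centreSUnit hR hcyc hμ hfac *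
        (centreTwist hv.isBalancing)⁻¹ : LinearMap.GeneralLinearGroup ℂ (centre H)).val z).2
  have h1 : c⁻¹ • (centreToSLF hR hcyc c
      ((centreAntipode hR * (centreTwist hv.isBalancing)⁻¹ * centreSUnit hR hcyc hμ hfac *
        (centreTwist hv.isBalancing)⁻¹ : LinearMap.GeneralLinearGroup ℂ (centre H)).val z) :
      Module.Dual ℂ H) x = μ ((u⁻¹ : Hˣ) * (D * x)) := by
    rw [centreToSLF_apply, smul_eq_mul, inv_mul_cancel_left₀ hc]
    change μ ((u⁻¹ : Hˣ) * (𝐒 (𝐒 D) * x)) = _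
    rw [hR.antipode_antipode_of_mem_centre hD]
  -- Since Δ(v) = (R'R)⁻¹(v ⊗ v), slicing Δ(v) by μ(z ?) gives v𝒮₋(vz), that is 𝒯⁻¹𝒮𝒯⁻¹z.
  have h2 : rightSlice (actL μ (z : H)) (Δ v) = D := by
    have hz := mem_centre_iff.1 z.2
    have h : actL μ (z : H) ∘ₗ LinearMap.mulRight ℂ (v : H) = actL μ (v * z) := by
      ext y
      simp only [LinearMap.comp_apply, LinearMap.mulRight_apply, actL_apply]
      rw [← hv.commute, ← mul_assoc, hz]
    rw [hv.comul_eq, rightSlice_mul_tmul, h, ← hv.commute]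
    rfl
  -- Going back to ν, the factors u v⁻² and S(u) = v²u⁻¹ cancel and ν(S(zq)) = μ(zq) remains. The
  -- constant c disappears here, whence the c⁻¹ in the statement.
  have h3 : ∀ q : H, (centreToSLF hR hcyc c z : Module.Dual ℂ H) (𝐒 (u : H) * 𝐒 q) =
      μ (z * q) := by
    intro q
    rw [centreToSLF_apply, ← hνc, hR.antipode_drinfeldUnit hv]
    have hz := mem_centre_iff.1 (hR.antipode_mem_centre z.2)
    have h4 : (u : H) * (v⁻¹ : Hˣ) * (v⁻¹ : Hˣ) *
        (𝐒 (z : H) * (v * v * (u⁻¹ : Hˣ) * 𝐒 q)) = 𝐒 ((z : H) * q) := by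
      rw [← mul_assoc (𝐒 (z : H)), hz, mem_centre_iff.1 z.2, antipode_mul]
      simp only [mul_assoc]
      rw [Units.inv_mul_cancel_left, Units.inv_mul_cancel_left, Units.mul_inv_cancel_left]
    rw [h4, ← hν, LinearMap.comp_apply]
  rw [LinearMap.smul_apply, h1, valB_actL_apply hR hcyc hμ hv.isBalancing, ← h2]
  induction Δ (v : H) with
  | zero => simp
  | add X Y hX hY => simp only [map_add, add_mul, mul_add, hX, hY]
  | tmul p q =>
    rw [lin₂_tmul, h3, rightSlice_tmul, smul_mul_assoc, mul_smul_comm, map_smul]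
    rfl

end Intertwiner

theorem tauB_eq : tauB = tMat⁻¹ * sMat⁻¹ * tMat⁻¹ := by
  rw [sMat_eq_and_tMat_eq.1, sMat_eq_and_tMat_eq.2]
  group

end

end TorusRep

theorem mainTheorem5 {H : Type*} [Ring H] [HopfAlgebra ℂ H] [FiniteDimensional ℂ H]
    (R : (H ⊗[ℂ] H)ˣ) (hR : TorusRep.IsUniversalRMatrix R)
    (hfac : TorusRep.IsFactorizable R)
    (v : Hˣ) (hv : TorusRep.IsRibbonElement R v)
    (μl μr : Module.Dual ℂ H) (hμl : TorusRep.IsLeftIntegral μl)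
    (hμr : μr ∘ₗ HopfAlgebra.antipode ℂ (A := H) = μl) :
    ∃ (ρ : TorusRep.HandleAlgebra R →ₐ[ℂ] Module.End ℂ (Module.Dual ℂ H))
      (θ₁ : SL(2, ℤ) →* TorusRep.PGL (TorusRep.SLF H))
      (ρLM : SL(2, ℤ) →* TorusRep.PGL (TorusRep.centre H))
      (f : TorusRep.centre H ≃ₗ[ℂ] TorusRep.SLF H),
      TorusRep.IsHandleRep R ρ ∧
      TorusRep.IsTheta hfac v ρ θ₁ ∧
      TorusRep.IsLyubashenkoMajid R v μl ρLM ∧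
      (∀ (z : TorusRep.centre H) (x : H), (f z : Module.Dual ℂ H) x =
        μr (TorusRep.pivot R v * (v⁻¹ : Hˣ) * HopfAlgebra.antipode ℂ (z : H) * x)) ∧
      ∀ γ : SL(2, ℤ), TorusRep.PGL.conj f (ρLM γ) = θ₁ γ := by
  open TorusRep in
  have hcyc := hμl.apply_mul_antipode_sq hR hv hfac
  obtain ⟨c, hc, hνc⟩ := hμl.exists_right_integral_eq hR hv hfac hμr
  have hb := hv.isBalancing
  have hS := antipode_units_inv v hv.antipode_eq
  have hn := integral_ne_zero hR hcyc hμl hfac hb hS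
  obtain ⟨hXX, hX4, hXT⟩ := centre_relations hR hcyc hμl hfac hb hS
  set X := centreSUnit hR hcyc hμl hfac
  set A := centreAntipode hR
  set T := centreTwist hb
  obtain ⟨σ, hσs, hσt⟩ := exists_monoidHom_of_relations hX4 hXT
  let f := LinearEquiv.ofBijective _ (centreToSLF_bijective hR hcyc hμl hc)
  have hA2 : (A : PGL (centre H)) * A = 1 := by rw [← hXX]; simpa [pow_succ, mul_assoc] using hX4
  -- θ₁ is defined by transport along f, so the equivalence holds by definition; the content lies in
  -- its values on τ_a and τ_b.
  refine ⟨handleRep hR, (PGL.conj f).toMonoidHom.comp σ, σ, f, isHandleRep_handleRep hR,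
    ⟨⟨LinearMap.GeneralLinearGroup.congrLinearEquiv f T, fun w => ?_, ?_⟩, ?_⟩,
    ⟨⟨X, fun z => ?_, hσs.symm⟩, ⟨T, fun z => rfl, hσt.symm⟩⟩, fun z x => ?_, fun γ => rfl⟩
  · rw [handleRep_jA_loopOf]
    obtain ⟨z, rfl⟩ := f.surjective w
    have h : (LinearMap.GeneralLinearGroup.congrLinearEquiv f T).val (f z) = f (T.val z) := by
      change f (T.val (f.symm (f z))) = _
      rw [f.symm_apply_apply]
    exact (congrArg Subtype.val h).trans (centreToSLF_twist hR hcyc hv c z)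
  · change _ = PGL.conj f (σ tMat)
    rw [hσt]
    rfl
  -- The first factor comes from Ψ⁻¹(v⁻¹) = μ(v)⁻¹ μ(v ?), the second from the action of μ(v ?) on
  -- f(z). The restriction must be matched exactly, so the scalar is kept until the passage to PGL.
  · let k : ℂ := (μl v)⁻¹ * c⁻¹
    let Z : LinearMap.GeneralLinearGroup ℂ (centre H) :=
      Units.map (algebraMap ℂ (Module.End ℂ (centre H)) : ℂ →* Module.End ℂ (centre H))
        (Units.mk0 k (mul_ne_zero (inv_ne_zero hn) (inv_ne_zero hc)))
    refine ⟨LinearMap.GeneralLinearGroup.congrLinearEquiv f (Z * (A * T⁻¹ * X * T⁻¹)),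
      fun w => ?_, ?_⟩
    · obtain ⟨z, rfl⟩ := f.surjective w
      have h : (LinearMap.GeneralLinearGroup.congrLinearEquiv f
          (Z * (A * T⁻¹ * X * T⁻¹))).val (f z) =
          k • f ((A * T⁻¹ * X * T⁻¹).val z) := by
        change f (k • ((A * T⁻¹ * X * T⁻¹).val (f.symm (f z)))) = _
        rw [f.symm_apply_apply, map_smul]
      refine (congrArg Subtype.val h).trans ?_
      rw [loopOf_inv hR hcyc hfac hv hμl, handleRep_jB, map_smul, LinearMap.smul_apply]
      refine Eq.trans ?_ (congrArg _ (valB_centreToSLF hR hcyc hfac hv hμl hμr hc hνc z).symm)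
      exact mul_smul _ _ _
    · change PGL.conj f ((Z * (A * T⁻¹ * X * T⁻¹) : LinearMap.GeneralLinearGroup ℂ (centre H)) :
        PGL (centre H)) = PGL.conj f (σ tauB)
      have hAT : (A : PGL (centre H)) * T = T * A := centreAntipode_mul_centreTwist hR hb hS
      -- Needed because τ_b = t⁻¹s⁻¹t⁻¹ involves the inverse of 𝒮, while the computation produced A
      -- and 𝒮 itself.
      have hXinv : (X : PGL (centre H))⁻¹ = A * X :=
        inv_eq_of_mul_eq_one_left (by rw [mul_assoc, hXX, hA2])
      refine congrArg _ ((PGL.mk_eq_mk (Q := A * T⁻¹ * X * T⁻¹)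
        (mul_ne_zero (inv_ne_zero hn) (inv_ne_zero hc))
        fun z => rfl).trans ?_)
      rw [tauB_eq, map_mul, map_mul, map_inv, map_inv, hσt, hσs, hXinv]
      have hAT' : (A : PGL (centre H)) * (T : PGL (centre H))⁻¹ = (T : PGL (centre H))⁻¹ * A := by
        rw [eq_inv_mul_iff_mul_eq, ← mul_assoc, ← hAT, mul_inv_cancel_right]
      change (A : PGL (centre H)) * (T : PGL (centre H))⁻¹ * X * (T : PGL (centre H))⁻¹ = _
      rw [hAT', mul_assoc _ _ (X : PGL (centre H))]
  · exact (opS_apply_of_central R μl (mem_centre_iff.1 z.2)).symm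
  · change (centreToSLF hR hcyc c z : Module.Dual ℂ H) x = _
    rw [centreToSLF_apply, ← hνc, ← mul_assoc]
    rfl
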